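/- **Setting.** Let $(X,\mathcal A)$ be a standard Borel space, $\mu$ a $\sigma$-finite measure on $\mathcal A$ which is continuous ($\mu(\{x\})=0$ for all $x\in X$) and infinite ($\mu(X)=\infty$), and let $T$ be an invertible bi-measurable $\mu$-preserving transformation of $X$ which is ergodic. Let $X^*$ be the set of counting measures $\nu=\sum_{i\in I}\delta_{x_i}$ on $X$ ($I$ countable), put $N(A)(\nu)=\nu(A)$ for $A\in\mathcal A$, $\mathcal A^*=\sigma\{N(A):A\in\mathcal A\}$, and let $\mu^*$ be the law of the Poisson measure of intensity $\mu$, i.e. the probability measure on $\mathcal A^*$ such that for pairwise disjoint $A_1,\dots,A_k\in\mathcal A$ with $0<\mu(A_i)<\infty$ the variables $N(A_1),\dots,N(A_k)$ are independent and Poisson distributed with parameters $\mu(A_1),\dots,\mu(A_k)$. The Poisson suspension is $(X^*,\mathcal A^*,\mu^*,T_*)$ with $T_*\nu=\nu\circ T^{-1}$. For $n\ge 0$ the chaos $H^n\subset L^2(\mu^*)$ (complex scalars) is the range of the $n$-fold stochastic integral; equivalently, the closed linear span of the variables $\prod_{i=1}^n\bigl(N(A_i)-\mu(A_i)\bigr)$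 with $A_1,\dots,A_n\in\mathcal A$ pairwise disjoint of finite measure. **Factors.** A factor of a system $(Y,\mathcal B,m,S)$ is a sub-$\sigma$-algebra $\mathcal C\subset\mathcal B$ with $S^{-1}\mathcal C=\mathcal C$; it is a $\sigma$-finite factor if moreover $m|_{\mathcal C}$ is $\sigma$-finite. Equality, inclusion and triviality of $\sigma$-algebras are understood modulo null sets; a $\sigma$-algebra is trivial if all its sets are null or conull. A probability-preserving system is prime if its only factors are the trivial one and the full $\sigma$-algebra; an ergodic infinite-measure-preserving system is prime if its only $\sigma$-finite factor is the full $\sigma$-algebra. A Poissonian factor of the suspension is either $\{\emptyset,X^*\}$ or a $\sigma$-algebra $\sigma\{N(C):C\in\mathcal G\}$, where $\mathcal G$ is a $\sigma$-finite factor of the restriction of $(X,\mathcal A,\mu,T)$ to some $T$-invariant set $A\in\mathcal A$. The suspension has property CP if for every factor $\mathcal C\subset\mathcal A^*$ the conditional expectation $\mathbb E[\,\cdot\mid\mathcal C]$ on $L^2(\mu^*)$ maps $H^n$ into $H^n$ for every $n\ge0$. **Theorem.** Assume that the Poisson suspension $(X^*,\mathcal A^*,\mu^*,T_*)$ has property CP.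 Then every non-trivial factor $\mathcal C\subset\mathcal A^*$ of the suspension contains a non-trivial Poissonian factor. In particular, if moreover $(X,\mathcal A,\mu,T)$ is prime, then $(X^*,\mathcal A^*,\mu^*,T_*)$ is prime. -/

import Mathlib

open MeasureTheory ProbabilityTheory Set
open scoped ENNReal NNReal

namespace PoissonSuspension

section Factors

/-- A factor of the system `(X, mX, μ, T)`: a sub-σ-algebra `C` of `mX` such that `T⁻¹ C = C`
(`C.comap T` is the σ-algebra `{T⁻¹ s : s ∈ C}`). -/
structure IsFactor {X : Type*} {mX : MeasurableSpace X} (T : X → X) (_μ : Measure[mX] X)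
    (C : MeasurableSpace X) : Prop where
  le : C ≤ mX
  comap_eq : C.comap T = C

/-- A `σ`-finite factor: a factor `B` such that the restriction of `μ` to `B` is `σ`-finite. -/
structure IsSigmaFiniteFactor {X : Type*} {mX : MeasurableSpace X} (T : X → X) (μ : Measure[mX] X)
    (B : MeasurableSpace X) : Prop where
  isFactor : IsFactor T μ B
  sigmaFinite : SigmaFinite (μ.trim isFactor.le)

/-- Inclusion of σ-algebras modulo `μ`-null sets. -/
def LeMod {X : Type*} {mX : MeasurableSpace X} (μ : Measure[mX] X) (B C : MeasurableSpace X) :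
    Prop :=
  ∀ s : Set X, MeasurableSet[B] s → ∃ t : Set X, MeasurableSet[C] t ∧ s =ᵐ[μ] t

/-- `C` coincides, modulo `μ`-null sets, with the σ-algebra `{∅, X}`. -/
def IsTrivialMod {X : Type*} {mX : MeasurableSpace X} (μ : Measure[mX] X) (C : MeasurableSpace X) :
    Prop :=
  LeMod μ C ⊥

/-- A probability-preserving system is prime if its only factors, modulo null sets, are the full
σ-algebra and the trivial one. -/
def IsPrimeProbSystem {X : Type*} {mX : MeasurableSpace X} (T : X → X) (P : Measure[mX] X) : Prop :=
  ∀ C : MeasurableSpace X, IsFactor T P C → LeMod P mX C ∨ IsTrivialMod P C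

/-- An (ergodic) infinite-measure-preserving system is prime if its only `σ`-finite factor, modulo
null sets, is the full σ-algebra. -/
def IsPrimeInfiniteSystem {X : Type*} {mX : MeasurableSpace X} (T : X → X) (μ : Measure[mX] X) :
    Prop :=
  ∀ B : MeasurableSpace X, IsSigmaFiniteFactor T μ B → LeMod μ mX B

end Factors

section PoissonSpace

/-- The space `X*` of counting measures on `X`, i.e. measures `∑ i ∈ I, δ (x i)`, `I` countable. -/
def CountingMeasures (X : Type*) [MeasurableSpace X] : Type _ :=
  {ν : Measure X // ∃ (I : Type) (_ : Countable I) (x : I → X),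
    ν = Measure.sum fun i => Measure.dirac (x i)}

/-- `N(A) : X* → [0, ∞]`, `ν ↦ ν(A)`. -/
def N {X : Type*} [MeasurableSpace X] (A : Set X) (ν : CountingMeasures X) : ℝ≥0∞ := ν.1 A

/-- The σ-algebra generated by the maps `N(A)`, for `A` in a family `S` of sets. -/
abbrev sigmaN {X : Type*} [MeasurableSpace X] (S : Set (Set X)) :
    MeasurableSpace (CountingMeasures X) :=
  ⨆ A ∈ S, MeasurableSpace.comap (N A) (inferInstance : MeasurableSpace ℝ≥0∞)

/-- The σ-algebra `𝒜*` on `X*`, generated by all the maps `N(A)`, `A` measurable. -/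
instance {X : Type*} [MeasurableSpace X] : MeasurableSpace (CountingMeasures X) :=
  sigmaN {A | MeasurableSet A}

/-- `P` is the law `μ*` of the Poisson measure with intensity `μ`: for pairwise disjoint measurable
sets `A i` with `0 < μ (A i) < ∞`, the variables `N (A i)` are independent, and `N (A i)` has the
Poisson law with parameter `μ (A i)`. -/
structure IsPoissonMeasure {X : Type*} [MeasurableSpace X] (μ : Measure X)
    (P : Measure (CountingMeasures X)) : Prop where
  isProbabilityMeasure : IsProbabilityMeasure P
  iIndepFun : ∀ (k : ℕ) (A : Fin k → Set X), (∀ i, MeasurableSet (A i)) →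
    Pairwise (fun i j => Disjoint (A i) (A j)) → (∀ i, 0 < μ (A i) ∧ μ (A i) < ∞) →
    ProbabilityTheory.iIndepFun (fun i => N (A i)) P
  map_eq : ∀ A : Set X, MeasurableSet A → 0 < μ A → μ A < ∞ →
    P.map (N A) = (poissonMeasure (μ A).toNNReal).map (fun n : ℕ => (n : ℝ≥0∞))

/-- The transformation `T_* : ν ↦ ν ∘ T⁻¹` of `X*`. -/
noncomputable def suspension {X : Type*} [MeasurableSpace X] (T : X ≃ᵐ X)
    (ν : CountingMeasures X) : CountingMeasures X :=
  ⟨ν.1.map T, by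
    obtain ⟨ν, I, hI, x, rfl⟩ := ν
    refine ⟨I, hI, fun i => T (x i), ?_⟩
    rw [Measure.map_sum T.measurable.aemeasurable]
    simp [Measure.map_dirac' T.measurable]⟩

/-- The chaos `H^n` of order `n`: the closed linear span in `L²(μ*)` of the multiple stochastic
integrals of the indicators of products `A₁ × ⋯ × Aₙ` with pairwise disjoint `Aᵢ` of finite
measure, that is of the variables `∏ i, (N (A i) - μ (A i))`. For a continuous `μ` these indicators
generate, after symmetrization, a dense subspace of the symmetric functions of `L²(μ^{⊗ n})`, so
that this is the range of the `n`-fold stochastic integral. -/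
noncomputable def chaos {X : Type*} [MeasurableSpace X] (μ : Measure X)
    (P : Measure (CountingMeasures X)) (n : ℕ) : Submodule ℂ (Lp ℂ 2 P) :=
  (Submodule.span ℂ {F : Lp ℂ 2 P | ∃ A : Fin n → Set X,
    (∀ i, MeasurableSet (A i)) ∧ Pairwise (fun i j => Disjoint (A i) (A j)) ∧
    (∀ i, μ (A i) < ∞) ∧
    F =ᵐ[P] fun ν => ∏ i, (((N (A i) ν).toReal - (μ (A i)).toReal : ℝ) : ℂ)}).topologicalClosure

/-- Property CP: the conditional expectation with respect to any factor of the suspension maps each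
chaos into itself. -/
def PropertyCP {X : Type*} [MeasurableSpace X] (T : X ≃ᵐ X) (μ : Measure X)
    (P : Measure (CountingMeasures X)) : Prop :=
  ∀ (C : MeasurableSpace (CountingMeasures X)) (hC : IsFactor (suspension T) P C) (n : ℕ)
    (F : Lp ℂ 2 P), F ∈ chaos μ P n → (condExpL2 ℂ ℂ hC.le F).1 ∈ chaos μ P n

/-- The restriction of `μ` to the subset `A`, as a measure on the space `A` (with the trace of the
σ-algebra of `X`). -/
noncomputable def restrictMeasure {X : Type*} [MeasurableSpace X] (μ : Measure X) (A : Set X) :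
    Measure A :=
  μ.comap Subtype.val

/-- Poissonian factors of the suspension: the trivial σ-algebra, and the σ-algebras
`σ{N(C) : C ∈ G}`, where `G` is a `σ`-finite factor of the system restricted to some `T`-invariant
measurable set `A`. -/
def IsPoissonianFactor {X : Type*} [MeasurableSpace X] (T : X ≃ᵐ X) (μ : Measure X)
    (D : MeasurableSpace (CountingMeasures X)) : Prop :=
  D = ⊥ ∨ ∃ (A : Set X) (_ : MeasurableSet A) (hTA : T ⁻¹' A = A) (G : MeasurableSpace A),
    IsSigmaFiniteFactor (MapsTo.restrict T A A hTA.ge) (restrictMeasure μ A) G ∧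
    D = sigmaN {C | ∃ c : Set A, MeasurableSet[G] c ∧ C = Subtype.val '' c}

end PoissonSpace

end PoissonSuspension

/-! Let C be a non-trivial factor. The chaoses H^n are total in L²(μ*), so the centred indicator of
a non-trivial event of C has a non-zero projection on some H^n with n ≥ 1. By property CP this
projection is C-measurable (`aestronglyMeasurable_component`): conditional expectation given C is
self-adjoint and preserves H^n, hence commutes with the projection on H^n.

Descent to n = 1. For F in H^n, the quantity E[|F|² N(A)] - μ(A) E|F|² measures how many of the n
coordinates of the kernel of F lie in A. It is between 0 and n‖F‖², and equals n‖F‖² when A carries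
F. If E[N(A) | C] = μ(A) for every A of finite measure, it vanishes for the C-measurable F above and
all A, which forces F = 0 (`eq_zero_of_lintegral_weighted`). So some E[N(A) - μ(A) | C] is non-zero,
and by CP it lies in H^1.

From functions to sets. H^1 is the isometric image of L²(μ) under the stochastic integral I. Let K
be the closed space of real f with I(f) C-measurable. The projection of exp(i I(f)) - 1 on H^1 is
E[exp(i I(f))] · I(exp(i f) - 1), and the scalar never vanishes (`inner_stochInt_expLp`,
`charInt_ne_zero`). By CP again, K is stable under f ↦ cos f - 1 and f ↦ sin f. Iterating x ↦ x -
sin(2πx)/(2π) drives values in [0, 1] to 0, 1/2 or 1, so that K, being non-zero, contains the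
indicator of a non-null set of finite measure (`IsTrigStable.exists_indLp_mem`).

The factor. The sets B such that 1_{A ∩ B} is in K whenever 1_A is form a T-invariant σ-algebra G.
By ergodicity the translates of one non-null set with indicator in K cover X up to a null set, so G
is σ-finite and N(B) is measurable for the completion of C for every B in G. Hence σ{N(B) : B ∈ G}
is the required Poissonian factor. If the base is prime, G is everything modulo μ, and so is C
modulo μ*. -/

namespace PoissonSuspension

/-! ### Moments and generating function of the Poisson law -/

section PoissonLaw

/-- The Chen–Stein identity, from k · r^k / k! = r · r^(k-1) / (k-1)!. It needs no integrability,
since the two series agree after reindexing and scaling. The polynomial moments below are derived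
from it. -/
lemma integral_poissonMeasure_natCast_mul (r : ℝ≥0) (g : ℕ → ℂ) :
    ∫ k, (k : ℂ) * g k ∂(poissonMeasure r) = r * ∫ k, g (k + 1) ∂(poissonMeasure r) := by
  rw [integral_poissonMeasure, integral_poissonMeasure, ← tsum_mul_left,
    ← Nat.succ_injective.tsum_eq (f := fun n : ℕ =>
      (Real.exp (-r) * (r : ℝ) ^ n / (n.factorial : ℝ)) • ((n : ℂ) * g n))]
  · refine tsum_congr fun k => ?_
    have h1 : ((k : ℂ) + 1) ≠ 0 := by exact_mod_cast Nat.succ_ne_zero k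
    have h2 : ((k.factorial : ℕ) : ℂ) ≠ 0 := by exact_mod_cast k.factorial_ne_zero
    simp only [Nat.succ_eq_add_one, Nat.factorial_succ, Complex.real_smul]
    push_cast
    field_simp
    ring
  · intro n hn
    rcases n with _ | n
    · simp at hn
    · exact ⟨n, rfl⟩

lemma integrable_poissonMeasure_pow (r : ℝ≥0) (w : ℂ) :
    Integrable (fun k : ℕ => w ^ k) (poissonMeasure r) := by
  rw [integrable_poissonMeasure_iff]
  have := (Real.summable_pow_div_factorial (r * ‖w‖)).mul_left (Real.exp (-r))
  refine this.congr fun k => ?_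
  rw [norm_pow, mul_pow]
  ring

lemma integral_poissonMeasure_pow (r : ℝ≥0) (w : ℂ) :
    ∫ k, w ^ k ∂(poissonMeasure r) = Complex.exp (r * (w - 1)) := by
  rw [integral_poissonMeasure]
  have h : ∀ k : ℕ, (Real.exp (-r) * (r : ℝ) ^ k / (k.factorial : ℝ)) • w ^ k =
      Complex.exp (-r) * ((r * w) ^ k / (k.factorial : ℂ)) := fun k => by
    rw [Complex.real_smul, mul_pow]
    push_cast
    ring
  simp_rw [h]
  rw [tsum_mul_left, (NormedSpace.expSeries_div_hasSum_exp ((r : ℂ) * w)).tsum_eq,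
    ← Complex.exp_eq_exp_ℂ, ← Complex.exp_add]
  congr 1
  ring

lemma integrable_poissonMeasure_natCast_pow (r : ℝ≥0) (n : ℕ) :
    Integrable (fun k : ℕ => (k : ℝ) ^ n) (poissonMeasure r) := by
  have h : Integrable (fun k : ℕ => (n.factorial : ℝ) * ‖(Real.exp 1 : ℂ) ^ k‖)
      (poissonMeasure r) :=
    (integrable_poissonMeasure_pow r (Real.exp 1)).norm.const_mul _
  refine h.mono' (Measurable.of_discrete).aestronglyMeasurable (Filter.Eventually.of_forall ?_)
  intro k
  have h1 := Real.pow_div_factorial_le_exp (k : ℝ) (Nat.cast_nonneg k) n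
  have h2 : ‖(Real.exp 1 : ℂ) ^ k‖ = Real.exp k := by
    rw [norm_pow, Complex.norm_real, Real.norm_of_nonneg (Real.exp_pos _).le, ← Real.exp_nat_mul,
      mul_one]
  rw [Real.norm_of_nonneg (by positivity), h2]
  rw [div_le_iff₀ (by positivity)] at h1
  linarith

lemma integrable_poissonMeasure_natCast_pow_complex (r : ℝ≥0) (n : ℕ) :
    Integrable (fun k : ℕ => (k : ℂ) ^ n) (poissonMeasure r) := by
  have := (integrable_poissonMeasure_natCast_pow r n).ofReal (𝕜 := ℂ)
  simpa using this

lemma integrable_poissonMeasure_natCast (r : ℝ≥0) :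
    Integrable (fun k : ℕ => (k : ℂ)) (poissonMeasure r) := by
  simpa using integrable_poissonMeasure_natCast_pow_complex r 1

lemma integral_poissonMeasure_natCast (r : ℝ≥0) :
    ∫ k : ℕ, (k : ℂ) ∂(poissonMeasure r) = r := by
  simpa using integral_poissonMeasure_natCast_mul r (fun _ => 1)

lemma integral_poissonMeasure_natCast_sq (r : ℝ≥0) :
    ∫ k : ℕ, (k : ℂ) ^ 2 ∂(poissonMeasure r) = r ^ 2 + r := by
  have h := integral_poissonMeasure_natCast_mul r (fun k => (k : ℂ))
  simp only [Nat.cast_add, Nat.cast_one] at h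
  rw [integral_add (integrable_poissonMeasure_natCast r) (integrable_const _),
    integral_poissonMeasure_natCast] at h
  simp_rw [pow_two, h]
  simp
  ring

lemma integral_poissonMeasure_natCast_cube (r : ℝ≥0) :
    ∫ k : ℕ, (k : ℂ) ^ 3 ∂(poissonMeasure r) = r ^ 3 + 3 * r ^ 2 + r := by
  have h := integral_poissonMeasure_natCast_mul r (fun k => (k : ℂ) ^ 2)
  have e : ∀ k : ℕ, ((k + 1 : ℕ) : ℂ) ^ 2 = (k : ℂ) ^ 2 + (2 * (k : ℂ) + 1) := fun k => by
    push_cast; ring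
  have i1 : Integrable (fun k : ℕ => 2 * (k : ℂ)) (poissonMeasure r) :=
    (integrable_poissonMeasure_natCast r).const_mul 2
  have i2 : Integrable (fun k : ℕ => 2 * (k : ℂ) + 1) (poissonMeasure r) :=
    i1.add (integrable_const _)
  simp_rw [e] at h
  rw [integral_add (integrable_poissonMeasure_natCast_pow_complex r 2) i2,
    integral_add i1 (integrable_const _), integral_const_mul,
    integral_poissonMeasure_natCast, integral_poissonMeasure_natCast_sq] at h
  have e3 : ∀ k : ℕ, (k : ℂ) ^ 3 = k * (k : ℂ) ^ 2 := fun k => by ring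
  simp_rw [e3, h]
  simp
  ring

lemma integral_poissonMeasure_centered (r : ℝ≥0) :
    ∫ k : ℕ, ((k : ℂ) - r) ∂(poissonMeasure r) = 0 := by
  rw [integral_sub (integrable_poissonMeasure_natCast r) (integrable_const _),
    integral_poissonMeasure_natCast]
  simp

lemma integral_poissonMeasure_centered_mul (r : ℝ≥0) :
    ∫ k : ℕ, ((k : ℂ) - r) * k ∂(poissonMeasure r) = r := by
  have e : ∀ k : ℕ, ((k : ℂ) - r) * k = (k : ℂ) ^ 2 - r * k := fun k => by ring
  have i1 := integrable_poissonMeasure_natCast r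
  simp_rw [e]
  rw [integral_sub (integrable_poissonMeasure_natCast_pow_complex r 2) (i1.const_mul _),
    integral_const_mul, integral_poissonMeasure_natCast, integral_poissonMeasure_natCast_sq]
  ring

lemma integral_poissonMeasure_centered_sq (r : ℝ≥0) :
    ∫ k : ℕ, ((k : ℂ) - r) * ((k : ℂ) - r) ∂(poissonMeasure r) = r := by
  have e : ∀ k : ℕ, ((k : ℂ) - r) * ((k : ℂ) - r) = ((k : ℂ) - r) * k - r * (k - r) :=
    fun k => by ring
  have i1 := integrable_poissonMeasure_natCast r
  have i2 : Integrable (fun k : ℕ => ((k : ℂ) - r) * k) (poissonMeasure r) :=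
    ((integrable_poissonMeasure_natCast_pow_complex r 2).sub (i1.const_mul (r : ℂ))).congr
      (Filter.Eventually.of_forall fun k => by simp only [Pi.sub_apply]; ring)
  have i3 : Integrable (fun k : ℕ => (r : ℂ) * ((k : ℂ) - r)) (poissonMeasure r) :=
    (i1.sub (integrable_const _)).const_mul _
  simp_rw [e]
  rw [integral_sub i2 i3, integral_const_mul,
    integral_poissonMeasure_centered, integral_poissonMeasure_centered_mul]
  simp

lemma integral_poissonMeasure_centered_sq_mul (r : ℝ≥0) :
    ∫ k : ℕ, ((k : ℂ) - r) * ((k : ℂ) - r) * k ∂(poissonMeasure r) = r * (r + 1) := by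
  have e : ∀ k : ℕ, ((k : ℂ) - r) * ((k : ℂ) - r) * k =
      (k : ℂ) ^ 3 - ((2 * r) * k ^ 2 - r ^ 2 * k) := fun k => by ring
  have i1 : Integrable (fun k : ℕ => (r : ℂ) ^ 2 * k) (poissonMeasure r) :=
    (integrable_poissonMeasure_natCast r).const_mul _
  have i2 : Integrable (fun k : ℕ => 2 * (r : ℂ) * k ^ 2) (poissonMeasure r) :=
    (integrable_poissonMeasure_natCast_pow_complex r 2).const_mul _
  have i3 : Integrable (fun k : ℕ => 2 * (r : ℂ) * k ^ 2 - r ^ 2 * k) (poissonMeasure r) :=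
    i2.sub i1
  simp_rw [e]
  rw [integral_sub (integrable_poissonMeasure_natCast_pow_complex r 3) i3, integral_sub i2 i1,
    integral_const_mul, integral_const_mul, integral_poissonMeasure_natCast_cube,
    integral_poissonMeasure_natCast_sq, integral_poissonMeasure_natCast]
  ring

lemma integrable_poissonMeasure_natCast_mul_pow (r : ℝ≥0) (w : ℂ) :
    Integrable (fun k : ℕ => (k : ℂ) * w ^ k) (poissonMeasure r) := by
  have h := (integrable_poissonMeasure_pow r (2 * ‖w‖ : ℝ)).norm
  refine h.mono' (Measurable.of_discrete).aestronglyMeasurable (Filter.Eventually.of_forall ?_)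
  intro k
  have h1 : (k : ℝ) ≤ 2 ^ k := by exact_mod_cast (Nat.lt_two_pow_self (n := k)).le
  rw [norm_mul, norm_pow, norm_pow, Complex.norm_real, Complex.norm_natCast,
    Real.norm_of_nonneg (by positivity), mul_pow]
  gcongr

lemma integral_poissonMeasure_centered_mul_pow (r : ℝ≥0) (w : ℂ) :
    ∫ k : ℕ, ((k : ℂ) - r) * w ^ k ∂(poissonMeasure r) =
      r * (w - 1) * Complex.exp (r * (w - 1)) := by
  have h := integral_poissonMeasure_natCast_mul r (fun k => w ^ k)
  simp_rw [pow_succ, integral_mul_const, integral_poissonMeasure_pow] at h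
  simp_rw [sub_mul]
  rw [integral_sub (integrable_poissonMeasure_natCast_mul_pow r w)
    ((integrable_poissonMeasure_pow r w).const_mul _), integral_const_mul, h,
    integral_poissonMeasure_pow]
  ring

end PoissonLaw

/-! ### Random variables with finite moments of all orders -/

section Moments

variable {Ω : Type*} {mΩ : MeasurableSpace Ω} {P : Measure Ω}

/-- The random variables all of whose moments are finite. -/
def HasAllMoments (F : Ω → ℂ) (P : Measure Ω) : Prop :=
  ∀ n : ℕ, MemLp F n P

lemma HasAllMoments.mul {F G : Ω → ℂ} (hF : HasAllMoments F P) (hG : HasAllMoments G P) :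
    HasAllMoments (fun x => F x * G x) P := by
  intro n
  have : ENNReal.HolderTriple ((2 * n : ℕ) : ℝ≥0∞) ((2 * n : ℕ) : ℝ≥0∞) (n : ℝ≥0∞) := by
    constructor
    rcases Nat.eq_zero_or_pos n with rfl | hn
    · simp
    · push_cast
      rw [ENNReal.mul_inv (Or.inl two_ne_zero) (Or.inl ENNReal.ofNat_ne_top), ← add_mul,
        ENNReal.inv_two_add_inv_two, one_mul]
  exact (hG (2 * n)).mul' (hF (2 * n))

lemma HasAllMoments.const [IsFiniteMeasure P] (c : ℂ) : HasAllMoments (fun _ => c) P :=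
  fun _ => memLp_const c

lemma HasAllMoments.add {F G : Ω → ℂ} (hF : HasAllMoments F P) (hG : HasAllMoments G P) :
    HasAllMoments (fun x => F x + G x) P :=
  fun n => (hF n).add (hG n)

lemma HasAllMoments.sum {ι : Type*} {s : Finset ι} {F : ι → Ω → ℂ}
    (hF : ∀ i ∈ s, HasAllMoments (F i) P) : HasAllMoments (fun x => ∑ i ∈ s, F i x) P :=
  fun n => memLp_finsetSum s fun i hi => hF i hi n

lemma HasAllMoments.prod [IsFiniteMeasure P] {ι : Type*} {s : Finset ι} {F : ι → Ω → ℂ}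
    (hF : ∀ i ∈ s, HasAllMoments (F i) P) : HasAllMoments (fun x => ∏ i ∈ s, F i x) P := by
  classical
  induction s using Finset.induction_on with
  | empty => simpa using HasAllMoments.const 1
  | insert a s ha ih =>
    simp_rw [Finset.prod_insert ha]
    exact (hF a (Finset.mem_insert_self a s)).mul
      (ih fun i hi => hF i (Finset.mem_insert_of_mem hi))

lemma HasAllMoments.conj {F : Ω → ℂ} (hF : HasAllMoments F P) :
    HasAllMoments (fun x => (starRingEnd ℂ) (F x)) P :=
  fun n => (hF n).star

lemma HasAllMoments.congr {F G : Ω → ℂ} (hF : HasAllMoments F P) (h : F =ᵐ[P] G) :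
    HasAllMoments G P :=
  fun n => (memLp_congr_ae h).1 (hF n)

lemma HasAllMoments.memLp_two {F : Ω → ℂ} (hF : HasAllMoments F P) : MemLp F 2 P := by
  simpa using hF 2

lemma HasAllMoments.integrable {F : Ω → ℂ} (hF : HasAllMoments F P) : Integrable F P :=
  memLp_one_iff_integrable.1 (by simpa using hF 1)

end Moments

/-! ### From the definition of the Poisson measure to integer-valued counts -/

section PoissonLaw

variable {X : Type*} [MeasurableSpace X]

lemma measurable_N {A : Set X} (hA : MeasurableSet A) : Measurable (N A) :=
  (comap_measurable (N A)).mono (le_iSup₂_of_le A hA le_rfl) le_rfl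

/-- The integer value of `N A`. -/
noncomputable def num (A : Set X) (ν : CountingMeasures X) : ℕ := ⌊(N A ν).toReal⌋₊

/-- The compensated variable `N A - μ A`. -/
noncomputable def ctr (μ : Measure X) (A : Set X) (ν : CountingMeasures X) : ℝ :=
  (N A ν).toReal - (μ A).toReal

lemma measurable_num {A : Set X} (hA : MeasurableSet A) : Measurable (num A) :=
  Nat.measurable_floor.comp (measurable_N hA).ennreal_toReal

lemma num_eq_of_N_eq {A : Set X} {ν : CountingMeasures X} {n : ℕ} (h : N A ν = n) :
    num A ν = n := by
  simp [num, h]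

/-- Finite families of pairwise disjoint sets of finite measure. -/
structure IsDisjointFamily (μ : Measure X) {ι : Type*} (B : ι → Set X) : Prop where
  measurableSet : ∀ i, MeasurableSet (B i)
  disjoint : Pairwise (fun i j => Disjoint (B i) (B j))
  measure_lt_top : ∀ i, μ (B i) < ∞

/-- The Poisson property, including sets of measure zero and arbitrary finite index types. -/
structure IsPoissonProcess (μ : Measure X) (P : Measure (CountingMeasures X)) : Prop where
  isProbabilityMeasure : IsProbabilityMeasure P
  ae_N_eq : ∀ A, MeasurableSet A → μ A < ∞ → ∀ᵐ ν ∂P, N A ν = num A ν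
  map_num : ∀ A, MeasurableSet A → μ A < ∞ → P.map (num A) = poissonMeasure (μ A).toNNReal
  iIndepFun_num : ∀ {ι : Type} [Fintype ι] (B : ι → Set X), IsDisjointFamily μ B →
    iIndepFun (fun i => num (B i)) P

lemma N_union {A B : Set X} (h : Disjoint A B) (hB : MeasurableSet B) (ν : CountingMeasures X) :
    N (A ∪ B) ν = N A ν + N B ν :=
  measure_union h hB

lemma poissonMeasure_zero : poissonMeasure 0 = Measure.dirac 0 := by
  refine Measure.ext_of_singleton fun n => ?_
  rw [poissonMeasure_singleton]
  rcases n with _ | n <;> simp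

variable {μ : Measure X} {P : Measure (CountingMeasures X)}

/-- The definition of the Poisson law says nothing about null sets. Since μ is infinite, the
complement of A contains B with 0 < μ(B) < ∞. Then N(B ∪ A) = N(B) + N(A) has the same law as N(B),
with finite mean, hence E N(A) = 0. -/
lemma IsPoissonMeasure.ae_N_eq_zero [SigmaFinite μ] (hμ : μ univ = ∞) (hP : IsPoissonMeasure μ P)
    {A : Set X} (hA : MeasurableSet A) (h0 : μ A = 0) : ∀ᵐ ν ∂P, N A ν = 0 := by
  have hc : (0 : ℝ≥0∞) < μ Aᶜ := by
    have h := measure_add_measure_compl (μ := μ) hA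
    rw [h0, zero_add, hμ] at h
    simp [h]
  obtain ⟨B, hB, hBA, hB0, hB1⟩ := Measure.exists_subset_measure_lt_top hA.compl hc
  have hd : Disjoint B A := disjoint_left.2 fun x hx hxA => hBA hx hxA
  have hU : μ (B ∪ A) = μ B := by rw [measure_union hd hA, h0, add_zero]
  have hUm := hP.map_eq (B ∪ A) (hB.union hA) (hU ▸ hB0) (hU ▸ hB1)
  rw [hU, ← hP.map_eq B hB hB0 hB1] at hUm
  have h1 : ∫⁻ ν, N (B ∪ A) ν ∂P = ∫⁻ ν, N B ν ∂P := by
    have e1 := lintegral_map (μ := P) measurable_id (measurable_N (hB.union hA))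
    have e2 := lintegral_map (μ := P) measurable_id (measurable_N hB)
    rw [hUm] at e1
    exact e1.symm.trans e2
  have hfin : ∫⁻ ν, N B ν ∂P ≠ ∞ := by
    have e := lintegral_map (μ := P) measurable_id (measurable_N hB)
    rw [hP.map_eq B hB hB0 hB1, lintegral_map measurable_id (Measurable.of_discrete)] at e
    simp only [id] at e
    rw [← e]
    have hi := (integrable_poissonMeasure_natCast_pow (μ B).toNNReal 1).lintegral_lt_top
    simp only [pow_one, ENNReal.ofReal_natCast] at hi
    exact hi.ne
  simp_rw [N_union hd hA] at h1
  rw [lintegral_add_right _ (measurable_N hA)] at h1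
  have h2 : ∫⁻ ν, N A ν ∂P = 0 := by
    by_contra hne
    exact (ENNReal.lt_add_right hfin hne).ne' h1
  exact (lintegral_eq_zero_iff (measurable_N hA)).1 h2

lemma iIndepFun_of_subtype {ι Ω : Type*} {mΩ : MeasurableSpace Ω} {P : Measure Ω}
    [IsProbabilityMeasure P] {f : ι → Ω → ℕ} {p : ι → Prop}
    (h : iIndepFun (fun i : {i // p i} => f i) P) (h0 : ∀ i, ¬ p i → ∀ᵐ ω ∂P, f i ω = 0) :
    iIndepFun f P := by
  classical
  let g : ι → Ω → ℕ := fun i => if p i then f i else fun _ => 0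
  suffices hg : iIndepFun g P by
    refine hg.congr fun i => ?_
    by_cases hi : p i
    · simp [g, hi]
    · filter_upwards [h0 i hi] with ω hω
      simp [g, hi, hω]
  rw [iIndepFun_iff_measure_inter_preimage_eq_mul] at h ⊢
  intro S E hE
  -- An index outside `p` has `g i = 0`: its event is empty if 0 ∉ E i, and then both sides vanish;
  -- otherwise it is the whole space and drops out of both sides.
  by_cases hz : ∃ i ∈ S, ¬ p i ∧ 0 ∉ E i
  · obtain ⟨i, hiS, hip, hi0⟩ := hz
    have he : g i ⁻¹' E i = ∅ := by
      ext ω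
      simp [g, hip, hi0]
    rw [Finset.prod_eq_zero hiS (by rw [he, measure_empty])]
    exact measure_mono_null (iInter₂_subset i hiS) (by rw [he, measure_empty])
  · push Not at hz
    have e1 : ⋂ i ∈ S, g i ⁻¹' E i = ⋂ i ∈ S.subtype p, f i ⁻¹' E i := by
      ext ω
      simp only [mem_iInter, mem_preimage, Finset.mem_subtype, Subtype.forall]
      refine forall_congr' fun i => ?_
      by_cases hi : p i
      · simp [g, hi]
      · simpa [g, hi] using fun hS => hz i hS hi
    rw [e1, h (S.subtype p) (sets := fun i => E i) fun i _ => MeasurableSet.of_discrete,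
      Finset.prod_subtype_eq_prod_filter (fun i => P (f i ⁻¹' E i)), Finset.prod_filter]
    refine Finset.prod_congr rfl fun i hi => ?_
    by_cases hp : p i
    · simp [g, hp]
    · have : g i ⁻¹' E i = univ := by
        ext ω
        simpa [g, hp] using hz i hi hp
      simp [hp, this]

lemma IsPoissonMeasure.isPoissonProcess [SigmaFinite μ] (hμ : μ univ = ∞)
    (hP : IsPoissonMeasure μ P) : IsPoissonProcess μ P := by
  have hprob := hP.isProbabilityMeasure
  have hN : ∀ A, MeasurableSet A → μ A < ∞ → ∀ᵐ ν ∂P, N A ν = num A ν := by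
    intro A hA hfin
    rcases eq_or_ne (μ A) 0 with h0 | h0
    · filter_upwards [hP.ae_N_eq_zero hμ hA h0] with ν hν
      simp [num, hν]
    · have hr : MeasurableSet {x | x ∈ range fun n : ℕ => (n : ℝ≥0∞)} :=
        (countable_range _).measurableSet
      have h1 : ∀ᵐ x ∂(P.map (N A)), x ∈ range fun n : ℕ => (n : ℝ≥0∞) := by
        rw [hP.map_eq A hA h0.bot_lt hfin,
          ae_map_iff (Measurable.of_discrete.aemeasurable) hr]
        exact Filter.Eventually.of_forall fun n => ⟨n, rfl⟩
      rw [ae_map_iff (measurable_N hA).aemeasurable hr] at h1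
      filter_upwards [h1] with ν hν
      obtain ⟨n, hn⟩ := hν
      rw [num_eq_of_N_eq hn.symm, ← hn]
  refine ⟨hprob, hN, fun A hA hfin => ?_, fun {ι} _ B hB => ?_⟩
  · rcases eq_or_ne (μ A) 0 with h0 | h0
    · have : num A =ᵐ[P] fun _ => 0 := by
        filter_upwards [hP.ae_N_eq_zero hμ hA h0] with ν hν
        simp [num, hν]
      rw [Measure.map_congr this, h0, ENNReal.toNNReal_zero, poissonMeasure_zero,
        Measure.map_const]
      simp
    · have e : num A = (fun x : ℝ≥0∞ => ⌊x.toReal⌋₊) ∘ N A := rfl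
      have hm : Measurable (fun x : ℝ≥0∞ => ⌊x.toReal⌋₊) :=
        Nat.measurable_floor.comp ENNReal.measurable_toReal
      rw [e, ← Measure.map_map hm (measurable_N hA), hP.map_eq A hA h0.bot_lt hfin,
        Measure.map_map hm Measurable.of_discrete]
      convert! Measure.map_id
      ext n
      simp
  · refine iIndepFun_of_subtype (p := fun i => 0 < μ (B i)) ?_ fun i hi => ?_
    · let e := (Fintype.equivFin {i // 0 < μ (B i)}).symm
      have h := hP.iIndepFun _ (fun j => B (e j)) (fun j => hB.measurableSet _)
        (fun j k hjk => hB.disjoint fun h => hjk (e.injective (Subtype.ext h)))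
        (fun j => ⟨(e j).2, hB.measure_lt_top _⟩)
      exact (h.comp (fun _ x => ⌊x.toReal⌋₊)
        fun _ => Nat.measurable_floor.comp ENNReal.measurable_toReal).of_precomp e.surjective
    · filter_upwards [hP.ae_N_eq_zero hμ (hB.measurableSet i) (by simpa using hi)] with ν hν
      simp [num, hν]

namespace IsPoissonProcess

lemma integral_comp_num (hP : IsPoissonProcess μ P) {A : Set X} (hA : MeasurableSet A)
    (hfin : μ A < ∞) (g : ℕ → ℂ) :
    ∫ ν, g (num A ν) ∂P = ∫ k, g k ∂(poissonMeasure (μ A).toNNReal) := by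
  rw [← hP.map_num A hA hfin, integral_map (measurable_num hA).aemeasurable
    Measurable.of_discrete.aestronglyMeasurable]

lemma integral_prod_comp_num (hP : IsPoissonProcess μ P) {ι : Type} [Fintype ι] {B : ι → Set X}
    (hB : IsDisjointFamily μ B) (g : ι → ℕ → ℂ) :
    ∫ ν, ∏ i, g i (num (B i) ν) ∂P = ∏ i, ∫ k, g i k ∂(poissonMeasure (μ (B i)).toNNReal) := by
  rw [(hP.iIndepFun_num B hB).integral_fun_prod_comp
    (fun i => (measurable_num (hB.measurableSet i)).aemeasurable)
    (fun i => Measurable.of_discrete.aestronglyMeasurable)]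
  exact Finset.prod_congr rfl fun i _ =>
    hP.integral_comp_num (hB.measurableSet i) (hB.measure_lt_top i) (g i)

lemma hasAllMoments_num (hP : IsPoissonProcess μ P) {A : Set X} (hA : MeasurableSet A)
    (hfin : μ A < ∞) : HasAllMoments (fun ν => (num A ν : ℂ)) P := by
  intro n
  have hm := (measurable_num hA)
  have h : MemLp (fun k : ℕ => (k : ℂ)) n (P.map (num A)) := by
    rw [hP.map_num A hA hfin]
    rcases eq_or_ne n 0 with rfl | hn
    · simpa using (Measurable.of_discrete (f := fun k : ℕ => (k : ℂ))).aestronglyMeasurable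
    · rw [← integrable_norm_rpow_iff Measurable.of_discrete.aestronglyMeasurable
        (by exact_mod_cast hn) (ENNReal.natCast_ne_top n)]
      simpa using integrable_poissonMeasure_natCast_pow (μ A).toNNReal n
  exact h.comp_of_map hm.aemeasurable

lemma ae_ctr_eq (hP : IsPoissonProcess μ P) {A : Set X} (hA : MeasurableSet A)
    (hfin : μ A < ∞) : ∀ᵐ ν ∂P, (ctr μ A ν : ℂ) = (num A ν : ℂ) - (μ A).toNNReal := by
  filter_upwards [hP.ae_N_eq A hA hfin] with ν hν
  simp only [ctr, hν]
  push_cast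
  simp [ENNReal.toReal]

lemma hasAllMoments_ctr (hP : IsPoissonProcess μ P) {A : Set X} (hA : MeasurableSet A)
    (hfin : μ A < ∞) : HasAllMoments (fun ν => (ctr μ A ν : ℂ)) P := by
  have := hP.isProbabilityMeasure
  refine ((hP.hasAllMoments_num hA hfin).add (HasAllMoments.const (-((μ A).toNNReal : ℂ)))).congr ?_
  filter_upwards [hP.ae_ctr_eq hA hfin] with ν hν
  rw [hν, sub_eq_add_neg]

end IsPoissonProcess

end PoissonLaw

/-! ### Refinement of finite families into disjoint atoms -/

section Atoms

variable {X : Type*} [MeasurableSpace X] {μ : Measure X} {P : Measure (CountingMeasures X)}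

/-- A finite family of sets of finite measure is a family of unions of members of a finite family
of pairwise disjoint nonempty sets of finite measure. -/
lemma exists_atoms {κ : Type*} [Fintype κ] (A : κ → Set X) (hA : ∀ k, MeasurableSet (A k))
    (hfin : ∀ k, μ (A k) < ∞) :
    ∃ (m : ℕ) (B : Fin m → Set X) (S : κ → Finset (Fin m)), IsDisjointFamily μ B ∧
      (∀ b, (B b).Nonempty) ∧ ∀ k, A k = ⋃ b ∈ S k, B b := by
  classical
  let C : Finset κ → Set X := fun s => {x | Finset.univ.filter (fun k => x ∈ A k) = s}
  have hC : ∀ s x, x ∈ C s ↔ ∀ k, k ∈ s ↔ x ∈ A k := by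
    intro s x
    simp only [C, mem_ofPred_eq, Finset.ext_iff, Finset.mem_filter, Finset.mem_univ, true_and]
    exact forall_congr' fun k => iff_comm
  have hCm : ∀ s, MeasurableSet (C s) := by
    intro s
    have : C s = ⋂ k, if k ∈ s then A k else (A k)ᶜ := by
      ext x
      rw [hC, mem_iInter]
      refine forall_congr' fun k => ?_
      by_cases hk : k ∈ s <;> simp [hk]
    rw [this]
    refine MeasurableSet.iInter fun k => ?_
    split_ifs
    · exact hA k
    · exact (hA k).compl
  -- Atoms are the classes of points with the same membership pattern. The empty pattern is
  -- discarded because its class may have infinite measure; empty classes are discarded so that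
  -- disjoint sets get disjoint index sets.
  let e := (Fintype.equivFin {s : Finset κ // s.Nonempty ∧ (C s).Nonempty}).symm
  refine ⟨_, fun b => C (e b), fun k => Finset.univ.filter fun b => k ∈ (e b).1,
    ⟨fun b => hCm _, fun b c hbc => ?_, fun b => ?_⟩, fun b => (e b).2.2, fun k => ?_⟩
  · refine disjoint_left.2 fun x hx hx' => hbc (e.injective (Subtype.ext ?_))
    exact hx.symm.trans hx'
  · obtain ⟨k, hk⟩ := (e b).2.1
    exact (measure_mono fun x hx => ((hC _ x).1 hx k).1 hk).trans_lt (hfin k)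
  · ext x
    simp only [mem_iUnion, Finset.mem_filter, Finset.mem_univ, true_and, exists_prop]
    constructor
    · intro hx
      let s : Finset κ := Finset.univ.filter (fun k => x ∈ A k)
      have hks : k ∈ s := by simp [s, hx]
      refine ⟨e.symm ⟨s, ⟨k, hks⟩, ⟨x, rfl⟩⟩, ?_, ?_⟩
      · simpa using hks
      · rw [e.apply_symm_apply]
        exact rfl
    · rintro ⟨b, hk, hx⟩
      exact ((hC _ x).1 hx k).1 hk

lemma N_biUnion {ι : Type*} {B : ι → Set X} (hB : IsDisjointFamily μ B) (S : Finset ι)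
    (ν : CountingMeasures X) : N (⋃ b ∈ S, B b) ν = ∑ b ∈ S, N (B b) ν :=
  measure_biUnion_finset (fun _ _ _ _ h => hB.disjoint h) fun b _ => hB.measurableSet b

lemma IsDisjointFamily.measure_biUnion_lt_top {ι : Type*} {B : ι → Set X} (hB : IsDisjointFamily μ B)
    (S : Finset ι) : μ (⋃ b ∈ S, B b) < ∞ :=
  MeasureTheory.measure_biUnion_lt_top S.finite_toSet fun b _ => hB.measure_lt_top b

lemma num_biUnion {ι : Type*} {B : ι → Set X} (hB : IsDisjointFamily μ B) (S : Finset ι)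
    {ν : CountingMeasures X} (h : ∀ b, N (B b) ν = num (B b) ν) :
    num (⋃ b ∈ S, B b) ν = ∑ b ∈ S, num (B b) ν := by
  refine num_eq_of_N_eq ?_
  rw [N_biUnion hB, Finset.sum_congr rfl fun b _ => h b]
  push_cast
  rfl

lemma ctr_biUnion {ι : Type*} {B : ι → Set X} (hB : IsDisjointFamily μ B) (S : Finset ι)
    {ν : CountingMeasures X} (h : ∀ b, N (B b) ν = num (B b) ν) :
    ctr μ (⋃ b ∈ S, B b) ν = ∑ b ∈ S, ctr μ (B b) ν := by
  simp only [ctr, Finset.sum_sub_distrib]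
  rw [N_biUnion hB, ENNReal.toReal_sum fun b _ => by rw [h b]; exact ENNReal.natCast_ne_top _,
    measure_biUnion_finset (fun _ _ _ _ h => hB.disjoint h) fun b _ => hB.measurableSet b,
    ENNReal.toReal_sum fun b _ => (hB.measure_lt_top b).ne]

lemma IsPoissonProcess.ae_N_eq_num (hP : IsPoissonProcess μ P) {ι : Type*} [Countable ι]
    {B : ι → Set X} (hB : IsDisjointFamily μ B) : ∀ᵐ ν ∂P, ∀ b, N (B b) ν = num (B b) ν :=
  ae_all_iff.2 fun b => hP.ae_N_eq _ (hB.measurableSet b) (hB.measure_lt_top b)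

end Atoms

/-! ### Laws on the configuration space are determined by characteristic functions -/

section Determination

variable {X : Type*} [MeasurableSpace X] {μ : Measure X}

lemma measurable_N_of_finite [SigmaFinite μ] {m : MeasurableSpace (CountingMeasures X)}
    {A : Set X} (h : ∀ n : ℕ, Measurable[m] (N (A ∩ spanningSets μ n))) : Measurable[m] (N A) := by
  have e : N A = fun ν => ⨆ n, N (A ∩ spanningSets μ n) ν := by
    funext ν
    have hmono : Monotone fun n => A ∩ spanningSets μ n :=
      monotone_const.inter (monotone_spanningSets μ)
    change ν.1 A = ⨆ n, ν.1 (A ∩ spanningSets μ n)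
    rw [← hmono.measure_iUnion, ← inter_iUnion, iUnion_spanningSets, inter_univ]
  rw [e]
  exact Measurable.iSup h

lemma sigmaN_finite_eq [SigmaFinite μ] :
    (inferInstance : MeasurableSpace (CountingMeasures X)) =
      sigmaN {A | MeasurableSet A ∧ μ A < ∞} := by
  apply le_antisymm
  · refine iSup₂_le fun A (hA : MeasurableSet A) => ?_
    refine Measurable.comap_le (measurable_N_of_finite (μ := μ) fun n => ?_)
    have hn : A ∩ spanningSets μ n ∈ {A | MeasurableSet A ∧ μ A < ∞} :=
      ⟨hA.inter (measurableSet_spanningSets _ _),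
        (measure_mono inter_subset_right).trans_lt (measure_spanningSets_lt_top _ _)⟩
    exact (comap_measurable _).mono (le_iSup₂_of_le _ hn le_rfl) le_rfl
  · exact iSup₂_le fun A hA => (measurable_N hA.1).comap_le

/-- Finite measures on the space of counting measures are determined by the joint characteristic
functions of the variables `N (B b)`, for disjoint families `B` of sets of finite measure. -/
theorem ext_of_integral_num [SigmaFinite μ] {Q₁ Q₂ : Measure (CountingMeasures X)}
    [IsFiniteMeasure Q₁] [IsFiniteMeasure Q₂]
    (h₁ : ∀ A, MeasurableSet A → μ A < ∞ → ∀ᵐ ν ∂Q₁, N A ν = num A ν)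
    (h₂ : ∀ A, MeasurableSet A → μ A < ∞ → ∀ᵐ ν ∂Q₂, N A ν = num A ν)
    (h : ∀ (m : ℕ) (B : Fin m → Set X), IsDisjointFamily μ B → ∀ v : Fin m → ℝ,
      ∫ ν, ∏ b, Complex.exp (v b * Complex.I) ^ num (B b) ν ∂Q₁ =
        ∫ ν, ∏ b, Complex.exp (v b * Complex.I) ^ num (B b) ν ∂Q₂) :
    Q₁ = Q₂ := by
  let S : Set (Set X) := {A | MeasurableSet A ∧ μ A < ∞}
  let π : Set X → Set (Set (CountingMeasures X)) := fun A =>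
    {s | MeasurableSet[MeasurableSpace.comap (N A) inferInstance] s}
  have key : ∀ s ∈ piiUnionInter π S, Q₁ s = Q₂ s := by
    rintro s ⟨t, htS, f, hf, rfl⟩
    choose! E hEm hE using hf
    let V : CountingMeasures X → (t → ℝ) := fun ν A => num A.1 ν
    have hV : Measurable V := measurable_pi_lambda _ fun A =>
      (Measurable.of_discrete (f := fun n : ℕ => (n : ℝ))).comp (measurable_num (htS A.2).1)
    have hmap : Q₁.map V = Q₂.map V := by
      refine Measure.ext_of_charFunDual (funext fun L => ?_)
      -- The sets in `t` may overlap. Over the atoms, a linear functional of their counts becomes a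
      -- linear combination of counts of disjoint sets, to which the hypothesis applies.
      obtain ⟨m, B, T, hB, -, hT⟩ := exists_atoms (μ := μ) (fun A : t => A.1)
        (fun A => (htS A.2).1) fun A => (htS A.2).2
      have hL : ∀ x : t → ℝ, L x = ∑ A, x A * L (Pi.single A 1) := by
        intro x
        conv_lhs => rw [pi_eq_sum_univ' x]
        simp [map_sum]
      have e : ∀ Q : Measure (CountingMeasures X),
          (∀ A, MeasurableSet A → μ A < ∞ → ∀ᵐ ν ∂Q, N A ν = num A ν) →
          charFunDual (Q.map V) L =
            ∫ ν, ∏ b, Complex.exp (((∑ A ∈ Finset.univ.filter fun A => b ∈ T A,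
              L (Pi.single A 1) : ℝ) : ℂ) * Complex.I) ^ num (B b) ν ∂Q := by
        intro Q hQ
        rw [charFunDual_apply, integral_map hV.aemeasurable
          (Continuous.aestronglyMeasurable (by fun_prop))]
        refine integral_congr_ae ?_
        have hae : ∀ᵐ ν ∂Q, ∀ b, N (B b) ν = num (B b) ν :=
          ae_all_iff.2 fun b => hQ _ (hB.measurableSet b) (hB.measure_lt_top b)
        filter_upwards [hae] with ν hν
        simp_rw [← Complex.exp_nat_mul]
        rw [← Complex.exp_sum]
        congr 1
        have hv : ∀ A : t, V ν A = ∑ b ∈ T A, (num (B b) ν : ℝ) := by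
          intro A
          simp only [V]
          rw [hT A, num_biUnion hB _ hν]
          push_cast
          rfl
        have hsum : L (V ν) = ∑ b, (num (B b) ν : ℝ) *
            ∑ A ∈ Finset.univ.filter (fun A => b ∈ T A), L (Pi.single A 1) := by
          rw [hL]
          simp_rw [hv, Finset.mul_sum, Finset.sum_mul]
          exact Finset.sum_comm' (by simp)
        rw [hsum]
        push_cast
        rw [Finset.sum_mul]
        exact Finset.sum_congr rfl fun b _ => by ring
      rw [e Q₁ h₁, e Q₂ h₂]
      exact h m B hB _
    -- The counts are almost surely integers, so events on the extended values `N A` can be read on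
    -- the real vector `V`.
    let E' : Set (t → ℝ) := ⋂ A : t, {x | ENNReal.ofReal (x A) ∈ E A.1}
    have hE' : MeasurableSet E' := MeasurableSet.iInter fun A =>
      (ENNReal.measurable_ofReal.comp (measurable_pi_apply A)) (hEm A.1 A.2)
    have e : ∀ Q : Measure (CountingMeasures X),
        (∀ A, MeasurableSet A → μ A < ∞ → ∀ᵐ ν ∂Q, N A ν = num A ν) →
        Q (⋂ x ∈ t, f x) = Q.map V E' := by
      intro Q hQ
      rw [Measure.map_apply hV hE']
      refine measure_congr ?_
      have hae : ∀ᵐ ν ∂Q, ∀ A : t, N A.1 ν = num A.1 ν :=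
        ae_all_iff.2 fun A => hQ _ (htS A.2).1 (htS A.2).2
      filter_upwards [hae] with ν hν
      refine propext ?_
      change ν ∈ ⋂ x ∈ t, f x ↔ V ν ∈ E'
      simp only [mem_iInter, E', mem_ofPred_eq, Subtype.forall]
      refine forall₂_congr fun A hA => ?_
      rw [← hE A hA, mem_preimage, hν ⟨A, hA⟩]
      simp [V]
    rw [e Q₁ h₁, e Q₂ h₂, hmap]
  have huniv : Q₁ univ = Q₂ univ := by
    refine key univ ⟨∅, by simp, fun _ => univ, by simp, by simp⟩
  refine ext_of_generate_finite (piiUnionInter π S) ?_ ?_ key huniv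
  · exact (sigmaN_finite_eq (μ := μ)).trans (generateFrom_piiUnionInter_measurableSet
      (fun A => MeasurableSpace.comap (N A) inferInstance) S).symm
  · exact isPiSystem_piiUnionInter _
      (fun A => @MeasurableSpace.isPiSystem_measurableSet _
        (MeasurableSpace.comap (N A) inferInstance)) _

end Determination

/-! ### The suspension preserves the Poisson law -/

section Suspension

variable {X : Type*} [MeasurableSpace X] {μ : Measure X} {P : Measure (CountingMeasures X)}

lemma N_suspension (T : X ≃ᵐ X) {A : Set X} (hA : MeasurableSet A) (ν : CountingMeasures X) :
    N A (suspension T ν) = N (T ⁻¹' A) ν :=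
  Measure.map_apply T.measurable hA

lemma measurable_suspension (T : X ≃ᵐ X) : Measurable (suspension T) := by
  refine Measurable.of_le_map (iSup₂_le fun A hA => ?_)
  rw [MeasurableSpace.comap_le_iff_le_map]
  have : N A ∘ suspension T = N (T ⁻¹' A) := funext fun ν => N_suspension T hA ν
  have h2 : Measurable (N A ∘ suspension T) := this ▸ measurable_N (T.measurable hA)
  exact fun s hs => h2 hs

lemma measurePreserving_suspension [SigmaFinite μ] {T : X ≃ᵐ X} (hT : MeasurePreserving T μ μ)
    (hP : IsPoissonProcess μ P) : MeasurePreserving (suspension T) P P := by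
  have := hP.isProbabilityMeasure
  have hm := measurable_suspension T
  have := Measure.isProbabilityMeasure_map hm.aemeasurable (μ := P)
  have hnum : ∀ A, MeasurableSet A → ∀ ν, num A (suspension T ν) = num (T ⁻¹' A) ν := by
    intro A hA ν
    simp only [num, N_suspension T hA]
  have hpre : ∀ A, MeasurableSet A → μ (T ⁻¹' A) = μ A := fun A hA =>
    hT.measure_preimage hA.nullMeasurableSet
  refine ⟨hm, ext_of_integral_num (μ := μ) (fun A hA hfin => ?_) hP.ae_N_eq
    fun m B hB v => ?_⟩
  · have h : ∀ᵐ ν ∂P, N A (suspension T ν) = num A (suspension T ν) := by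
      filter_upwards [hP.ae_N_eq _ (T.measurable hA) (hpre A hA ▸ hfin)] with ν hν
      rw [hnum A hA, N_suspension T hA, hν]
    refine (ae_map_iff hm.aemeasurable (measurableSet_eq_fun (measurable_N hA) ?_)).2 h
    exact (Measurable.of_discrete (f := fun n : ℕ => (n : ℝ≥0∞))).comp (measurable_num hA)
  · have hB' : IsDisjointFamily μ fun b => T ⁻¹' (B b) :=
      ⟨fun b => T.measurable (hB.measurableSet b), fun b c hbc => (hB.disjoint hbc).preimage T,
        fun b => (hpre _ (hB.measurableSet b)) ▸ hB.measure_lt_top b⟩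
    rw [integral_map hm.aemeasurable]
    · simp_rw [hnum _ (hB.measurableSet _)]
      rw [hP.integral_prod_comp_num hB' fun b k => Complex.exp (v b * Complex.I) ^ k,
        hP.integral_prod_comp_num hB fun b k => Complex.exp (v b * Complex.I) ^ k]
      simp_rw [hpre _ (hB.measurableSet _)]
    · refine Measurable.aestronglyMeasurable (Finset.measurable_prod _ fun b _ => ?_)
      exact (Measurable.of_discrete (f := fun n : ℕ => Complex.exp (v b * Complex.I) ^ n)).comp
        (measurable_num (hB.measurableSet b))

end Suspension

/-! ### Splitting sets of a non-atomic space into pieces of equal measure -/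

section Splitting

/-- Intermediate value theorem for the distribution function, which is continuous because there are
no atoms. -/
lemma exists_measure_Iic_eq (ρ : Measure ℝ) [IsFiniteMeasure ρ] [NullSingletonClass ρ] {r : ℝ}
    (h0 : 0 < r) (h1 : r < ρ.real univ) : ∃ t, ρ.real (Iic t) = r := by
  have hc : Continuous fun t => ρ.real (Iic t) := by
    have e : (fun t => ρ.real (Iic t)) = fun t => ρ.real (Iic 0) + ∫ _ in (0 : ℝ)..t, (1 : ℝ) ∂ρ := by
      funext t
      have h := intervalIntegral.integral_Iic_sub_Iic (μ := ρ) (f := fun _ => (1 : ℝ))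
        (a := 0) (b := t) (integrable_const _).integrableOn (integrable_const _).integrableOn
      simp only [setIntegral_const, smul_eq_mul, mul_one] at h
      linarith
    rw [e]
    exact continuous_const.add (intervalIntegral.continuous_primitive
      (fun a b => intervalIntegrable_const) 0)
  refine mem_range_of_exists_le_of_exists_ge hc ?_ ?_
  · have h := (ENNReal.tendsto_toReal (measure_ne_top ρ univ)).comp (tendsto_measure_Ici_atBot ρ)
    obtain ⟨t, ht⟩ := (h.eventually (eventually_gt_nhds
      (show ρ.real univ - r < (ρ univ).toReal by simpa [Measure.real] using h0))).exists
    refine ⟨t, ?_⟩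
    have e1 : ρ.real (Ici t) = ρ.real (Ioi t) := measureReal_congr Ioi_ae_eq_Ici.symm
    have e2 : ρ.real (Iic t) + ρ.real (Ioi t) = ρ.real univ := by
      rw [← compl_Iic]
      exact measureReal_add_measureReal_compl measurableSet_Iic
    have ht' : ρ.real univ - r < ρ.real (Ici t) := ht
    linarith
  · have h := (ENNReal.tendsto_toReal (measure_ne_top ρ univ)).comp (tendsto_measure_Iic_atTop ρ)
    obtain ⟨t, ht⟩ := (h.eventually (eventually_gt_nhds
      (show r < (ρ univ).toReal by simpa [Measure.real] using h1))).exists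
    exact ⟨t, ht.le⟩

variable {X : Type*} [MeasurableSpace X] [StandardBorelSpace X] {μ : Measure X}
  [NullSingletonClass μ]

/-- A Borel embedding in ℝ transports μ restricted to A to a finite measure without atoms; the
subset is the preimage of a half-line. -/
lemma exists_subset_measure_eq {A : Set X} (hA : MeasurableSet A) (hfin : μ A < ∞) {r : ℝ}
    (h0 : 0 ≤ r) (h1 : r ≤ μ.real A) : ∃ B ⊆ A, MeasurableSet B ∧ μ.real B = r := by
  rcases h0.eq_or_lt with rfl | h0
  · exact ⟨∅, empty_subset _, MeasurableSet.empty, by simp⟩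
  rcases h1.eq_or_lt with rfl | h1
  · exact ⟨A, Subset.rfl, hA, rfl⟩
  have hf := measurableEmbedding_embeddingReal X
  have : IsFiniteMeasure (μ.restrict A) := ⟨by simpa using hfin⟩
  let ρ := (μ.restrict A).map (embeddingReal X)
  have : NullSingletonClass ρ := by
    refine ⟨fun x => ?_⟩
    rw [hf.map_apply]
    exact (subsingleton_singleton.preimage hf.injective).measure_zero _
  have hρ : ∀ s, MeasurableSet s → ρ.real s = μ.real (embeddingReal X ⁻¹' s ∩ A) := by
    intro s hs
    simp only [ρ, Measure.real]
    rw [hf.map_apply, Measure.restrict_apply (hf.measurable hs)]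
  obtain ⟨t, ht⟩ := exists_measure_Iic_eq ρ h0 (by rw [hρ _ MeasurableSet.univ]; simpa using h1)
  exact ⟨_, inter_subset_right, (hf.measurable measurableSet_Iic).inter hA,
    by rw [← ht, hρ _ measurableSet_Iic]⟩

/-- A set of finite measure of a non-atomic space splits into `n + 1` pieces of equal measure. -/
lemma exists_equal_pieces (n : ℕ) : ∀ {A : Set X}, MeasurableSet A → μ A < ∞ → ∀ {r : ℝ}, 0 ≤ r →
    μ.real A = (n + 1) * r → ∃ C : Fin (n + 1) → Set X, IsDisjointFamily μ C ∧
      (⋃ i, C i) = A ∧ ∀ i, μ.real (C i) = r := by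
  induction n with
  | zero =>
    intro A hA hfin r _ h
    refine ⟨fun _ => A, ⟨fun _ => hA, fun i j hij => absurd (Subsingleton.elim (α := Fin 1) i j) hij,
      fun _ => hfin⟩, iUnion_const (ι := Fin 1) A, fun _ => by simpa using h⟩
  | succ n ih =>
    intro A hA hfin r hr h
    have hrA : r ≤ μ.real A := by
      rw [h]
      push_cast
      nlinarith [mul_nonneg (Nat.cast_nonneg (α := ℝ) n) hr]
    obtain ⟨B, hBA, hB, hBr⟩ := exists_subset_measure_eq hA hfin hr hrA
    have hBf : μ B < ∞ := (measure_mono hBA).trans_lt hfin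
    have hdf : μ (A \ B) < ∞ := (measure_mono sdiff_subset).trans_lt hfin
    have hd : μ.real (A \ B) = (n + 1) * r := by
      rw [measureReal_sdiff hBA hB hfin.ne, h, hBr]
      push_cast
      ring
    obtain ⟨C, hC, hCu, hCr⟩ := ih (hA.diff hB) hdf hr hd
    have hBC : ∀ i, Disjoint B (C i) := fun i => by
      refine disjoint_left.2 fun x hxB hxC => ?_
      have : x ∈ A \ B := hCu ▸ mem_iUnion_of_mem i hxC
      exact this.2 hxB
    refine ⟨Fin.cons B C, ⟨fun i => ?_, fun i j hij => ?_, fun i => ?_⟩, ?_, fun i => ?_⟩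
    · refine Fin.cases hB (fun i => ?_) i
      simpa using hC.measurableSet i
    · induction i using Fin.cases with
      | zero =>
        induction j using Fin.cases with
        | zero => exact absurd rfl hij
        | succ j => simpa using hBC j
      | succ i =>
        induction j using Fin.cases with
        | zero => simpa using (hBC i).symm
        | succ j => simpa using hC.disjoint fun h => hij (congrArg _ h)
    · refine Fin.cases hBf (fun i => ?_) i
      simpa using hC.measure_lt_top i
    · ext x
      rw [mem_iUnion, Fin.exists_fin_succ]
      simp only [Fin.cons_zero, Fin.cons_succ]
      rw [← mem_iUnion, hCu]
      constructor
      · rintro (h | h)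
        exacts [hBA h, h.1]
      · intro h
        by_cases hx : x ∈ B
        exacts [Or.inl hx, Or.inr ⟨h, hx⟩]
    · refine Fin.cases hBr (fun i => ?_) i
      simpa using hCr i

end Splitting

/-! ### Elementary members of the chaoses -/

section Chaos

variable {X : Type*} [MeasurableSpace X] {μ : Measure X} {P : Measure (CountingMeasures X)}

lemma IsPoissonProcess.hasAllMoments_prod_ctr (hP : IsPoissonProcess μ P) {ι : Type*}
    {B : ι → Set X} (hB : IsDisjointFamily μ B) (t : Finset ι) :
    HasAllMoments (fun ν => ∏ i ∈ t, (ctr μ (B i) ν : ℂ)) P := by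
  have := hP.isProbabilityMeasure
  exact HasAllMoments.prod fun i _ => hP.hasAllMoments_ctr (hB.measurableSet i) (hB.measure_lt_top i)

lemma mem_chaos_of_ae_eq {n : ℕ} {A : Fin n → Set X} (hA : IsDisjointFamily μ A)
    {F : Lp ℂ 2 P} (hF : F =ᵐ[P] fun ν => ∏ i, (ctr μ (A i) ν : ℂ)) : F ∈ chaos μ P n :=
  Submodule.le_topologicalClosure _ (Submodule.subset_span
    ⟨A, hA.measurableSet, hA.disjoint, hA.measure_lt_top, hF⟩)

lemma mem_chaos_of_finset {ι : Type*} {B : ι → Set X} (hB : IsDisjointFamily μ B) (t : Finset ι)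
    {F : Lp ℂ 2 P} (hF : F =ᵐ[P] fun ν => ∏ i ∈ t, (ctr μ (B i) ν : ℂ)) :
    F ∈ chaos μ P t.card := by
  refine mem_chaos_of_ae_eq (A := fun i => B (t.equivFin.symm i))
    ⟨fun i => hB.measurableSet _, fun i j hij => hB.disjoint fun h =>
      hij (t.equivFin.symm.injective (Subtype.ext h)), fun i => hB.measure_lt_top _⟩ (hF.trans ?_)
  refine Filter.Eventually.of_forall fun ν => ?_
  simp only
  rw [← Finset.prod_coe_sort]
  exact (Equiv.prod_comp t.equivFin.symm fun i : t => (ctr μ (B i) ν : ℂ)).symm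

lemma inner_toLp {Ω : Type*} {mΩ : MeasurableSpace Ω} {P : Measure Ω} {F G : Ω → ℂ}
    (hF : MemLp F 2 P) (hG : MemLp G 2 P) :
    inner ℂ (hF.toLp F) (hG.toLp G) = ∫ ω, (starRingEnd ℂ) (F ω) * G ω ∂P := by
  rw [L2.inner_def]
  refine integral_congr_ae ?_
  filter_upwards [hF.coeFn_toLp, hG.coeFn_toLp] with ω h1 h2
  rw [h1, h2, RCLike.inner_apply, mul_comm]

end Chaos

/-! ### Second-order computations for one Poisson variable -/

section OneVariable

variable (r : ℝ≥0) (w : ℂ)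

open scoped ComplexConjugate

lemma integrable_poissonMeasure_centered_mul_pow :
    Integrable (fun k : ℕ => ((k : ℂ) - r) * w ^ k) (poissonMeasure r) := by
  simp_rw [sub_mul]
  exact (integrable_poissonMeasure_natCast_mul_pow r w).sub
    ((integrable_poissonMeasure_pow r w).const_mul _)

/-- This and the next two integrals form the Gram matrix of x = 1 + z(N - r) and y = w^N exp(-(w -
1)r). For z = w - 1 and s = |w - 1|² r it reads ⟨x, x⟩ = ⟨x, y⟩ = 1 + s and ⟨y, y⟩ = exp s, so x is
close to y when s is small. -/
lemma integral_poissonMeasure_affine_normSq (z : ℂ) :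
    ∫ k : ℕ, conj (1 + z * ((k : ℂ) - r)) * (1 + z * ((k : ℂ) - r)) ∂(poissonMeasure r) =
      1 + conj z * z * r := by
  have i1 : Integrable (fun k : ℕ => (conj z + z) * ((k : ℂ) - r)) (poissonMeasure r) :=
    ((integrable_poissonMeasure_natCast r).sub (integrable_const _)).const_mul _
  have i2 : Integrable (fun k : ℕ => conj z * z * (((k : ℂ) - r) * ((k : ℂ) - r)))
      (poissonMeasure r) := by
    refine Integrable.const_mul ?_ _
    have h := (integrable_poissonMeasure_natCast_pow_complex r 2).sub
      (((integrable_poissonMeasure_natCast r).const_mul (2 * r : ℂ)).sub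
        (integrable_const ((r : ℂ) ^ 2)))
    refine h.congr (Filter.Eventually.of_forall fun k => ?_)
    simp only [Pi.sub_apply]
    ring
  have e : ∀ k : ℕ, conj (1 + z * ((k : ℂ) - r)) * (1 + z * ((k : ℂ) - r)) =
      1 + ((conj z + z) * ((k : ℂ) - r) + conj z * z * (((k : ℂ) - r) * ((k : ℂ) - r))) := by
    intro k
    simp only [map_add, map_one, map_mul, map_sub, Complex.conj_natCast, Complex.conj_ofReal]
    ring
  have i3 : Integrable (fun k : ℕ => (conj z + z) * ((k : ℂ) - r) +
      conj z * z * (((k : ℂ) - r) * ((k : ℂ) - r))) (poissonMeasure r) := i1.add i2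
  simp_rw [e]
  rw [integral_add (integrable_const _) i3, integral_add i1 i2, integral_const_mul,
    integral_const_mul, integral_poissonMeasure_centered, integral_poissonMeasure_centered_sq]
  simp

lemma integral_poissonMeasure_affine_mul_pow (z : ℂ) :
    ∫ k : ℕ, conj (1 + z * ((k : ℂ) - r)) * (w ^ k * Complex.exp (-((w - 1) * r)))
      ∂(poissonMeasure r) = 1 + conj z * (w - 1) * r := by
  have e : ∀ k : ℕ, conj (1 + z * ((k : ℂ) - r)) * (w ^ k * Complex.exp (-((w - 1) * r))) =
      (w ^ k + conj z * (((k : ℂ) - r) * w ^ k)) * Complex.exp (-((w - 1) * r)) := by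
    intro k
    simp only [map_add, map_one, map_mul, map_sub, Complex.conj_natCast, Complex.conj_ofReal]
    ring
  simp_rw [e]
  rw [integral_mul_const, integral_add (integrable_poissonMeasure_pow r w)
    ((integrable_poissonMeasure_centered_mul_pow r w).const_mul _), integral_const_mul,
    integral_poissonMeasure_centered_mul_pow, integral_poissonMeasure_pow, Complex.exp_neg]
  have h := Complex.exp_ne_zero ((w - 1) * r)
  rw [mul_comm (r : ℂ) (w - 1)]
  field_simp

lemma integral_poissonMeasure_pow_normSq :
    ∫ k : ℕ, conj (w ^ k * Complex.exp (-((w - 1) * r))) *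
      (w ^ k * Complex.exp (-((w - 1) * r))) ∂(poissonMeasure r) =
      Complex.exp (conj (w - 1) * (w - 1) * r) := by
  have e : ∀ k : ℕ, conj (w ^ k * Complex.exp (-((w - 1) * r))) *
      (w ^ k * Complex.exp (-((w - 1) * r))) = (conj w * w) ^ k *
        Complex.exp (conj (-((w - 1) * r)) + (-((w - 1) * r))) := by
    intro k
    rw [Complex.exp_add, Complex.exp_conj, mul_pow, map_mul, map_pow]
    ring
  simp_rw [e]
  rw [integral_mul_const, integral_poissonMeasure_pow, ← Complex.exp_add]
  congr 1
  simp only [map_neg, map_mul, map_sub, map_one, Complex.conj_ofReal]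
  ring

end OneVariable

/-! ### Totality of the chaoses -/

section Totality

variable {X : Type*} [MeasurableSpace X] {μ : Measure X} {P : Measure (CountingMeasures X)}

open scoped ComplexConjugate

/-- Pythagoras: the first two hypotheses say that x is orthogonal to x - y. -/
lemma norm_sub_sq_of_inner_eq {E : Type*} [NormedAddCommGroup E] [InnerProductSpace ℂ E]
    {x y : E} {a b : ℂ} (hxx : inner ℂ x x = a) (hxy : inner ℂ x y = a)
    (hyy : inner ℂ y y = b) : ‖x - y‖ ^ 2 = (b - a).re := by
  have h1 : ‖x‖ ^ 2 = a.re := by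
    rw [← hxx, ← inner_self_eq_norm_sq (𝕜 := ℂ)]
    rfl
  have h2 : ‖y‖ ^ 2 = b.re := by
    rw [← hyy, ← inner_self_eq_norm_sq (𝕜 := ℂ)]
    rfl
  rw [norm_sub_sq (𝕜 := ℂ), hxy, h1, h2, Complex.sub_re]
  simp only [RCLike.re_to_complex]
  ring

/-- The finite approximation of the exponential variable belongs to the sum of the chaoses. -/
lemma inner_prod_one_add_eq_zero (hP : IsPoissonProcess μ P) {ι : Type*} [Fintype ι]
    {C : ι → Set X} (hC : IsDisjointFamily μ C) (z : ι → ℂ) {g : Lp ℂ 2 P}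
    (hg : ∀ n, ∀ F ∈ chaos μ P n, inner ℂ F g = 0)
    (hx : MemLp (fun ν => ∏ j, (1 + z j * (ctr μ (C j) ν : ℂ))) 2 P) :
    inner ℂ (hx.toLp _) g = 0 := by
  classical
  have hm : ∀ t : Finset ι, MemLp (fun ν => ∏ i ∈ t, (ctr μ (C i) ν : ℂ)) 2 P :=
    fun t => (hP.hasAllMoments_prod_ctr hC t).memLp_two
  -- Expanding the product over the subsets t of the index set, the term of t lies in the chaos of
  -- order |t|.
  have e : hx.toLp _ = ∑ t ∈ (Finset.univ : Finset ι).powerset,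
      (∏ i ∈ t, z i) • (hm t).toLp _ := by
    refine Lp.ext ?_
    have h1 : ∀ᵐ ν ∂P, ∀ t : Finset ι, ((∏ i ∈ t, z i) • (hm t).toLp _) ν =
        (∏ i ∈ t, z i) * ∏ i ∈ t, (ctr μ (C i) ν : ℂ) := by
      refine ae_all_iff.2 fun t => ?_
      filter_upwards [Lp.coeFn_smul (∏ i ∈ t, z i) ((hm t).toLp _), (hm t).coeFn_toLp]
        with ν h1 h2
      rw [h1, Pi.smul_apply, h2, smul_eq_mul]
    filter_upwards [hx.coeFn_toLp, h1, Lp.coeFn_finsetSum (Finset.univ : Finset ι).powerset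
      fun t => (∏ i ∈ t, z i) • (hm t).toLp _] with ν h1 h2 h3
    rw [h1, h3, Finset.prod_one_add, Finset.sum_apply]
    refine Finset.sum_congr rfl fun t _ => ?_
    rw [h2 t, Finset.prod_mul_distrib]
  rw [e, sum_inner]
  refine Finset.sum_eq_zero fun t _ => ?_
  rw [inner_smul_left, hg _ _ (mem_chaos_of_finset hC t (hm t).coeFn_toLp), mul_zero]

variable [StandardBorelSpace X] [NullSingletonClass μ]

/-- The functions orthogonal to all the chaoses are orthogonal to the exponential variables. -/
theorem integral_prod_pow_num_mul_eq_zero (hP : IsPoissonProcess μ P) {g : Lp ℂ 2 P}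
    (hg : ∀ n, ∀ F ∈ chaos μ P n, inner ℂ F g = 0) {m : ℕ} {B : Fin m → Set X}
    (hB : IsDisjointFamily μ B) {w : Fin m → ℂ} (hw : ∀ b, ‖w b‖ = 1) :
    ∫ ν, conj (∏ b, w b ^ num (B b) ν) * g ν ∂P = 0 := by
  have hprob := hP.isProbabilityMeasure
  have hyM : ∀ c : ℂ, MemLp (fun ν => (∏ b, w b ^ num (B b) ν) * c) 2 P := by
    intro c
    refine MemLp.of_bound (Measurable.aestronglyMeasurable ?_) ‖c‖
      (Filter.Eventually.of_forall fun ν => ?_)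
    · exact (Finset.measurable_prod _ fun b _ => (Measurable.of_discrete
        (f := fun n : ℕ => w b ^ n)).comp (measurable_num (hB.measurableSet b))).mul_const c
    · simp [norm_prod, hw]
  -- This constant normalizes the exponential variable `y` below to have mean 1.
  let c : ℂ := ∏ b, Complex.exp (-((w b - 1) * (μ (B b)).toNNReal))
  have hc : c ≠ 0 := Finset.prod_ne_zero_iff.2 fun b _ => Complex.exp_ne_zero _
  let y : Lp ℂ 2 P := (hyM c).toLp _
  let β : ℂ := ∏ b, Complex.exp (conj (w b - 1) * (w b - 1) * (μ (B b)).toNNReal)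
  -- `β` is the squared norm of `y`, and `α n` that of its n-th approximation, equal to their scalar
  -- product.
  let α : ℕ → ℂ := fun n => ∏ b,
    (1 + conj (w b - 1) * (w b - 1) * (μ (B b)).toNNReal / (n + 1 : ℕ)) ^ (n + 1)
  have hα : Filter.Tendsto α Filter.atTop (nhds β) := by
    refine tendsto_finsetProd _ fun b _ => ?_
    exact (Complex.tendsto_one_add_div_pow_exp _).comp (Filter.tendsto_add_atTop_nat 1)
  -- Cut each B b into n + 1 pieces of equal measure and replace the exponential factor of each
  -- piece by its affine part. The squared error is a difference of the form exp s - (1 +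
  -- s/(n+1))^(n+1), multiplied out over b.
  have key : ∀ n, ∃ x : Lp ℂ 2 P, inner ℂ x g = 0 ∧ ‖x - y‖ ^ 2 = (β - α n).re := by
    intro n
    have hs : ∀ b, ∃ C : Fin (n + 1) → Set X, IsDisjointFamily μ C ∧ (⋃ i, C i) = B b ∧
        ∀ i, μ.real (C i) = μ.real (B b) / (n + 1) := fun b =>
      exists_equal_pieces n (hB.measurableSet b) (hB.measure_lt_top b) (by positivity)
        (by field_simp)
    choose C hC hCu hCr using hs
    let D : Fin m × Fin (n + 1) → Set X := fun j => C j.1 j.2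
    have hD : IsDisjointFamily μ D := by
      refine ⟨fun j => (hC _).measurableSet _, ?_, fun j => (hC _).measure_lt_top _⟩
      rintro ⟨b, i⟩ ⟨b', i'⟩ h
      rcases eq_or_ne b b' with rfl | hb
      · exact (hC b).disjoint fun hi => h (Prod.ext rfl hi)
      · exact (hB.disjoint hb).mono (hCu b ▸ subset_iUnion (C b) i)
          (hCu b' ▸ subset_iUnion (C b') i')
    have hDr : ∀ j, ((μ (D j)).toNNReal : ℂ) = (μ (B j.1)).toNNReal / (n + 1 : ℕ) := by
      intro j
      have := hCr j.1 j.2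
      simp only [Measure.real, ENNReal.toReal] at this
      simp only [D]
      rw [this]
      push_cast
      rfl
    have hxA : HasAllMoments (fun ν => ∏ j, (1 + (w j.1 - 1) * (ctr μ (D j) ν : ℂ))) P :=
      HasAllMoments.prod fun j _ => (HasAllMoments.const 1).add ((HasAllMoments.const _).mul
        (hP.hasAllMoments_ctr (hD.measurableSet j) (hD.measure_lt_top j)))
    have hx : ∀ᵐ ν ∂P, (∏ j, (1 + (w j.1 - 1) * (ctr μ (D j) ν : ℂ))) =
        ∏ j, (1 + (w j.1 - 1) * ((num (D j) ν : ℂ) - (μ (D j)).toNNReal)) := by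
      filter_upwards [ae_all_iff.2 fun j =>
        hP.ae_ctr_eq (hD.measurableSet j) (hD.measure_lt_top j)] with ν hν
      exact Finset.prod_congr rfl fun j _ => by rw [hν]
    have hy : ∀ᵐ ν ∂P, (∏ b, w b ^ num (B b) ν) * c =
        ∏ j : Fin m × Fin (n + 1), (w j.1 ^ num (D j) ν *
          Complex.exp (-((w j.1 - 1) * (μ (D j)).toNNReal))) := by
      filter_upwards [ae_all_iff.2 fun b => hP.ae_N_eq_num (hC b)] with ν hν
      rw [Finset.prod_mul_distrib]
      congr 1
      · rw [Fintype.prod_prod_type]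
        refine Finset.prod_congr rfl fun b _ => ?_
        have := num_biUnion (hC b) Finset.univ (hν b)
        simp only [Finset.mem_univ, iUnion_true, hCu] at this
        rw [this, ← Finset.prod_pow_eq_pow_sum]
      · rw [Fintype.prod_prod_type]
        refine Finset.prod_congr rfl fun b _ => ?_
        simp only [hDr]
        rw [Finset.prod_const, ← Complex.exp_nat_mul, Finset.card_univ, Fintype.card_fin]
        congr 1
        have : ((n + 1 : ℕ) : ℂ) ≠ 0 := by exact_mod_cast Nat.succ_ne_zero n
        field_simp
    refine ⟨hxA.memLp_two.toLp _,
      inner_prod_one_add_eq_zero hP hD (fun j => w j.1 - 1) hg hxA.memLp_two,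
      norm_sub_sq_of_inner_eq ?_ ?_ ?_⟩
    · rw [inner_toLp, integral_congr_ae (g := fun ν => ∏ j,
        (conj (1 + (w j.1 - 1) * ((num (D j) ν : ℂ) - (μ (D j)).toNNReal)) *
        (1 + (w j.1 - 1) * ((num (D j) ν : ℂ) - (μ (D j)).toNNReal))))
        (hx.mono fun ν h => by simp only; rw [h, map_prod, ← Finset.prod_mul_distrib]),
        hP.integral_prod_comp_num hD fun j k =>
          conj (1 + (w j.1 - 1) * ((k : ℂ) - (μ (D j)).toNNReal)) *
          (1 + (w j.1 - 1) * ((k : ℂ) - (μ (D j)).toNNReal))]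
      simp_rw [integral_poissonMeasure_affine_normSq, hDr]
      rw [Fintype.prod_prod_type]
      simp only [Finset.prod_const, Finset.card_univ, Fintype.card_fin, α, mul_div_assoc]
    · rw [inner_toLp, integral_congr_ae (g := fun ν => ∏ j,
        (conj (1 + (w j.1 - 1) * ((num (D j) ν : ℂ) - (μ (D j)).toNNReal)) *
        (w j.1 ^ num (D j) ν * Complex.exp (-((w j.1 - 1) * (μ (D j)).toNNReal)))))
        ((hx.and hy).mono fun ν h => by
          simp only; rw [h.1, h.2, map_prod, ← Finset.prod_mul_distrib]),
        hP.integral_prod_comp_num hD fun j k =>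
          conj (1 + (w j.1 - 1) * ((k : ℂ) - (μ (D j)).toNNReal)) *
          (w j.1 ^ k * Complex.exp (-((w j.1 - 1) * (μ (D j)).toNNReal)))]
      simp_rw [integral_poissonMeasure_affine_mul_pow, hDr]
      rw [Fintype.prod_prod_type]
      simp only [Finset.prod_const, Finset.card_univ, Fintype.card_fin, α, mul_div_assoc]
    · rw [inner_toLp, integral_congr_ae (g := fun ν => ∏ j,
        (conj (w j.1 ^ num (D j) ν * Complex.exp (-((w j.1 - 1) * (μ (D j)).toNNReal))) *
        (w j.1 ^ num (D j) ν * Complex.exp (-((w j.1 - 1) * (μ (D j)).toNNReal)))))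
        (hy.mono fun ν h => by simp only; rw [h, map_prod, ← Finset.prod_mul_distrib]),
        hP.integral_prod_comp_num hD fun j k =>
          conj (w j.1 ^ k * Complex.exp (-((w j.1 - 1) * (μ (D j)).toNNReal))) *
          (w j.1 ^ k * Complex.exp (-((w j.1 - 1) * (μ (D j)).toNNReal)))]
      simp_rw [integral_poissonMeasure_pow_normSq, hDr]
      rw [Fintype.prod_prod_type]
      simp only [Finset.prod_const, Finset.card_univ, Fintype.card_fin, β]
      refine Finset.prod_congr rfl fun b _ => ?_
      rw [← Complex.exp_nat_mul]
      congr 1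
      have : ((n + 1 : ℕ) : ℂ) ≠ 0 := by exact_mod_cast Nat.succ_ne_zero n
      field_simp
  choose x hx hxy using key
  have hlim : Filter.Tendsto x Filter.atTop (nhds y) := by
    rw [tendsto_iff_norm_sub_tendsto_zero]
    have h1 : Filter.Tendsto (fun n => ‖x n - y‖ ^ 2) Filter.atTop (nhds 0) := by
      simp_rw [hxy]
      have := (Complex.continuous_re.tendsto _).comp (hα.const_sub β)
      simpa [Function.comp_def] using this
    have h2 := h1.sqrt
    simpa using h2
  have hy0 : inner ℂ y g = 0 :=
    tendsto_nhds_unique (hlim.inner tendsto_const_nhds) (by simp [hx])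
  have hyg : inner ℂ y g = conj c * ∫ ν, conj (∏ b, w b ^ num (B b) ν) * g ν ∂P := by
    rw [L2.inner_def, ← integral_const_mul]
    refine integral_congr_ae ?_
    filter_upwards [(hyM c).coeFn_toLp] with ν h
    simp only [y]
    rw [h, RCLike.inner_apply, map_mul]
    ring
  rw [hyg, mul_eq_zero] at hy0
  exact hy0.resolve_left (by simpa using hc)

/-- An event whose indicator has no nonconstant chaotic component is trivial. -/
theorem measure_eq_zero_or_one_of_orthogonal [SigmaFinite μ] (hP : IsPoissonProcess μ P)
    {s : Set (CountingMeasures X)} (hs : MeasurableSet s) {g : Lp ℂ 2 P}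
    (hgs : g =ᵐ[P] fun ν => s.indicator (fun _ => (1 : ℂ)) ν - P.real s)
    (hg : ∀ n, ∀ F ∈ chaos μ P n, inner ℂ F g = 0) : P s = 0 ∨ P s = 1 := by
  have hprob := hP.isProbabilityMeasure
  -- Orthogonality to the exponentials says that these two measures have the same characteristic
  -- functions. Evaluating at s gives P(s) = P(s)².
  have hQ : P.restrict s = P s • P := by
    have hfin : IsFiniteMeasure (P s • P) := by
      refine ⟨?_⟩
      simp
    refine ext_of_integral_num (μ := μ)
      (fun A hA h => ae_restrict_of_ae (hP.ae_N_eq A hA h))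
      (fun A hA h => Measure.ae_smul_measure (hP.ae_N_eq A hA h) _) fun m B hB v => ?_
    have hint : Integrable
        (fun ν => ∏ b, Complex.exp (v b * Complex.I) ^ num (B b) ν) P := by
      refine Integrable.of_bound (Measurable.aestronglyMeasurable ?_) 1
        (Filter.Eventually.of_forall fun ν => ?_)
      · exact Finset.measurable_prod _ fun b _ => (Measurable.of_discrete
          (f := fun n : ℕ => Complex.exp (v b * Complex.I) ^ n)).comp
            (measurable_num (hB.measurableSet b))
      · simp [norm_prod, Complex.norm_exp_ofReal_mul_I]
    -- The frequencies are negated because the orthogonality relation involves the conjugate of the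
    -- exponential.
    have h := integral_prod_pow_num_mul_eq_zero hP hg hB
      (w := fun b => Complex.exp ((-v b : ℝ) * Complex.I))
      (fun b => Complex.norm_exp_ofReal_mul_I _)
    have e : ∫ ν, (s.indicator (fun ν => ∏ b, Complex.exp (v b * Complex.I) ^ num (B b) ν) ν -
        P.real s * ∏ b, Complex.exp (v b * Complex.I) ^ num (B b) ν) ∂P = 0 := by
      rw [← h]
      refine integral_congr_ae ?_
      filter_upwards [hgs] with ν hν
      have hc : ∀ b, conj (Complex.exp ((-v b : ℝ) * Complex.I)) =
          Complex.exp (v b * Complex.I) := fun b => by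
        rw [← Complex.exp_conj]
        simp
      rw [hν, map_prod]
      simp_rw [map_pow, hc]
      by_cases hν : ν ∈ s
      · simp only [indicator_of_mem hν]
        ring
      · simp only [indicator_of_notMem hν]
        ring
    rw [integral_sub (hint.indicator hs) (hint.const_mul _), integral_indicator hs,
      integral_const_mul, sub_eq_zero] at e
    rw [e, integral_smul_measure]
    simp [Measure.real]
  have h := congrArg (fun m => m s) hQ
  simp only [Measure.restrict_apply_self, Measure.smul_apply, smul_eq_mul] at h
  by_contra! hne
  have h1 : P s * P s < P s * 1 :=
    ENNReal.mul_lt_mul_right hne.1 (measure_ne_top P s) (lt_of_le_of_ne prob_le_one hne.2)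
  rw [mul_one, ← h] at h1
  exact lt_irrefl _ h1

end Totality

/-! ### Elements of a chaos as multiaffine polynomials over atoms -/

section Representation

variable {X : Type*} [MeasurableSpace X] {μ : Measure X} {P : Measure (CountingMeasures X)}

open scoped ComplexConjugate

/-- The linear span of the generators of the chaos of order `n`. -/
noncomputable def chaosSpan (μ : Measure X) (P : Measure (CountingMeasures X)) (n : ℕ) :
    Submodule ℂ (Lp ℂ 2 P) :=
  Submodule.span ℂ {F : Lp ℂ 2 P | ∃ A : Fin n → Set X,
    (∀ i, MeasurableSet (A i)) ∧ Pairwise (fun i j => Disjoint (A i) (A j)) ∧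
    (∀ i, μ (A i) < ∞) ∧
    F =ᵐ[P] fun ν => ∏ i, (((N (A i) ν).toReal - (μ (A i)).toReal : ℝ) : ℂ)}

/-- A choice function picking an index in each of the disjoint sets S i is injective, so every
monomial of the expansion is square-free of degree n. The coefficient of s counts the choice
functions with image s. -/
lemma prod_sum_eq_sum_powersetCard {m n : ℕ} (S : Fin n → Finset (Fin m))
    (hS : ∀ i j, i ≠ j → Disjoint (S i) (S j)) :
    ∃ a : Finset (Fin m) → ℂ, ∀ x : Fin m → ℂ, ∏ i, ∑ b ∈ S i, x b =
      ∑ s ∈ Finset.powersetCard n Finset.univ, a s * ∏ b ∈ s, x b := by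
  classical
  have hinj : ∀ φ ∈ Fintype.piFinset S, Function.Injective φ := by
    intro φ hφ i j hij
    by_contra hne
    rw [Fintype.mem_piFinset] at hφ
    exact Finset.disjoint_left.1 (hS i j hne) (hφ i) (hij ▸ hφ j)
  refine ⟨fun s => ((Fintype.piFinset S).filter fun φ => Finset.univ.image φ = s).card,
    fun x => ?_⟩
  rw [Finset.prod_univ_sum, ← Finset.sum_fiberwise_of_maps_to
    (t := Finset.powersetCard n Finset.univ) (g := fun φ : Fin n → Fin m => Finset.univ.image φ)]
  · refine Finset.sum_congr rfl fun s _ => ?_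
    rw [← nsmul_eq_mul, ← Finset.sum_const]
    refine Finset.sum_congr rfl fun φ hφ => ?_
    rw [Finset.mem_filter] at hφ
    rw [← hφ.2, Finset.prod_image fun i _ j _ h => hinj φ hφ.1 h]
  · intro φ hφ
    rw [Finset.mem_powersetCard]
    refine ⟨Finset.subset_univ _, ?_⟩
    rw [Finset.card_image_of_injective _ (hinj φ hφ), Finset.card_univ, Fintype.card_fin]

/-- The elements of the span of the generators are homogeneous multiaffine polynomials in the
compensated variables of a disjoint family, of which a given set may be assumed to be a union. -/
lemma exists_repr_of_mem_chaosSpan (hP : IsPoissonProcess μ P) {n : ℕ} {F : Lp ℂ 2 P}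
    (hF : F ∈ chaosSpan μ P n) {A : Set X} (hA : MeasurableSet A) (hfin : μ A < ∞) :
    ∃ (m : ℕ) (B : Fin m → Set X) (S : Finset (Fin m)) (a : Finset (Fin m) → ℂ),
      IsDisjointFamily μ B ∧ A = ⋃ b ∈ S, B b ∧
      F =ᵐ[P] fun ν => ∑ s ∈ Finset.powersetCard n Finset.univ,
        a s * ∏ b ∈ s, (ctr μ (B b) ν : ℂ) := by
  obtain ⟨L, c, G, rfl⟩ := Submodule.mem_span_set'.1 hF
  have hG := fun l => (G l).2
  choose D hDm hDd hDf hDG using hG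
  -- The index `none` stands for A, so that A and all the sets occurring in F are refined together.
  obtain ⟨m, B, S, hB, hBn, hS⟩ := exists_atoms (μ := μ)
    (fun k : Option (Fin L × Fin n) => k.elim A fun j => D j.1 j.2)
    (by rintro (_ | j); exacts [hA, hDm _ _]) (by rintro (_ | j); exacts [hfin, hDf _ _])
  have hdis : ∀ l i j, i ≠ j → Disjoint (S (some (l, i))) (S (some (l, j))) := by
    intro l i j hij
    refine Finset.disjoint_left.2 fun b hb hb' => ?_
    obtain ⟨x, hx⟩ := hBn b
    have h1 : x ∈ D l i := by
      rw [show D l i = _ from hS (some (l, i))]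
      exact mem_biUnion hb hx
    have h2 : x ∈ D l j := by
      rw [show D l j = _ from hS (some (l, j))]
      exact mem_biUnion hb' hx
    exact disjoint_left.1 (hDd l hij) h1 h2
  choose a ha using fun l => prod_sum_eq_sum_powersetCard (fun i => S (some (l, i))) (hdis l)
  refine ⟨m, B, S none, fun s => ∑ l, c l * a l s, hB, hS none, ?_⟩
  have h1 : ∀ᵐ ν ∂P, ∀ l, (c l • (G l : Lp ℂ 2 P)) ν = c l *
      ∏ i, (ctr μ (D l i) ν : ℂ) := by
    refine ae_all_iff.2 fun l => ?_
    filter_upwards [Lp.coeFn_smul (c l) (G l : Lp ℂ 2 P), hDG l] with ν h1 h2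
    rw [h1, Pi.smul_apply, h2, smul_eq_mul]
    rfl
  filter_upwards [h1, Lp.coeFn_finsetSum Finset.univ fun l => c l • (G l : Lp ℂ 2 P),
    hP.ae_N_eq_num hB] with ν h1 h2 h3
  rw [h2, Finset.sum_apply]
  simp_rw [Finset.sum_mul]
  rw [Finset.sum_comm]
  refine Finset.sum_congr rfl fun l _ => ?_
  simp_rw [mul_assoc]
  rw [h1, ← Finset.mul_sum, ← ha l]
  congr 1
  refine Finset.prod_congr rfl fun i _ => ?_
  rw [show D l i = _ from hS (some (l, i)), ctr_biUnion hB _ h3]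
  push_cast
  rfl

/-- Mixed moments of the multiaffine monomials. -/
lemma integral_prod_ctr_mul (hP : IsPoissonProcess μ P) {m : ℕ} {B : Fin m → Set X}
    (hB : IsDisjointFamily μ B) {s s' e : Finset (Fin m)} (hc : s.card = s'.card)
    (he : e.card ≤ 1) :
    ∫ ν, (∏ b ∈ s, (ctr μ (B b) ν : ℂ)) * (∏ b ∈ s', (ctr μ (B b) ν : ℂ)) *
      (∏ b ∈ e, (num (B b) ν : ℂ)) ∂P = if s = s' then (∏ b ∈ s, ((μ.real (B b) : ℝ) : ℂ)) *
        ∏ b ∈ e, (((μ.real (B b) : ℝ) : ℂ) + if b ∈ s then 1 else 0) else 0 := by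
  classical
  have e1 : ∀ᵐ ν ∂P, (∏ b ∈ s, (ctr μ (B b) ν : ℂ)) * (∏ b ∈ s', (ctr μ (B b) ν : ℂ)) *
      (∏ b ∈ e, (num (B b) ν : ℂ)) = ∏ b,
        ((if b ∈ s then (num (B b) ν : ℂ) - (μ (B b)).toNNReal else 1) *
        (if b ∈ s' then (num (B b) ν : ℂ) - (μ (B b)).toNNReal else 1) *
        (if b ∈ e then (num (B b) ν : ℂ) else 1)) := by
    filter_upwards [ae_all_iff.2 fun b =>
      hP.ae_ctr_eq (hB.measurableSet b) (hB.measure_lt_top b)] with ν hν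
    simp_rw [Finset.prod_mul_distrib, Finset.prod_ite_mem, Finset.univ_inter, hν]
  rw [integral_congr_ae e1, hP.integral_prod_comp_num hB fun b k =>
        ((if b ∈ s then (k : ℂ) - (μ (B b)).toNNReal else 1) *
        (if b ∈ s' then (k : ℂ) - (μ (B b)).toNNReal else 1) *
        (if b ∈ e then (k : ℂ) else 1))]
  split_ifs with hss
  · subst hss
    have e2 : ∀ t : Finset (Fin m), ∀ f : Fin m → ℂ, ∏ b ∈ t, f b =
        ∏ b, if b ∈ t then f b else 1 := fun t f => by
      rw [Finset.prod_ite_mem, Finset.univ_inter]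
    rw [e2 s, e2 e, ← Finset.prod_mul_distrib]
    refine Finset.prod_congr rfl fun b _ => ?_
    have hr : ((μ.real (B b) : ℝ) : ℂ) = (μ (B b)).toNNReal := rfl
    rw [hr]
    by_cases h1 : b ∈ s <;> by_cases h2 : b ∈ e <;> simp only [h1, h2, if_true, if_false]
    · exact integral_poissonMeasure_centered_sq_mul _
    · simpa using integral_poissonMeasure_centered_sq _
    · simpa using integral_poissonMeasure_natCast _
    · simp
  -- Distinct sets of equal cardinality each have a point outside the other, and e contains at most
  -- one of these two points. The other one contributes the mean of a centred variable, which is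
  -- zero.
  · obtain ⟨b, hb, hbe⟩ : ∃ b, ¬ (b ∈ s ↔ b ∈ s') ∧ b ∉ e := by
      obtain ⟨b, hb, hb'⟩ := Finset.not_subset.1
        fun h : s ⊆ s' => hss (Finset.eq_of_subset_of_card_le h hc.ge)
      obtain ⟨b₁, hb₁, hb₁'⟩ := Finset.not_subset.1
        fun h : s' ⊆ s => hss (Finset.eq_of_subset_of_card_le h hc.le).symm
      by_cases hbe : b ∈ e
      · refine ⟨b₁, by tauto, fun h => ?_⟩
        have := Finset.card_le_one.1 he b hbe b₁ h
        exact hb₁' (this ▸ hb)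
      · exact ⟨b, by tauto, hbe⟩
    refine Finset.prod_eq_zero (Finset.mem_univ b) ?_
    by_cases h1 : b ∈ s <;> by_cases h2 : b ∈ s' <;> simp only [h1, h2, hbe, if_true, if_false,
      mul_one, one_mul]
    · exact absurd (iff_of_true h1 h2) hb
    · exact integral_poissonMeasure_centered _
    · exact integral_poissonMeasure_centered _
    · exact absurd (iff_of_false h1 h2) hb

/-- Off-diagonal terms of |F|² integrate to zero. The case e = ∅ gives the norm of F, and e = {b}
the norm weighted by the count of one atom. -/
lemma integral_conj_mul_self_mul (hP : IsPoissonProcess μ P) {m n : ℕ} {B : Fin m → Set X}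
    (hB : IsDisjointFamily μ B) (a : Finset (Fin m) → ℂ) {e : Finset (Fin m)} (he : e.card ≤ 1)
    {F : CountingMeasures X → ℂ} (hF : F =ᵐ[P] fun ν => ∑ s ∈ Finset.powersetCard n Finset.univ,
        a s * ∏ b ∈ s, (ctr μ (B b) ν : ℂ)) :
    ∫ ν, conj (F ν) * F ν * (∏ b ∈ e, (num (B b) ν : ℂ)) ∂P =
      ∑ s ∈ Finset.powersetCard n Finset.univ, conj (a s) * a s *
        ((∏ b ∈ s, ((μ.real (B b) : ℝ) : ℂ)) *
          ∏ b ∈ e, (((μ.real (B b) : ℝ) : ℂ) + if b ∈ s then 1 else 0)) := by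
  have hprob := hP.isProbabilityMeasure
  have hm : ∀ s s' : Finset (Fin m), Integrable (fun ν => (∏ b ∈ s, (ctr μ (B b) ν : ℂ)) *
      (∏ b ∈ s', (ctr μ (B b) ν : ℂ)) * (∏ b ∈ e, (num (B b) ν : ℂ))) P := fun s s' =>
    (((hP.hasAllMoments_prod_ctr hB s).mul (hP.hasAllMoments_prod_ctr hB s')).mul
      (HasAllMoments.prod fun b _ =>
        hP.hasAllMoments_num (hB.measurableSet b) (hB.measure_lt_top b))).integrable
  have e1 : ∀ᵐ ν ∂P, conj (F ν) * F ν * (∏ b ∈ e, (num (B b) ν : ℂ)) =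
      ∑ s ∈ Finset.powersetCard n Finset.univ, ∑ s' ∈ Finset.powersetCard n Finset.univ,
        conj (a s) * a s' * ((∏ b ∈ s, (ctr μ (B b) ν : ℂ)) *
          (∏ b ∈ s', (ctr μ (B b) ν : ℂ)) * (∏ b ∈ e, (num (B b) ν : ℂ))) := by
    filter_upwards [hF] with ν hν
    rw [hν, map_sum, Finset.sum_mul_sum, Finset.sum_mul]
    refine Finset.sum_congr rfl fun s _ => ?_
    rw [Finset.sum_mul]
    refine Finset.sum_congr rfl fun s' _ => ?_
    simp only [map_mul, map_prod, Complex.conj_ofReal]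
    ring
  rw [integral_congr_ae e1, integral_finsetSum _ fun s _ =>
    integrable_finsetSum _ fun s' _ => (hm s s').const_mul _]
  refine Finset.sum_congr rfl fun s hs => ?_
  rw [integral_finsetSum _ fun s' _ => (hm s s').const_mul _, Finset.sum_eq_single s]
  · rw [integral_const_mul, integral_prod_ctr_mul hP hB rfl he, if_pos rfl]
  · intro s' hs' hne
    rw [Finset.mem_powersetCard] at hs hs'
    rw [integral_const_mul, integral_prod_ctr_mul hP hB (hs.2.trans hs'.2.symm) he,
      if_neg hne.symm, mul_zero]
  · exact fun h => absurd hs h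

end Representation

/-! ### Norms in L² and lower semicontinuity -/

section General

variable {Ω : Type*} {mΩ : MeasurableSpace Ω} {ρ P : Measure Ω}

open scoped ComplexConjugate

lemma inner_self_eq_ofReal {E : Type*} [NormedAddCommGroup E] [InnerProductSpace ℂ E] (x : E) :
    inner ℂ x x = ((‖x‖ ^ 2 : ℝ) : ℂ) := by
  rw [Complex.ofReal_pow]
  exact inner_self_eq_norm_sq_to_K x

lemma norm_toLp_sq {F : Ω → ℂ} (hF : MemLp F 2 ρ) :
    ‖hF.toLp F‖ ^ 2 = ∫ ω, ‖F ω‖ ^ 2 ∂ρ := by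
  have h := inner_self_eq_ofReal (hF.toLp F)
  rw [inner_toLp] at h
  have e : ∀ ω, conj (F ω) * F ω = ((‖F ω‖ ^ 2 : ℝ) : ℂ) := fun ω => by
    rw [Complex.conj_mul']
    push_cast
    rfl
  simp_rw [e] at h
  rw [integral_complex_ofReal] at h
  exact_mod_cast h.symm

lemma norm_toLp_sq_eq_lintegral {F : Ω → ℂ} (hF : MemLp F 2 ρ) :
    ‖hF.toLp F‖ ^ 2 = (∫⁻ ω, ‖F ω‖ₑ ^ 2 ∂ρ).toReal := by
  have hm : AEStronglyMeasurable (fun ω => ‖F ω‖ ^ 2) ρ := hF.aestronglyMeasurable.norm.pow 2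
  rw [norm_toLp_sq, integral_eq_lintegral_of_nonneg_ae (Filter.Eventually.of_forall fun ω => by
    positivity) hm]
  congr 1
  refine lintegral_congr fun ω => ?_
  rw [ENNReal.ofReal_pow (norm_nonneg _), ofReal_norm]

/-- Fatou along a subsequence converging P-almost everywhere, hence ρ-almost everywhere. This
carries the weighted bounds from the span of the generators to its closure. -/
lemma isClosed_eLpNorm_le (hρ : ρ ≪ P) (C : ℝ) :
    IsClosed {F : Lp ℂ 2 P | eLpNorm F 2 ρ ≤ ENNReal.ofReal (C * ‖F‖)} := by
  refine IsSeqClosed.isClosed fun F G hF hFG => ?_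
  have h1 : TendstoInMeasure P (fun n => F n) Filter.atTop G := tendstoInMeasure_of_tendsto_Lp hFG
  obtain ⟨k, hk, hae⟩ := h1.exists_seq_tendsto_ae
  have h2 := Lp.eLpNorm_lim_le_liminf_eLpNorm (p := 2) (μ := ρ) (f := fun n => F (k n))
    (fun n => (Lp.aestronglyMeasurable _).mono_ac hρ) G (hρ.ae_le hae)
  refine h2.trans ?_
  have h3 : Filter.Tendsto (fun n => ENNReal.ofReal (C * ‖F (k n)‖)) Filter.atTop
      (nhds (ENNReal.ofReal (C * ‖G‖))) :=
    ENNReal.tendsto_ofReal ((hFG.norm.const_mul C).comp hk.tendsto_atTop)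
  rw [← h3.liminf_eq]
  exact Filter.liminf_le_liminf (Filter.Eventually.of_forall fun n => hF (k n))

end General

/-! ### Weighting by N(A), and the number of coordinates in A -/

section Weighted

variable {X : Type*} [MeasurableSpace X] {μ : Measure X} {P : Measure (CountingMeasures X)}

open scoped ComplexConjugate

/-- The measure with density `N A` with respect to `P`. -/
noncomputable def weighted (P : Measure (CountingMeasures X)) (A : Set X) :
    Measure (CountingMeasures X) :=
  P.withDensity (N A)

lemma weighted_ac (A : Set X) : weighted P A ≪ P := withDensity_absolutelyContinuous _ _

lemma IsPoissonProcess.ae_N_lt_top (hP : IsPoissonProcess μ P) {A : Set X} (hA : MeasurableSet A)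
    (hfin : μ A < ∞) : ∀ᵐ ν ∂P, N A ν < ∞ := by
  filter_upwards [hP.ae_N_eq A hA hfin] with ν hν
  rw [hν]
  exact ENNReal.natCast_lt_top _

lemma IsPoissonProcess.integral_weighted (hP : IsPoissonProcess μ P) {A : Set X}
    (hA : MeasurableSet A) (hfin : μ A < ∞) (f : CountingMeasures X → ℂ) :
    ∫ ν, f ν ∂(weighted P A) = ∫ ν, f ν * num A ν ∂P := by
  rw [weighted, integral_withDensity_eq_integral_toReal_smul (measurable_N hA)
    (hP.ae_N_lt_top hA hfin)]
  refine integral_congr_ae ?_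
  filter_upwards [hP.ae_N_eq A hA hfin] with ν hν
  rw [hν, Complex.real_smul, mul_comm]
  simp

lemma IsPoissonProcess.memLp_weighted (hP : IsPoissonProcess μ P) {A : Set X}
    (hA : MeasurableSet A) (hfin : μ A < ∞) {F : CountingMeasures X → ℂ}
    (hF : HasAllMoments F P) : MemLp F 2 (weighted P A) := by
  rw [memLp_two_iff_integrable_sq_norm (hF.integrable.aestronglyMeasurable.mono_ac (weighted_ac A)),
    weighted, integrable_withDensity_iff_integrable_smul₀' (measurable_N hA).aemeasurable
      (hP.ae_N_lt_top hA hfin)]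
  have h := ((hF.mul hF).mul (hP.hasAllMoments_num hA hfin)).integrable.norm
  refine h.congr ?_
  filter_upwards [hP.ae_N_eq A hA hfin] with ν hν
  rw [hν]
  simp only [norm_mul, Complex.norm_natCast, smul_eq_mul, ENNReal.toReal_natCast]
  ring

lemma hasAllMoments_of_mem_chaosSpan (hP : IsPoissonProcess μ P) {n : ℕ} {F : Lp ℂ 2 P}
    (hF : F ∈ chaosSpan μ P n) : HasAllMoments F P := by
  have hprob := hP.isProbabilityMeasure
  obtain ⟨m, B, S, a, hB, -, hFa⟩ :=
    exists_repr_of_mem_chaosSpan hP hF MeasurableSet.empty (by simp)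
  exact (HasAllMoments.sum fun s _ => (HasAllMoments.const (a s)).mul
    (hP.hasAllMoments_prod_ctr hB s)).congr hFa.symm

lemma norm_sq_of_repr (hP : IsPoissonProcess μ P) {n m : ℕ} {F : Lp ℂ 2 P}
    {B : Fin m → Set X} (hB : IsDisjointFamily μ B) {a : Finset (Fin m) → ℂ}
    (hF : F =ᵐ[P] fun ν => ∑ s ∈ Finset.powersetCard n Finset.univ,
      a s * ∏ b ∈ s, (ctr μ (B b) ν : ℂ)) :
    ‖F‖ ^ 2 = ∑ s ∈ Finset.powersetCard n Finset.univ, ‖a s‖ ^ 2 * ∏ b ∈ s, μ.real (B b) := by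
  have h := integral_conj_mul_self_mul hP hB a (e := ∅) (by simp) hF
  simp only [Finset.prod_empty, mul_one] at h
  have h2 : inner ℂ F F = ∫ ν, conj (F ν) * F ν ∂P := by
    rw [L2.inner_def]
    exact integral_congr_ae (Filter.Eventually.of_forall fun ν => by
      simp only [RCLike.inner_apply]; ring)
  rw [← h2, inner_self_eq_ofReal] at h
  simp_rw [Complex.conj_mul'] at h
  exact_mod_cast h

/-- For a Poisson variable of mean r one has E[(N - r)²] = r and E[(N - r)² N] = r(r + 1). So, with
A the union over S, weighting by N(A) multiplies the squared norm of the monomial s by μ(A) plus one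
for each index of s in S. -/
lemma norm_weighted_sq_of_repr (hP : IsPoissonProcess μ P) {n m : ℕ} {F : Lp ℂ 2 P}
    {B : Fin m → Set X} (hB : IsDisjointFamily μ B) {a : Finset (Fin m) → ℂ}
    (hF : F =ᵐ[P] fun ν => ∑ s ∈ Finset.powersetCard n Finset.univ,
      a s * ∏ b ∈ s, (ctr μ (B b) ν : ℂ)) {S : Finset (Fin m)}
    (hM : MemLp F 2 (weighted P (⋃ b ∈ S, B b))) (hFm : HasAllMoments F P) :
    ‖hM.toLp F‖ ^ 2 = ∑ s ∈ Finset.powersetCard n Finset.univ,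
      ‖a s‖ ^ 2 * (∏ b ∈ s, μ.real (B b)) * (μ.real (⋃ b ∈ S, B b) + (s ∩ S).card) := by
  classical
  have hA : MeasurableSet (⋃ b ∈ S, B b) :=
    S.measurableSet_biUnion fun b _ => hB.measurableSet b
  have hfin := hB.measure_biUnion_lt_top S
  have h1 : inner ℂ (hM.toLp F) (hM.toLp F) =
      ∑ b ∈ S, ∫ ν, conj (F ν) * F ν * num (B b) ν ∂P := by
    rw [inner_toLp, hP.integral_weighted hA hfin, ← integral_finsetSum]
    · refine integral_congr_ae ?_
      filter_upwards [hP.ae_N_eq_num hB] with ν hν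
      rw [num_biUnion hB S hν, Nat.cast_sum, Finset.mul_sum]
    · exact fun b _ => ((hFm.conj.mul hFm).mul
        (hP.hasAllMoments_num (hB.measurableSet b) (hB.measure_lt_top b))).integrable
  have h2 : ∀ b, ∫ ν, conj (F ν) * F ν * num (B b) ν ∂P = _ := fun b => by
    have h := integral_conj_mul_self_mul hP hB a (e := {b}) (by simp) hF
    simp only [Finset.prod_singleton] at h
    exact h
  simp_rw [h2] at h1
  rw [Finset.sum_comm, inner_self_eq_ofReal] at h1
  have h3 : μ.real (⋃ b ∈ S, B b) = ∑ b ∈ S, μ.real (B b) :=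
    measureReal_biUnion_finset (fun _ _ _ _ h => hB.disjoint h) (fun b _ => hB.measurableSet b)
      (fun b _ => (hB.measure_lt_top b).ne)
  have h4 : ∀ s : Finset (Fin m), ((s ∩ S).card : ℝ) = ∑ b ∈ S, if b ∈ s then (1 : ℝ) else 0 := by
    intro s
    rw [Finset.sum_boole, Finset.filter_mem_eq_inter, Finset.inter_comm]
  simp_rw [Complex.conj_mul'] at h1
  simp_rw [h3, h4, ← Finset.sum_add_distrib, Finset.mul_sum]
  simp_rw [mul_assoc]
  refine Complex.ofReal_injective (h1.trans ?_)
  push_cast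
  simp only [apply_ite (Complex.ofReal), Complex.ofReal_one, Complex.ofReal_zero]

/-- Every monomial s has n indices, so |s ∩ S| lies between 0 and n. -/
lemma weighted_bounds_of_mem_chaosSpan (hP : IsPoissonProcess μ P) {n : ℕ} {F : Lp ℂ 2 P}
    (hF : F ∈ chaosSpan μ P n) {A : Set X} (hA : MeasurableSet A) (hfin : μ A < ∞)
    (hM : MemLp F 2 (weighted P A)) :
    μ.real A * ‖F‖ ^ 2 ≤ ‖hM.toLp F‖ ^ 2 ∧ ‖hM.toLp F‖ ^ 2 ≤ (μ.real A + n) * ‖F‖ ^ 2 := by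
  classical
  obtain ⟨m, B, S, a, hB, rfl, hFa⟩ := exists_repr_of_mem_chaosSpan hP hF hA hfin
  rw [norm_weighted_sq_of_repr hP hB hFa hM (hasAllMoments_of_mem_chaosSpan hP hF),
    norm_sq_of_repr hP hB hFa, Finset.mul_sum, Finset.mul_sum]
  have h0 : ∀ s, 0 ≤ ‖a s‖ ^ 2 * ∏ b ∈ s, μ.real (B b) := fun s =>
    mul_nonneg (by positivity) (Finset.prod_nonneg fun b _ => measureReal_nonneg)
  constructor
  · refine Finset.sum_le_sum fun s _ => ?_
    rw [mul_comm]
    exact mul_le_mul_of_nonneg_left (by simp) (h0 s)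
  · refine Finset.sum_le_sum fun s hs => ?_
    rw [mul_comm (_ + _)]
    refine mul_le_mul_of_nonneg_left ?_ (h0 s)
    have : (s ∩ S).card ≤ n :=
      (Finset.card_le_card Finset.inter_subset_left).trans (Finset.mem_powersetCard.1 hs).2.le
    gcongr

/-- Take for A the union of all the atoms of F: then all n indices of every monomial count. -/
lemma exists_weighted_eq_of_mem_chaosSpan (hP : IsPoissonProcess μ P) {n : ℕ} {F : Lp ℂ 2 P}
    (hF : F ∈ chaosSpan μ P n) : ∃ A, MeasurableSet A ∧ μ A < ∞ ∧
      ∀ hM : MemLp F 2 (weighted P A), ‖hM.toLp F‖ ^ 2 = (μ.real A + n) * ‖F‖ ^ 2 := by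
  classical
  obtain ⟨m, B, -, a, hB, -, hFa⟩ :=
    exists_repr_of_mem_chaosSpan hP hF MeasurableSet.empty (by simp)
  refine ⟨⋃ b ∈ Finset.univ, B b, Finset.univ.measurableSet_biUnion fun b _ => hB.measurableSet b,
    hB.measure_biUnion_lt_top _, fun hM => ?_⟩
  rw [norm_weighted_sq_of_repr hP hB hFa hM (hasAllMoments_of_mem_chaosSpan hP hF),
    norm_sq_of_repr hP hB hFa, Finset.mul_sum]
  refine Finset.sum_congr rfl fun s hs => ?_
  rw [Finset.inter_univ, (Finset.mem_powersetCard.1 hs).2]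
  ring

lemma eLpNorm_weighted_le (hP : IsPoissonProcess μ P) {n : ℕ} {F : Lp ℂ 2 P}
    (hF : F ∈ chaos μ P n) {A : Set X} (hA : MeasurableSet A) (hfin : μ A < ∞) :
    eLpNorm F 2 (weighted P A) ≤ ENNReal.ofReal (√(μ.real A + n) * ‖F‖) := by
  refine closure_minimal (s := (chaosSpan μ P n : Set (Lp ℂ 2 P))) ?_
    (isClosed_eLpNorm_le (weighted_ac A) _) hF
  intro G hG
  have hM := hP.memLp_weighted hA hfin (hasAllMoments_of_mem_chaosSpan hP hG)
  have h := (weighted_bounds_of_mem_chaosSpan hP hG hA hfin hM).2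
  rw [mem_ofPred_eq, ENNReal.le_ofReal_iff_toReal_le hM.eLpNorm_ne_top (by positivity),
    ← Lp.norm_toLp _ hM]
  refine abs_le_of_sq_le_sq' ?_ (by positivity) |>.2
  rw [mul_pow, Real.sq_sqrt (by positivity)]
  exact h

lemma memLp_weighted_of_mem_chaos (hP : IsPoissonProcess μ P) {n : ℕ} {F : Lp ℂ 2 P}
    (hF : F ∈ chaos μ P n) {A : Set X} (hA : MeasurableSet A) (hfin : μ A < ∞) :
    MemLp F 2 (weighted P A) :=
  ⟨(Lp.aestronglyMeasurable F).mono_ac (weighted_ac A),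
    (eLpNorm_weighted_le hP hF hA hfin).trans_lt ENNReal.ofReal_lt_top⟩

/-- The inclusion of the chaos of order `n` in the weighted `L²` space. -/
noncomputable def chaosToWeighted (hP : IsPoissonProcess μ P) (n : ℕ) {A : Set X}
    (hA : MeasurableSet A) (hfin : μ A < ∞) : chaos μ P n →L[ℂ] Lp ℂ 2 (weighted P A) :=
  LinearMap.mkContinuous
    { toFun := fun F => (memLp_weighted_of_mem_chaos hP F.2 hA hfin).toLp F
      map_add' := fun F G => by
        rw [← MemLp.toLp_add]
        exact MemLp.toLp_congr _ _ ((weighted_ac A).ae_le (Lp.coeFn_add F.1 G.1))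
      map_smul' := fun c F => by
        rw [RingHom.id_apply, ← MemLp.toLp_const_smul]
        exact MemLp.toLp_congr _ _ ((weighted_ac A).ae_le (Lp.coeFn_smul c F.1)) }
    √(μ.real A + n) (fun F => by
      refine (Lp.norm_toLp _ (memLp_weighted_of_mem_chaos hP F.2 hA hfin)).trans_le ?_
      exact ENNReal.toReal_le_of_le_ofReal (by positivity) (eLpNorm_weighted_le hP F.2 hA hfin))

lemma dense_chaosSpan (n : ℕ) :
    Dense {F : chaos μ P n | (F : Lp ℂ 2 P) ∈ chaosSpan μ P n} := by
  intro F
  have hF : (F : Lp ℂ 2 P) ∈ closure (chaosSpan μ P n : Set (Lp ℂ 2 P)) := F.2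
  rw [closure_subtype]
  convert hF
  ext G
  constructor
  · rintro ⟨H, hH, rfl⟩
    exact hH
  · exact fun hG => ⟨⟨G, Submodule.le_topologicalClosure _ hG⟩, hG, rfl⟩

lemma weighted_bounds_of_mem_chaos (hP : IsPoissonProcess μ P) {n : ℕ} (F : chaos μ P n)
    {A : Set X} (hA : MeasurableSet A) (hfin : μ A < ∞) :
    μ.real A * ‖F‖ ^ 2 ≤ ‖chaosToWeighted hP n hA hfin F‖ ^ 2 ∧
      ‖chaosToWeighted hP n hA hfin F‖ ^ 2 ≤ (μ.real A + n) * ‖F‖ ^ 2 := by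
  have h1 : Continuous fun F : chaos μ P n => ‖chaosToWeighted hP n hA hfin F‖ ^ 2 := by fun_prop
  have h2 : ∀ c : ℝ, Continuous fun F : chaos μ P n => c * ‖F‖ ^ 2 := fun c => by fun_prop
  have hc := (isClosed_le (h2 (μ.real A)) h1).inter (isClosed_le h1 (h2 (μ.real A + n)))
  exact closure_minimal (s := {G : chaos μ P n | (G : Lp ℂ 2 P) ∈ chaosSpan μ P n})
    (fun G hG => weighted_bounds_of_mem_chaosSpan hP hG hA hfin
    (memLp_weighted_of_mem_chaos hP G.2 hA hfin)) hc (dense_chaosSpan n F)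

/-- An element of a chaos of positive order whose square is uncorrelated with all the variables
`N A` vanishes. -/
theorem eq_zero_of_lintegral_weighted (hP : IsPoissonProcess μ P) {n : ℕ} (hn : n ≠ 0)
    {F : Lp ℂ 2 P} (hF : F ∈ chaos μ P n)
    (h : ∀ A, MeasurableSet A → μ A < ∞ →
      ∫⁻ ν, ‖F ν‖ₑ ^ 2 ∂(weighted P A) = μ A * ∫⁻ ν, ‖F ν‖ₑ ^ 2 ∂P) : F = 0 := by
  let f : chaos μ P n := ⟨F, hF⟩
  -- The form q(h) = ‖J h‖² - μ(A)‖h‖² satisfies 0 ≤ q(h) ≤ n‖h‖², with q(f) = 0 by hypothesis and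
  -- q(g) = n‖g‖² by the choice of A. The parallelogram identity q(g) + q(2f - g) = 2q(f) + 2q(g -
  -- f) then gives n‖g‖² ≤ 2n‖g - f‖².
  have key : ∀ g : chaos μ P n, (g : Lp ℂ 2 P) ∈ chaosSpan μ P n →
      ‖g‖ ^ 2 ≤ 2 * ‖g - f‖ ^ 2 := by
    intro g hg
    obtain ⟨A, hA, hfin, hAg⟩ := exists_weighted_eq_of_mem_chaosSpan hP hg
    let J := chaosToWeighted hP n hA hfin
    have h1 : ‖J g‖ ^ 2 = (μ.real A + n) * ‖g‖ ^ 2 :=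
      hAg (memLp_weighted_of_mem_chaos hP g.2 hA hfin)
    have h2 : ‖J f‖ ^ 2 = μ.real A * ‖f‖ ^ 2 := by
      have e1 : ‖J f‖ ^ 2 = _ :=
        norm_toLp_sq_eq_lintegral (memLp_weighted_of_mem_chaos hP hF hA hfin)
      have e2 := norm_toLp_sq_eq_lintegral (Lp.memLp F)
      rw [Lp.toLp_coeFn] at e2
      rw [e1, h A hA hfin, ENNReal.toReal_mul]
      exact congrArg _ e2.symm
    have h3 := (weighted_bounds_of_mem_chaos hP (g - f) hA hfin).2
    have h4 := (weighted_bounds_of_mem_chaos hP ((2 : ℂ) • f - g) hA hfin).1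
    have p1 := parallelogram_law_with_norm ℂ (J f) (J (g - f))
    have p2 := parallelogram_law_with_norm ℂ f (g - f)
    have e1 : f + (g - f) = g := by abel
    have e2 : f - (g - f) = (2 : ℂ) • f - g := by rw [two_smul]; abel
    rw [← map_add, ← map_sub, e1, e2] at p1
    rw [e1, e2] at p2
    have hn' : (0 : ℝ) < n := by exact_mod_cast Nat.pos_of_ne_zero hn
    have h5 : (n : ℝ) * ‖g‖ ^ 2 ≤ n * (2 * ‖g - f‖ ^ 2) := by
      change ‖J (g - f)‖ ^ 2 ≤ _ at h3
      change _ ≤ ‖J ((2 : ℂ) • f - g)‖ ^ 2 at h4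
      have p2' : μ.real A * (‖g‖ ^ 2 + ‖(2 : ℂ) • f - g‖ ^ 2) =
        μ.real A * (2 * (‖f‖ ^ 2 + ‖g - f‖ ^ 2)) := by rw [p2]
      nlinarith
    exact le_of_mul_le_mul_left h5 hn'
  -- The set A has disappeared from the inequality, so it passes to the closure and may be applied
  -- to g = f.
  have hall : ∀ g : chaos μ P n, ‖g‖ ^ 2 ≤ 2 * ‖g - f‖ ^ 2 := fun g =>
    closure_minimal (fun g hg => key g hg)
      (isClosed_le (f := fun g : chaos μ P n => ‖g‖ ^ 2) (by fun_prop) (by fun_prop))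
      (dense_chaosSpan n g)
  have hf := hall f
  rw [sub_self, norm_zero] at hf
  have hf0 : ‖f‖ = 0 := by nlinarith [norm_nonneg f]
  exact congrArg Subtype.val (norm_eq_zero.1 hf0)

end Weighted

/-! ### Conditional expectation and invariant subspaces -/

section CondExp

variable {Ω : Type*} {C mΩ : MeasurableSpace Ω} {P : Measure Ω}

lemma condExpL2_eq_self (hm : C ≤ mΩ) {F : Lp ℂ 2 P} (hF : AEStronglyMeasurable[C] F P) :
    (condExpL2 ℂ ℂ hm F : Lp ℂ 2 P) = F := by
  have : Fact (C ≤ mΩ) := ⟨hm⟩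
  exact Submodule.starProjection_eq_self_iff.2 (mem_lpMeas_iff_aestronglyMeasurable.2 hF)

/-- If the conditional expectation leaves a subspace invariant, the component along this subspace
of a `C`-measurable function is `C`-measurable. -/
lemma aestronglyMeasurable_component (hm : C ≤ mΩ) {H : Submodule ℂ (Lp ℂ 2 P)}
    (hH : ∀ x ∈ H, (condExpL2 ℂ ℂ hm x : Lp ℂ 2 P) ∈ H) {G h : Lp ℂ 2 P}
    (hG : AEStronglyMeasurable[C] G P) (hh : h ∈ H) (hr : ∀ x ∈ H, inner ℂ x (G - h) = 0) :
    AEStronglyMeasurable[C] h P := by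
  suffices h0 : (condExpL2 ℂ ℂ hm h : Lp ℂ 2 P) = h by
    rw [← h0]
    exact lpMeas.aestronglyMeasurable _
  have e : (condExpL2 ℂ ℂ hm (G - h) : Lp ℂ 2 P) = G - (condExpL2 ℂ ℂ hm h : Lp ℂ 2 P) := by
    rw [map_sub, Submodule.coe_sub, condExpL2_eq_self hm hG]
  have hd : h - (condExpL2 ℂ ℂ hm h : Lp ℂ 2 P) ∈ H := H.sub_mem hh (hH h hh)
  have e2 : h - (condExpL2 ℂ ℂ hm h : Lp ℂ 2 P) =
      (condExpL2 ℂ ℂ hm (G - h) : Lp ℂ 2 P) - (G - h) := by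
    rw [e]
    abel
  -- With d the difference h - E[h | C], which lies in H, `e2` reads d = E[G - h | C] - (G - h).
  -- Both terms are orthogonal to d, the first one because E[· | C] is self-adjoint and maps d into
  -- H.
  have h1 : inner ℂ (h - (condExpL2 ℂ ℂ hm h : Lp ℂ 2 P))
      (h - (condExpL2 ℂ ℂ hm h : Lp ℂ 2 P)) = 0 := by
    refine (congrArg (inner ℂ (h - (condExpL2 ℂ ℂ hm h : Lp ℂ 2 P))) e2).trans ?_
    rw [inner_sub_right, hr _ hd, ← inner_condExpL2_left_eq_right, hr _ (hH _ hd), sub_zero]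
  exact (sub_eq_zero.1 (inner_self_eq_zero.1 h1)).symm

lemma exists_measure_ne_of_not_isTrivialMod [IsProbabilityMeasure P] (hm : C ≤ mΩ)
    (hC : ¬ IsTrivialMod P C) : ∃ s, MeasurableSet[C] s ∧ P s ≠ 0 ∧ P s ≠ 1 := by
  by_contra! h
  refine hC fun s hs => ?_
  by_cases h0 : P s = 0
  · exact ⟨∅, MeasurableSpace.measurableSet_bot_iff.2 (Or.inl rfl), ae_eq_empty.2 h0⟩
  · exact ⟨univ, MeasurableSpace.measurableSet_bot_iff.2 (Or.inr rfl),
      ae_eq_univ.2 ((prob_compl_eq_zero_iff (hm s hs)).2 (h s hs h0))⟩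

lemma exists_toLp_indicator_sub_const [IsFiniteMeasure P] (hm : C ≤ mΩ) {s : Set Ω}
    (hs : MeasurableSet[C] s) (c : ℝ) : ∃ G : Lp ℂ 2 P, AEStronglyMeasurable[C] G P ∧
      G =ᵐ[P] fun ω => s.indicator (fun _ => (1 : ℂ)) ω - c := by
  have h1 : indicatorConstLp 2 (hm s hs) (measure_ne_top P s) (1 : ℂ) -
      indicatorConstLp 2 (hm univ MeasurableSet.univ) (measure_ne_top P univ) (c : ℂ) ∈
        lpMeas ℂ ℂ C 2 P :=
    Submodule.sub_mem _ (mem_lpMeas_indicatorConstLp hm hs _)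
      (mem_lpMeas_indicatorConstLp hm MeasurableSet.univ _)
  refine ⟨_, mem_lpMeas_iff_aestronglyMeasurable.1 h1, ?_⟩
  filter_upwards [Lp.coeFn_sub (indicatorConstLp 2 (hm s hs) (measure_ne_top P s) (1 : ℂ))
    (indicatorConstLp 2 (hm univ MeasurableSet.univ) (measure_ne_top P univ) (c : ℂ)),
    indicatorConstLp_coeFn (p := 2) (hs := hm s hs) (hμs := measure_ne_top P s) (c := (1 : ℂ)),
    indicatorConstLp_coeFn (p := 2) (hs := hm univ MeasurableSet.univ)
      (hμs := measure_ne_top P univ) (c := (c : ℂ))] with ω h1 h2 h3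
  rw [h1, Pi.sub_apply, h2, h3, indicator_univ]

lemma integral_eq_zero_of_condExpL2_eq_zero [IsFiniteMeasure P] (hm : C ≤ mΩ) {G : Lp ℂ 2 P}
    (h0 : (condExpL2 ℂ ℂ hm G : Lp ℂ 2 P) = 0) {s : Set Ω} (hs : MeasurableSet[C] s) :
    ∫ ω in s, G ω ∂P = 0 := by
  have h := L2.inner_indicatorConstLp_one (𝕜 := ℂ) (hm s hs) (measure_ne_top P s) G
  rw [← h, ← condExpL2_indicator_of_measurable (𝕜 := ℂ) hm hs (measure_ne_top P s) (1 : ℂ),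
    inner_condExpL2_left_eq_right, h0, inner_zero_right]

end CondExp

/-! ### A non-zero measurable element of the first chaos -/

section FirstChaos

variable {X : Type*} [MeasurableSpace X] {μ : Measure X} {P : Measure (CountingMeasures X)}

lemma isClosed_chaos (n : ℕ) : IsClosed (chaos μ P n : Set (Lp ℂ 2 P)) :=
  Submodule.isClosed_topologicalClosure _

/-- The centered indicator of a nontrivial event has a component of positive order. -/
lemma exists_inner_ne_zero [StandardBorelSpace X] [NullSingletonClass μ] [SigmaFinite μ]
    (hP : IsPoissonProcess μ P) {s : Set (CountingMeasures X)} (hs : MeasurableSet s)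
    (hs0 : P s ≠ 0) (hs1 : P s ≠ 1) {G : Lp ℂ 2 P}
    (hG : G =ᵐ[P] fun ν => s.indicator (fun _ => (1 : ℂ)) ν - P.real s) :
    ∃ n, n ≠ 0 ∧ ∃ F ∈ chaos μ P n, inner ℂ F G ≠ 0 := by
  have hprob := hP.isProbabilityMeasure
  obtain ⟨n, F₀, hF₀, hne⟩ : ∃ n, ∃ F ∈ chaos μ P n, inner ℂ F G ≠ 0 := by
    by_contra! h
    rcases measure_eq_zero_or_one_of_orthogonal hP hs hG h with h | h
    exacts [hs0 h, hs1 h]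
  refine ⟨n, ?_, F₀, hF₀, hne⟩
  rintro rfl
  refine hne ?_
  -- The chaos of order 0 consists of constants, to which the centred G is orthogonal.
  have hcl : IsClosed {F : Lp ℂ 2 P | inner ℂ F G = 0} :=
    isClosed_eq (by fun_prop) continuous_const
  refine closure_minimal (s := (chaosSpan μ P 0 : Set (Lp ℂ 2 P))) (fun F hF => ?_) hcl hF₀
  have hle : chaosSpan μ P 0 ≤ (LinearMap.ker (innerₛₗ ℂ G)) := by
    refine Submodule.span_le.2 ?_
    rintro F ⟨A, -, -, -, hF⟩
    rw [SetLike.mem_coe, LinearMap.mem_ker]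
    change inner ℂ G F = 0
    rw [← inner_conj_symm, L2.inner_def, integral_congr_ae
      (g := fun ν => s.indicator (fun _ => (1 : ℂ)) ν - P.real s)]
    · rw [integral_sub ((integrable_const _).indicator hs) (integrable_const _),
        integral_indicator hs]
      simp [Measure.real]
    · filter_upwards [hF, hG] with ν h1 h2
      rw [h1, RCLike.inner_apply, h2]
      simp
  have h1 : inner ℂ G F = 0 := hle hF
  rw [mem_ofPred_eq, ← inner_conj_symm, h1, map_zero]

/-- A nontrivial σ-algebra, the conditional expectation of which preserves the chaoses, has a
nonzero measurable element in some chaos of positive order. -/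
lemma exists_ne_zero_mem_chaos [StandardBorelSpace X] [NullSingletonClass μ] [SigmaFinite μ]
    {C : MeasurableSpace (CountingMeasures X)}
    (hP : IsPoissonProcess μ P) (hm : C ≤ instMeasurableSpaceCountingMeasures)
    (hC : ¬ IsTrivialMod P C)
    (hCP : ∀ n, ∀ F ∈ chaos μ P n, (condExpL2 ℂ ℂ hm F : Lp ℂ 2 P) ∈ chaos μ P n) :
    ∃ n, n ≠ 0 ∧ ∃ F ∈ chaos μ P n, AEStronglyMeasurable[C] F P ∧ F ≠ 0 := by
  have hprob := hP.isProbabilityMeasure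
  obtain ⟨s, hs, hs0, hs1⟩ := exists_measure_ne_of_not_isTrivialMod hm hC
  obtain ⟨G, hGC, hG⟩ := exists_toLp_indicator_sub_const (P := P) hm hs (P.real s)
  obtain ⟨n, hn, F₀, hF₀, hne⟩ := exists_inner_ne_zero hP (hm s hs) hs0 hs1 hG
  have : CompleteSpace (chaos μ P n) := (isClosed_chaos n).completeSpace_coe
  have horth : ∀ x ∈ chaos μ P n, inner ℂ x (G - (chaos μ P n).starProjection G) = 0 :=
    fun x hx => (Submodule.mem_orthogonal _ _).1
      (Submodule.sub_starProjection_mem_orthogonal G) x hx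
  refine ⟨n, hn, (chaos μ P n).starProjection G, Submodule.starProjection_apply_mem _ _, ?_, ?_⟩
  · exact aestronglyMeasurable_component hm (hCP n) hGC (Submodule.starProjection_apply_mem _ _)
      horth
  · intro h0
    have := horth F₀ hF₀
    rw [h0, sub_zero] at this
    exact hne this

/-- The hypothesis says that the measure with density N(A) coincides with μ(A) P on C, so the two
give the same integral to the C-measurable |F|². -/
lemma lintegral_weighted_eq {C : MeasurableSpace (CountingMeasures X)} (hP : IsPoissonProcess μ P) (hm : C ≤ instMeasurableSpaceCountingMeasures) {A : Set X}
    (h : ∀ s, MeasurableSet[C] s → ∫⁻ ν in s, N A ν ∂P = μ A * P s) {F : Lp ℂ 2 P}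
    (hF : AEStronglyMeasurable[C] F P) :
    ∫⁻ ν, ‖F ν‖ₑ ^ 2 ∂(weighted P A) = μ A * ∫⁻ ν, ‖F ν‖ₑ ^ 2 ∂P := by
  have hprob := hP.isProbabilityMeasure
  obtain ⟨F', hF', hFF'⟩ := hF
  have e1 : ∫⁻ ν, ‖F ν‖ₑ ^ 2 ∂(weighted P A) = ∫⁻ ν, ‖F' ν‖ₑ ^ 2 ∂(weighted P A) :=
    lintegral_congr_ae ((weighted_ac A).ae_le (hFF'.mono fun ν h => by simp only [h]))
  have e2 : ∫⁻ ν, ‖F ν‖ₑ ^ 2 ∂P = ∫⁻ ν, ‖F' ν‖ₑ ^ 2 ∂P :=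
    lintegral_congr_ae (hFF'.mono fun ν h => by simp only [h])
  have hmeas : Measurable[C] fun ν => ‖F' ν‖ₑ ^ 2 := (StronglyMeasurable.enorm hF').pow_const 2
  have e3 : (weighted P A).trim hm = μ A • P.trim hm := by
    refine @Measure.ext _ C _ _ fun s hs => ?_
    rw [trim_measurableSet_eq hm hs, Measure.smul_apply, trim_measurableSet_eq hm hs, weighted,
      withDensity_apply _ (hm s hs), h s hs, smul_eq_mul]
  rw [e1, e2, ← lintegral_trim hm hmeas, ← lintegral_trim hm hmeas, e3, lintegral_smul_measure,
    smul_eq_mul]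

lemma toLp_ctr_mem_chaos (hP : IsPoissonProcess μ P) {A : Set X} (hA : MeasurableSet A)
    (hfin : μ A < ∞) :
    (hP.hasAllMoments_ctr hA hfin).memLp_two.toLp _ ∈ chaos μ P 1 := by
  refine mem_chaos_of_ae_eq (A := fun _ => A) ⟨fun _ => hA,
    fun i j hij => absurd (Subsingleton.elim i j) hij, fun _ => hfin⟩ ?_
  filter_upwards [(hP.hasAllMoments_ctr hA hfin).memLp_two.coeFn_toLp] with ν h
  simpa using h

lemma setLIntegral_N_eq_of_integral_eq_zero (hP : IsPoissonProcess μ P) {A : Set X}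
    (hA : MeasurableSet A) (hfin : μ A < ∞) {s : Set (CountingMeasures X)}
    (h1 : ∫ ν in s, (ctr μ A ν : ℂ) ∂P = 0) : ∫⁻ ν in s, N A ν ∂P = μ A * P s := by
  have hprob := hP.isProbabilityMeasure
  have hNi : Integrable (fun ν => (N A ν).toReal) P := by
    refine (hP.hasAllMoments_num hA hfin).integrable.norm.congr ?_
    filter_upwards [hP.ae_N_eq A hA hfin] with ν hν
    rw [hν]
    simp
  rw [integral_complex_ofReal, Complex.ofReal_eq_zero] at h1
  simp only [ctr] at h1
  rw [integral_sub hNi.integrableOn (integrable_const _), setIntegral_const,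
    sub_eq_zero, integral_toReal (measurable_N hA).aemeasurable
      (ae_restrict_of_ae (hP.ae_N_lt_top hA hfin)), smul_eq_mul, Measure.real,
    ← ENNReal.toReal_mul] at h1
  have hlt : ∫⁻ ν in s, N A ν ∂P ≠ ∞ := by
    have h2 : ∫⁻ ν, N A ν ∂P ≠ ∞ := by
      have h3 := hNi.lintegral_lt_top
      rw [lintegral_congr_ae (g := N A) ((hP.ae_N_lt_top hA hfin).mono fun ν h =>
        ENNReal.ofReal_toReal h.ne)] at h3
      exact h3.ne
    exact ((setLIntegral_le_lintegral s _).trans_lt h2.lt_top).ne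
  rw [mul_comm]
  exact (ENNReal.toReal_eq_toReal_iff' hlt
    (ENNReal.mul_ne_top (measure_ne_top P s) hfin.ne)).1 h1

/-- A nontrivial σ-algebra, the conditional expectation of which preserves the chaoses, has a
nonzero measurable element in the first chaos. -/
theorem exists_ne_zero_mem_chaos_one [StandardBorelSpace X] [NullSingletonClass μ] [SigmaFinite μ]
    {C : MeasurableSpace (CountingMeasures X)}
    (hP : IsPoissonProcess μ P) (hm : C ≤ instMeasurableSpaceCountingMeasures)
    (hC : ¬ IsTrivialMod P C)
    (hCP : ∀ n, ∀ F ∈ chaos μ P n, (condExpL2 ℂ ℂ hm F : Lp ℂ 2 P) ∈ chaos μ P n) :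
    ∃ F ∈ chaos μ P 1, AEStronglyMeasurable[C] F P ∧ F ≠ 0 := by
  have hprob := hP.isProbabilityMeasure
  obtain ⟨n, hn, F, hFn, hFC, hF0⟩ := exists_ne_zero_mem_chaos hP hm hC hCP
  -- If every N(A) had constant conditional expectation, F would vanish by
  -- `eq_zero_of_lintegral_weighted`. For the A found here, the projection of N(A) - μ(A) is the
  -- element sought.
  obtain ⟨A, hA, hfin, s, hs, hne⟩ : ∃ A, ∃ _ : MeasurableSet A, ∃ _ : μ A < ∞, ∃ s,
      MeasurableSet[C] s ∧ ∫⁻ ν in s, N A ν ∂P ≠ μ A * P s := by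
    by_contra! h
    exact hF0 (eq_zero_of_lintegral_weighted hP hn hFn fun A hA hfin =>
      lintegral_weighted_eq hP hm (h A hA hfin) hFC)
  have hL := (hP.hasAllMoments_ctr hA hfin).memLp_two
  refine ⟨condExpL2 ℂ ℂ hm (hL.toLp _), hCP 1 _ (toLp_ctr_mem_chaos hP hA hfin),
    lpMeas.aestronglyMeasurable _, fun h0 => hne ?_⟩
  refine setLIntegral_N_eq_of_integral_eq_zero hP hA hfin ?_
  rw [← integral_eq_zero_of_condExpL2_eq_zero hm h0 hs]
  exact integral_congr_ae (ae_restrict_of_ae hL.coeFn_toLp.symm)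

end FirstChaos

/-! ### The stochastic integral as an isometry onto the first chaos -/

section StochasticIntegral

variable {X : Type*} [MeasurableSpace X] {μ : Measure X} {P : Measure (CountingMeasures X)}

/-- Measurable sets of finite measure. -/
abbrev FiniteMeasureSet (μ : Measure X) : Type _ := {A : Set X // MeasurableSet A ∧ μ A < ∞}

/-- The indicator function of a set of finite measure, in `L²(μ)`. -/
noncomputable def indLp (𝕜 : Type*) [RCLike 𝕜] (A : FiniteMeasureSet μ) : Lp 𝕜 2 μ :=
  indicatorConstLp 2 A.2.1 A.2.2.ne (1 : 𝕜)

lemma coeFn_indLp (𝕜 : Type*) [RCLike 𝕜] (A : FiniteMeasureSet μ) :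
    indLp 𝕜 A =ᵐ[μ] A.1.indicator fun _ => (1 : 𝕜) := indicatorConstLp_coeFn

/-- The centered variable `N(A) - μ(A)`, in `L²(μ*)`. -/
noncomputable def ctrLp (hP : IsPoissonProcess μ P) (A : FiniteMeasureSet μ) : Lp ℂ 2 P :=
  (hP.hasAllMoments_ctr A.2.1 A.2.2).memLp_two.toLp _

lemma coeFn_ctrLp (hP : IsPoissonProcess μ P) (A : FiniteMeasureSet μ) :
    ctrLp hP A =ᵐ[P] fun ν => (ctr μ A.1 ν : ℂ) := MemLp.coeFn_toLp _

/-- The members of a disjoint family, as sets of finite measure. -/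
abbrev IsDisjointFamily.set {ι : Type*} {B : ι → Set X} (hB : IsDisjointFamily μ B) (b : ι) :
    FiniteMeasureSet μ := ⟨B b, hB.measurableSet b, hB.measure_lt_top b⟩

lemma indLp_biUnion {𝕜 : Type*} [RCLike 𝕜] {ι : Type*} {B : ι → Set X}
    (hB : IsDisjointFamily μ B) (S : Finset ι)
    {A : FiniteMeasureSet μ} (hA : A.1 = ⋃ b ∈ S, B b) :
    indLp 𝕜 A = ∑ b ∈ S, indLp 𝕜 (hB.set b) := by
  refine Lp.ext ?_
  have h : ∀ᵐ x ∂μ, ∀ b ∈ S, indLp 𝕜 (hB.set b) x = (B b).indicator (fun _ => (1 : 𝕜)) x :=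
    (Finset.eventually_all S).2 fun b _ => coeFn_indLp 𝕜 (hB.set b)
  filter_upwards [coeFn_indLp 𝕜 A, h, Lp.coeFn_finsetSum S fun b => indLp 𝕜 (hB.set b)]
    with x h1 h2 h3
  rw [h1, h3, Finset.sum_apply, Finset.sum_congr rfl h2, hA,
    Finset.indicator_biUnion_apply S B fun _ _ _ _ h => hB.disjoint h]

lemma ctrLp_biUnion (hP : IsPoissonProcess μ P) {ι : Type*} [Countable ι] {B : ι → Set X}
    (hB : IsDisjointFamily μ B) (S : Finset ι)
    {A : FiniteMeasureSet μ} (hA : A.1 = ⋃ b ∈ S, B b) :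
    ctrLp hP A = ∑ b ∈ S, ctrLp hP (hB.set b) := by
  refine Lp.ext ?_
  have h : ∀ᵐ ν ∂P, ∀ b ∈ S, ctrLp hP (hB.set b) ν = (ctr μ (B b) ν : ℂ) :=
    (Finset.eventually_all S).2 fun b _ => coeFn_ctrLp hP (hB.set b)
  filter_upwards [coeFn_ctrLp hP A, h, Lp.coeFn_finsetSum S fun b => ctrLp hP (hB.set b),
    hP.ae_N_eq_num hB] with ν h1 h2 h3 h4
  rw [h1, h3, Finset.sum_apply, Finset.sum_congr rfl h2, hA, ctr_biUnion hB S h4]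
  push_cast
  rfl

lemma inner_indLp (𝕜 : Type*) [RCLike 𝕜] (A B : FiniteMeasureSet μ) :
    inner 𝕜 (indLp 𝕜 A) (indLp 𝕜 B) = ((μ.real (A.1 ∩ B.1) : ℝ) : 𝕜) := by
  rw [indLp, L2.inner_indicatorConstLp_one, setIntegral_congr_ae A.2.1
    ((coeFn_indLp 𝕜 B).mono fun _ h _ => h), setIntegral_indicator B.2.1, setIntegral_const]
  rw [RCLike.real_smul_eq_coe_mul, mul_one]

lemma inner_ctrLp_family (hP : IsPoissonProcess μ P) {m : ℕ} {B : Fin m → Set X}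
    (hB : IsDisjointFamily μ B) (b b' : Fin m) :
    inner ℂ (ctrLp hP (hB.set b)) (ctrLp hP (hB.set b')) =
      inner ℂ (indLp ℂ (hB.set b)) (indLp ℂ (hB.set b')) := by
  have h := integral_prod_ctr_mul hP hB (s := {b}) (s' := {b'}) (e := ∅) (by simp) (by simp)
  simp only [Finset.prod_singleton, Finset.prod_empty, mul_one] at h
  rw [inner_indLp, ctrLp, ctrLp, inner_toLp]
  simp only [Complex.conj_ofReal]
  rw [h]
  by_cases hb : b = b'
  · subst hb
    simp
  · have : B b ∩ B b' = ∅ := (hB.disjoint hb).inter_eq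
    simp [hb, this]

lemma inner_ctrLp (hP : IsPoissonProcess μ P) (A A' : FiniteMeasureSet μ) :
    inner ℂ (ctrLp hP A) (ctrLp hP A') = inner ℂ (indLp ℂ A) (indLp ℂ A') := by
  obtain ⟨m, B, S, hB, -, hS⟩ := exists_atoms (μ := μ) (fun k : Bool => cond k A.1 A'.1)
    (by rintro (_ | _) <;> [exact A'.2.1; exact A.2.1])
    (by rintro (_ | _) <;> [exact A'.2.2; exact A.2.2])
  rw [ctrLp_biUnion hP hB _ (hS true), ctrLp_biUnion hP hB _ (hS false),
    indLp_biUnion hB _ (hS true), indLp_biUnion hB _ (hS false)]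
  simp only [sum_inner, inner_sum, inner_ctrLp_family]

/-- Linear combinations of indicator functions. -/
noncomputable def stepLp (𝕜 : Type*) [RCLike 𝕜] (μ : Measure X) :
    (FiniteMeasureSet μ →₀ 𝕜) →ₗ[𝕜] Lp 𝕜 2 μ := Finsupp.linearCombination 𝕜 (indLp 𝕜)

lemma denseRange_stepLp (𝕜 : Type*) [RCLike 𝕜] : DenseRange (stepLp 𝕜 μ) := by
  intro f
  have h : closure (range (stepLp 𝕜 μ)) = ((LinearMap.range (stepLp 𝕜 μ)).topologicalClosure :
      Set (Lp 𝕜 2 μ)) := by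
    rw [Submodule.topologicalClosure_coe]
    rfl
  rw [h]
  refine Lp.induction (by norm_num) (motive := fun f => f ∈
    ((LinearMap.range (stepLp 𝕜 μ)).topologicalClosure : Set (Lp 𝕜 2 μ))) (fun c s hs hμs => ?_)
    (fun f g _ _ _ hf hg => Submodule.add_mem _ hf hg)
    (Submodule.isClosed_topologicalClosure _) f
  refine Submodule.le_topologicalClosure _ ⟨Finsupp.single ⟨s, hs, hμs⟩ c, ?_⟩
  rw [stepLp, Finsupp.linearCombination_single]
  refine Lp.ext ?_
  rw [Lp.simpleFunc.coe_indicatorConst]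
  filter_upwards [Lp.coeFn_smul c (indLp 𝕜 (⟨s, hs, hμs⟩ : FiniteMeasureSet μ)),
    coeFn_indLp 𝕜 (⟨s, hs, hμs⟩ : FiniteMeasureSet μ),
    indicatorConstLp_coeFn (p := 2) (hs := hs) (hμs := hμs.ne) (c := c)] with x h1 h2 h3
  rw [h1, Pi.smul_apply, h2, h3]
  by_cases hx : x ∈ s <;> simp [hx]

/-- Only Gram matrices enter, and they agree by `inner_ctrLp`. As a step function has many
representations, this is also what makes its integral well defined. -/
lemma norm_linearCombination_ctrLp (hP : IsPoissonProcess μ P) (c : FiniteMeasureSet μ →₀ ℂ) :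
    ‖Finsupp.linearCombination ℂ (ctrLp hP) c‖ = ‖stepLp ℂ μ c‖ := by
  rw [@norm_eq_sqrt_re_inner ℂ, @norm_eq_sqrt_re_inner ℂ]
  simp only [stepLp, Finsupp.linearCombination_apply, Finsupp.sum_inner, Finsupp.inner_sum,
    inner_smul_left, inner_smul_right, inner_ctrLp]

/-- The stochastic integral, an isometry from `L²(μ)` to `L²(μ*)`. -/
noncomputable def stochInt (hP : IsPoissonProcess μ P) : Lp ℂ 2 μ →ₗᵢ[ℂ] Lp ℂ 2 P where
  toLinearMap := ((Finsupp.linearCombination ℂ (ctrLp hP)).extendOfNorm (stepLp ℂ μ)).toLinearMap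
  norm_map' f := by
    refine (denseRange_stepLp ℂ).induction_on (p := fun f =>
      ‖(Finsupp.linearCombination ℂ (ctrLp hP)).extendOfNorm (stepLp ℂ μ) f‖ = ‖f‖) f
      (isClosed_eq (by fun_prop) continuous_norm) fun c => ?_
    rw [LinearMap.extendOfNorm_eq (denseRange_stepLp ℂ)
      ⟨1, fun c => by rw [norm_linearCombination_ctrLp, one_mul]⟩, norm_linearCombination_ctrLp]

lemma stochInt_indLp (hP : IsPoissonProcess μ P) (A : FiniteMeasureSet μ) :
    stochInt hP (indLp ℂ A) = ctrLp hP A := by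
  have h : stochInt hP (stepLp ℂ μ (Finsupp.single A 1)) =
      Finsupp.linearCombination ℂ (ctrLp hP) (Finsupp.single A 1) :=
    LinearMap.extendOfNorm_eq (denseRange_stepLp ℂ)
      ⟨1, fun c => by rw [norm_linearCombination_ctrLp, one_mul]⟩ _
  simpa only [stepLp, Finsupp.linearCombination_single, one_smul] using h

lemma stochInt_mem_chaos (hP : IsPoissonProcess μ P) (f : Lp ℂ 2 μ) :
    stochInt hP f ∈ chaos μ P 1 := by
  refine (denseRange_stepLp ℂ).induction_on (p := fun f => stochInt hP f ∈ chaos μ P 1) f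
    ((isClosed_chaos 1).preimage (stochInt hP).continuous) fun c => ?_
  rw [stepLp, Finsupp.linearCombination_apply, Finsupp.sum, map_sum]
  refine Submodule.sum_mem _ fun A _ => ?_
  rw [map_smul, stochInt_indLp]
  exact Submodule.smul_mem _ _ (toLp_ctr_mem_chaos hP A.2.1 A.2.2)

/-- The range of an isometry is closed, and this one contains the generators of the first chaos. -/
lemma exists_stochInt_eq (hP : IsPoissonProcess μ P) {F : Lp ℂ 2 P} (hF : F ∈ chaos μ P 1) :
    ∃ f, stochInt hP f = F := by
  have h : chaos μ P 1 ≤ LinearMap.range (stochInt hP).toLinearMap := by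
    refine Submodule.topologicalClosure_minimal _ (Submodule.span_le.2 ?_)
      (stochInt hP).isometry.isClosedEmbedding.isClosed_range
    rintro F ⟨A, hA, -, hfin, hF⟩
    refine ⟨indLp ℂ ⟨A 0, hA 0, hfin 0⟩, (stochInt_indLp hP _).trans (Lp.ext ?_)⟩
    filter_upwards [hF, coeFn_ctrLp hP ⟨A 0, hA 0, hfin 0⟩] with ν h1 h2
    rw [h1, h2]
    simp [ctr]
  exact h hF

end StochasticIntegral

/-! ### Real and imaginary parts, and the map f ↦ exp(if) - 1 on L² -/

section RealPart

variable {Ω : Type*} {mΩ : MeasurableSpace Ω}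

/-- The real part, from complex to real `L²`. -/
noncomputable def reLp (ρ : Measure Ω) : Lp ℂ 2 ρ →L[ℝ] Lp ℝ 2 ρ := Complex.reCLM.compLpL 2 ρ

/-- The imaginary part, from complex to real `L²`. -/
noncomputable def imLp (ρ : Measure Ω) : Lp ℂ 2 ρ →L[ℝ] Lp ℝ 2 ρ := Complex.imCLM.compLpL 2 ρ

/-- The inclusion of real into complex `L²`. -/
noncomputable def ofRealLp (ρ : Measure Ω) : Lp ℝ 2 ρ →L[ℝ] Lp ℂ 2 ρ :=
  Complex.ofRealCLM.compLpL 2 ρ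

variable {ρ : Measure Ω}

lemma coeFn_reLp (f : Lp ℂ 2 ρ) : ∀ᵐ x ∂ρ, reLp ρ f x = (f x).re :=
  ContinuousLinearMap.coeFn_compLpL _ f

lemma coeFn_imLp (f : Lp ℂ 2 ρ) : ∀ᵐ x ∂ρ, imLp ρ f x = (f x).im :=
  ContinuousLinearMap.coeFn_compLpL _ f

lemma coeFn_ofRealLp (f : Lp ℝ 2 ρ) : ∀ᵐ x ∂ρ, ofRealLp ρ f x = (f x : ℂ) :=
  ContinuousLinearMap.coeFn_compLpL _ f

lemma reLp_ofRealLp (f : Lp ℝ 2 ρ) : reLp ρ (ofRealLp ρ f) = f := by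
  refine Lp.ext ?_
  filter_upwards [coeFn_reLp (ofRealLp ρ f), coeFn_ofRealLp f] with x h1 h2
  rw [h1, h2, Complex.ofReal_re]

lemma imLp_ofRealLp (f : Lp ℝ 2 ρ) : imLp ρ (ofRealLp ρ f) = 0 := by
  refine Lp.ext ?_
  filter_upwards [coeFn_imLp (ofRealLp ρ f), coeFn_ofRealLp f, Lp.coeFn_zero ℝ 2 ρ] with x h1 h2 h3
  rw [h1, h2, h3, Complex.ofReal_im, Pi.zero_apply]

lemma reLp_I_smul (f : Lp ℂ 2 ρ) : reLp ρ (Complex.I • f) = -imLp ρ f := by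
  refine Lp.ext ?_
  filter_upwards [coeFn_reLp (Complex.I • f), coeFn_imLp f, Lp.coeFn_smul Complex.I f,
    Lp.coeFn_neg (imLp ρ f)] with x h1 h2 h3 h4
  rw [h1, h3, h4]
  simp [h2]

lemma imLp_I_smul (f : Lp ℂ 2 ρ) : imLp ρ (Complex.I • f) = reLp ρ f := by
  refine Lp.ext ?_
  filter_upwards [coeFn_imLp (Complex.I • f), coeFn_reLp f, Lp.coeFn_smul Complex.I f]
    with x h1 h2 h3
  rw [h1, h3]
  simp [h2]

lemma ofRealLp_reLp_add (f : Lp ℂ 2 ρ) :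
    ofRealLp ρ (reLp ρ f) + Complex.I • ofRealLp ρ (imLp ρ f) = f := by
  refine Lp.ext ?_
  filter_upwards [coeFn_reLp f, coeFn_imLp f, coeFn_ofRealLp (reLp ρ f), coeFn_ofRealLp (imLp ρ f),
    Lp.coeFn_smul Complex.I (ofRealLp ρ (imLp ρ f)),
    Lp.coeFn_add (ofRealLp ρ (reLp ρ f)) (Complex.I • ofRealLp ρ (imLp ρ f))]
    with x h1 h2 h3 h4 h5 h6
  rw [h6, Pi.add_apply, h5, Pi.smul_apply, h3, h4, h1, h2, smul_eq_mul, mul_comm,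
    Complex.re_add_im]

/-- The function `x ↦ exp (i x) - 1`. -/
noncomputable def expSubOne (x : ℝ) : ℂ := Complex.exp (Complex.I * x) - 1

/-- Being Lipschitz and zero at 0 makes the map act continuously on L² even when the measure is
infinite; this is why 1 is subtracted. -/
lemma lipschitzWith_expSubOne : LipschitzWith 1 expSubOne := by
  refine LipschitzWith.of_dist_le_mul fun x y => ?_
  have h : expSubOne x - expSubOne y =
      Complex.exp (Complex.I * y) * (Complex.exp (Complex.I * (x - y : ℝ)) - 1) := by
    rw [mul_sub, ← Complex.exp_add]
    simp only [expSubOne]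
    push_cast
    ring_nf
  rw [dist_eq_norm, h, norm_mul, Complex.norm_exp_I_mul_ofReal, one_mul, NNReal.coe_one, one_mul,
    Real.dist_eq, ← Real.norm_eq_abs]
  exact Real.norm_exp_I_mul_ofReal_sub_one_le

lemma expSubOne_zero : expSubOne 0 = 0 := by simp [expSubOne]

/-- The map `f ↦ exp (i f) - 1` on `L²`. -/
noncomputable def expLp (f : Lp ℝ 2 ρ) : Lp ℂ 2 ρ :=
  lipschitzWith_expSubOne.compLp expSubOne_zero f

lemma coeFn_expLp (f : Lp ℝ 2 ρ) : ∀ᵐ x ∂ρ, expLp f x = Complex.exp (Complex.I * f x) - 1 :=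
  lipschitzWith_expSubOne.coeFn_compLp expSubOne_zero f

lemma continuous_expLp : Continuous (expLp (ρ := ρ)) :=
  lipschitzWith_expSubOne.continuous_compLp expSubOne_zero

end RealPart

/-! ### The stochastic integral of real functions -/

section RealIntegral

variable {X : Type*} [MeasurableSpace X] {μ : Measure X} {P : Measure (CountingMeasures X)}

/-- The stochastic integral of real functions. -/
noncomputable def realInt (hP : IsPoissonProcess μ P) : Lp ℝ 2 μ →L[ℝ] Lp ℝ 2 P :=
  reLp P ∘L (stochInt hP).toContinuousLinearMap.restrictScalars ℝ ∘L ofRealLp μ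

lemma ofRealLp_indLp (A : FiniteMeasureSet μ) : ofRealLp μ (indLp ℝ A) = indLp ℂ A := by
  refine Lp.ext ?_
  filter_upwards [coeFn_ofRealLp (indLp ℝ A), coeFn_indLp ℝ A, coeFn_indLp ℂ A] with x h1 h2 h3
  rw [h1, h2, h3]
  by_cases hx : x ∈ A.1 <;> simp [hx]

lemma coeFn_realInt_indLp (hP : IsPoissonProcess μ P) (A : FiniteMeasureSet μ) :
    realInt hP (indLp ℝ A) =ᵐ[P] ctr μ A.1 := by
  have h : realInt hP (indLp ℝ A) = reLp P (ctrLp hP A) := by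
    rw [← stochInt_indLp, ← ofRealLp_indLp]
    rfl
  rw [h]
  filter_upwards [coeFn_reLp (ctrLp hP A), coeFn_ctrLp hP A] with ν h1 h2
  rw [h1, h2, Complex.ofReal_re]

lemma ofRealLp_realInt (hP : IsPoissonProcess μ P) (f : Lp ℝ 2 μ) :
    ofRealLp P (realInt hP f) = stochInt hP (ofRealLp μ f) := by
  refine (denseRange_stepLp ℝ).induction_on (p := fun f =>
    ofRealLp P (realInt hP f) = stochInt hP (ofRealLp μ f)) f
    (isClosed_eq (by fun_prop) ((stochInt hP).continuous.comp (ofRealLp μ).continuous)) fun c => ?_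
  have h1 (A : FiniteMeasureSet μ) : ofRealLp P (realInt hP (indLp ℝ A)) =
      (stochInt hP).toContinuousLinearMap.restrictScalars ℝ (ofRealLp μ (indLp ℝ A)) := by
    refine Eq.trans ?_ ((stochInt_indLp hP A).symm.trans
      (congrArg (stochInt hP) (ofRealLp_indLp A).symm))
    refine Lp.ext ?_
    filter_upwards [coeFn_ofRealLp (realInt hP (indLp ℝ A)), coeFn_realInt_indLp hP A,
      coeFn_ctrLp hP A] with ν h1 h2 h3
    rw [h1, h2, h3]
  change _ = (stochInt hP).toContinuousLinearMap.restrictScalars ℝ (ofRealLp μ (stepLp ℝ μ c))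
  simp only [stepLp, Finsupp.linearCombination_apply, Finsupp.sum, map_sum, map_smul, h1]

lemma reLp_stochInt_and_imLp_stochInt (hP : IsPoissonProcess μ P) (f : Lp ℂ 2 μ) :
    reLp P (stochInt hP f) = realInt hP (reLp μ f) ∧
      imLp P (stochInt hP f) = realInt hP (imLp μ f) := by
  have h : stochInt hP f =
      ofRealLp P (realInt hP (reLp μ f)) + Complex.I • ofRealLp P (realInt hP (imLp μ f)) := by
    rw [ofRealLp_realInt, ofRealLp_realInt, ← map_smul, ← map_add, ofRealLp_reLp_add]
  rw [h, map_add, map_add, reLp_I_smul, imLp_I_smul]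
  simp only [reLp_ofRealLp, imLp_ofRealLp, neg_zero, add_zero, zero_add, and_self]

end RealIntegral

/-! ### Projection of exp(i ∫ f) on the first chaos -/

section Characteristic

variable {X : Type*} [MeasurableSpace X] {μ : Measure X} {P : Measure (CountingMeasures X)}

/-- The linear combination of the indicator functions of a disjoint family. -/
noncomputable def familyLp {m : ℕ} {B : Fin m → Set X} (hB : IsDisjointFamily μ B)
    (v : Fin m → ℝ) : Lp ℝ 2 μ := ∑ b, v b • indLp ℝ (hB.set b)

lemma exists_familyLp_eq_stepLp (c : FiniteMeasureSet μ →₀ ℝ) (A : FiniteMeasureSet μ) :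
    ∃ (m : ℕ) (B : Fin m → Set X) (hB : IsDisjointFamily μ B) (v : Fin m → ℝ) (S : Finset (Fin m)),
      stepLp ℝ μ c = familyLp hB v ∧ A.1 = ⋃ b ∈ S, B b := by
  classical
  let D : Option c.support → FiniteMeasureSet μ := fun k => k.elim A fun a => a.1
  obtain ⟨m, B, S, hB, -, hS⟩ := exists_atoms (μ := μ) (fun k => (D k).1) (fun k => (D k).2.1)
    (fun k => (D k).2.2)
  refine ⟨m, B, hB, fun b => ∑ a : c.support, if b ∈ S (some a) then c a else 0, S none, ?_, hS none⟩
  rw [stepLp, Finsupp.linearCombination_apply, Finsupp.sum, ← Finset.sum_coe_sort, familyLp]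
  simp_rw [Finset.sum_smul]
  rw [Finset.sum_comm]
  refine Finset.sum_congr rfl fun a _ => ?_
  rw [show indLp ℝ a.1 = _ from indLp_biUnion hB _ (hS (some a)), Finset.smul_sum]
  simp [ite_smul, Finset.sum_ite_mem]

variable {m : ℕ} {B : Fin m → Set X} (hB : IsDisjointFamily μ B) (v : Fin m → ℝ)

lemma norm_familyLp_sq : ‖familyLp hB v‖ ^ 2 = ∑ b, v b ^ 2 * μ.real (B b) := by
  have h (b b' : Fin m) : μ.real (B b ∩ B b') = if b = b' then μ.real (B b) else 0 := by
    by_cases hb : b = b'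
    · subst hb
      simp
    · simp [hb, (hB.disjoint hb).inter_eq]
  rw [← real_inner_self_eq_norm_sq, familyLp]
  simp only [sum_inner, inner_sum, inner_smul_left, inner_smul_right, inner_indLp, h]
  simp [pow_two, mul_assoc]

lemma coeFn_familyLp : ∀ᵐ x ∂μ, ∀ b, x ∈ B b → familyLp hB v x = v b := by
  have h : ∀ᵐ x ∂μ, ∀ b ∈ Finset.univ, (v b • indLp ℝ (hB.set b)) x =
      v b * (B b).indicator (fun _ => (1 : ℝ)) x := (Finset.eventually_all _).2 fun b _ => by
    filter_upwards [Lp.coeFn_smul (v b) (indLp ℝ (hB.set b)), coeFn_indLp ℝ (hB.set b)]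
      with x h1 h2
    rw [h1, Pi.smul_apply, h2, smul_eq_mul]
  filter_upwards [h, Lp.coeFn_finsetSum Finset.univ fun b => v b • indLp ℝ (hB.set b)]
    with x h1 h2 b hb
  rw [familyLp, h2, Finset.sum_apply, Finset.sum_congr rfl h1, Finset.sum_eq_single b]
  · simp [hb]
  · intro b' _ hb'
    rw [indicator_of_notMem fun h => (hB.disjoint hb').notMem_of_mem_left h hb, mul_zero]
  · simp

lemma coeFn_realInt_familyLp (hP : IsPoissonProcess μ P) :
    ∀ᵐ ν ∂P, realInt hP (familyLp hB v) ν = ∑ b, v b * ctr μ (B b) ν := by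
  have h : ∀ᵐ ν ∂P, ∀ b ∈ Finset.univ, (v b • realInt hP (indLp ℝ (hB.set b))) ν =
      v b * ctr μ (B b) ν := (Finset.eventually_all _).2 fun b _ => by
    filter_upwards [Lp.coeFn_smul (v b) (realInt hP (indLp ℝ (hB.set b))),
      coeFn_realInt_indLp hP (hB.set b)] with x h1 h2
    rw [h1, Pi.smul_apply, h2, smul_eq_mul]
  rw [familyLp, map_sum]
  simp only [map_smul]
  filter_upwards [h, Lp.coeFn_finsetSum Finset.univ fun b => v b • realInt hP (indLp ℝ (hB.set b))]
    with x h1 h2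
  rw [h2, Finset.sum_apply, Finset.sum_congr rfl h1]

/-- The characteristic function of the stochastic integral of `familyLp hB v`. -/
noncomputable def familyChar (μ : Measure X) (B : Fin m → Set X) (v : Fin m → ℝ) : ℂ :=
  ∏ b, Complex.exp (-(Complex.I * v b * (μ (B b)).toNNReal)) *
    Complex.exp ((μ (B b)).toNNReal * (Complex.exp (Complex.I * v b) - 1))

lemma coeFn_expLp_realInt_familyLp (hP : IsPoissonProcess μ P) :
    ∀ᵐ ν ∂P, expLp (realInt hP (familyLp hB v)) ν + 1 =
      ∏ b, Complex.exp (-(Complex.I * v b * (μ (B b)).toNNReal)) *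
        Complex.exp (Complex.I * v b) ^ num (B b) ν := by
  have h : ∀ᵐ ν ∂P, ∀ b, (ctr μ (B b) ν : ℂ) = (num (B b) ν : ℂ) - (μ (B b)).toNNReal :=
    ae_all_iff.2 fun b => hP.ae_ctr_eq (hB.measurableSet b) (hB.measure_lt_top b)
  filter_upwards [coeFn_expLp (realInt hP (familyLp hB v)), coeFn_realInt_familyLp hB v hP, h]
    with ν h1 h2 h3
  rw [h1, h2, sub_add_cancel, Complex.ofReal_sum]
  simp only [Complex.ofReal_mul]
  rw [Finset.mul_sum, Complex.exp_sum]
  refine Finset.prod_congr rfl fun b _ => ?_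
  rw [h3, ← Complex.exp_nat_mul, ← Complex.exp_add]
  congr 1
  ring

lemma integral_expLp_realInt_familyLp (hP : IsPoissonProcess μ P) :
    ∫ ν, (expLp (realInt hP (familyLp hB v)) ν + 1) ∂P = familyChar μ B v := by
  rw [integral_congr_ae (coeFn_expLp_realInt_familyLp hB v hP), hP.integral_prod_comp_num hB
    fun b k => Complex.exp (-(Complex.I * v b * (μ (B b)).toNNReal)) *
        Complex.exp (Complex.I * v b) ^ k]
  simp only [integral_const_mul, integral_poissonMeasure_pow, familyChar]

/-- By independence the centred count of B a changes only the factor at a, which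
`integral_poissonMeasure_centered_mul_pow` multiplies by μ(B a)(exp(i v a) - 1). -/
lemma integral_ctr_mul_expLp_realInt_familyLp (hP : IsPoissonProcess μ P) (a : Fin m) :
    ∫ ν, (ctr μ (B a) ν : ℂ) * (expLp (realInt hP (familyLp hB v)) ν + 1) ∂P =
      familyChar μ B v * ((μ (B a)).toNNReal * (Complex.exp (Complex.I * v a) - 1)) := by
  have h : ∀ᵐ ν ∂P, (ctr μ (B a) ν : ℂ) * (expLp (realInt hP (familyLp hB v)) ν + 1) =
      ∏ b, Complex.exp (-(Complex.I * v b * (μ (B b)).toNNReal)) *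
        ((if b = a then (num (B b) ν : ℂ) - (μ (B b)).toNNReal else 1) *
          Complex.exp (Complex.I * v b) ^ num (B b) ν) := by
    filter_upwards [coeFn_expLp_realInt_familyLp hB v hP,
      hP.ae_ctr_eq (hB.measurableSet a) (hB.measure_lt_top a)] with ν h1 h2
    rw [h1, h2]
    simp only [Finset.prod_mul_distrib, Finset.prod_ite_eq', Finset.mem_univ, if_true]
    ring
  rw [integral_congr_ae h, hP.integral_prod_comp_num hB
    fun b k => Complex.exp (-(Complex.I * v b * (μ (B b)).toNNReal)) *
        ((if b = a then (k : ℂ) - (μ (B b)).toNNReal else 1) * Complex.exp (Complex.I * v b) ^ k)]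
  have h2 (b : Fin m) : ∫ k : ℕ, Complex.exp (-(Complex.I * v b * (μ (B b)).toNNReal)) *
        ((if b = a then (k : ℂ) - (μ (B b)).toNNReal else 1) * Complex.exp (Complex.I * v b) ^ k)
        ∂(poissonMeasure (μ (B b)).toNNReal) =
      (Complex.exp (-(Complex.I * v b * (μ (B b)).toNNReal)) *
        Complex.exp ((μ (B b)).toNNReal * (Complex.exp (Complex.I * v b) - 1))) *
        if b = a then (μ (B b)).toNNReal * (Complex.exp (Complex.I * v b) - 1) else 1 := by
    rw [integral_const_mul]
    split_ifs
    · rw [integral_poissonMeasure_centered_mul_pow]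
      ring
    · simp only [one_mul, mul_one, integral_poissonMeasure_pow]
  simp only [h2]
  rw [Finset.prod_mul_distrib, Finset.prod_ite_eq', if_pos (Finset.mem_univ a), familyChar]

lemma integral_ctr (hP : IsPoissonProcess μ P) (A : FiniteMeasureSet μ) :
    ∫ ν, (ctr μ A.1 ν : ℂ) ∂P = 0 := by
  rw [integral_congr_ae (hP.ae_ctr_eq A.2.1 A.2.2),
    hP.integral_comp_num A.2.1 A.2.2 fun k => (k : ℂ) - (μ A.1).toNNReal,
    integral_poissonMeasure_centered]

lemma inner_ctrLp_eq_integral (hP : IsPoissonProcess μ P) (A : FiniteMeasureSet μ) (F : Lp ℂ 2 P) :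
    inner ℂ (ctrLp hP A) F = ∫ ν, (ctr μ A.1 ν : ℂ) * (F ν + 1) ∂P := by
  have h : ∀ᵐ ν ∂P, inner ℂ (ctrLp hP A ν) (F ν) =
      (ctr μ A.1 ν : ℂ) * (F ν + 1) - (ctr μ A.1 ν : ℂ) := by
    filter_upwards [coeFn_ctrLp hP A] with ν h
    rw [h, RCLike.inner_apply, Complex.conj_ofReal]
    ring
  have i0 := (hP.hasAllMoments_ctr A.2.1 A.2.2).integrable
  have i1 : Integrable (fun ν => (ctr μ A.1 ν : ℂ) * (F ν + 1)) P := by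
    refine ((L2.integrable_inner (ctrLp hP A) F).add i0).congr ?_
    filter_upwards [h] with ν h
    rw [Pi.add_apply, h, sub_add_cancel]
  rw [L2.inner_def, integral_congr_ae h, integral_sub i1 i0, integral_ctr hP, sub_zero]

lemma inner_indLp_expLp_familyLp (a : Fin m) :
    inner ℂ (indLp ℂ (hB.set a)) (expLp (familyLp hB v)) =
      (μ (B a)).toNNReal * (Complex.exp (Complex.I * v a) - 1) := by
  rw [indLp, L2.inner_indicatorConstLp_one, setIntegral_congr_ae (hB.measurableSet a)
    (g := fun _ => Complex.exp (Complex.I * v a) - 1)]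
  · rw [setIntegral_const, Complex.real_smul]
    rfl
  · filter_upwards [coeFn_expLp (familyLp hB v), coeFn_familyLp hB v] with x h1 h2 hx
    rw [h1, h2 a hx]

/-- The modulus is exp(-∑ μ(B b)(1 - cos v b)), and 1 - cos t ≤ t²/2. As the bound depends only on
the L² norm, it survives the passage to the limit and shows that `charInt` never vanishes. -/
lemma exp_le_norm_familyChar :
    Real.exp (-(‖familyLp hB v‖ ^ 2 / 2)) ≤ ‖familyChar μ B v‖ := by
  rw [norm_familyLp_sq, familyChar, norm_prod, Finset.sum_div, ← Finset.sum_neg_distrib,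
    Real.exp_sum]
  refine Finset.prod_le_prod (fun _ _ => (Real.exp_pos _).le) fun b _ => ?_
  rw [norm_mul, Complex.norm_exp, Complex.norm_exp, ← Real.exp_add, Real.exp_le_exp]
  have h1 : (-(Complex.I * v b * ((μ (B b)).toNNReal : ℂ))).re = 0 := by simp
  have h2 : (((μ (B b)).toNNReal : ℂ) * (Complex.exp (Complex.I * v b) - 1)).re =
      μ.real (B b) * (Real.cos (v b) - 1) := by
    rw [mul_comm Complex.I, show ((μ (B b)).toNNReal : ℂ) = ((μ.real (B b) : ℝ) : ℂ) from rfl,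
      Complex.re_ofReal_mul, Complex.sub_re, Complex.exp_ofReal_mul_I_re, Complex.one_re]
  rw [h1, h2, zero_add]
  nlinarith [Real.one_sub_sq_div_two_le_cos (x := v b), measureReal_nonneg (μ := μ) (s := B b)]

/-- The characteristic function of the stochastic integral. -/
noncomputable def charInt (hP : IsPoissonProcess μ P) (f : Lp ℝ 2 μ) : ℂ :=
  ∫ ν, expLp (realInt hP f) ν ∂P + 1

lemma charInt_familyLp (hP : IsPoissonProcess μ P) :
    charInt hP (familyLp hB v) = familyChar μ B v := by
  have := hP.isProbabilityMeasure
  rw [← integral_expLp_realInt_familyLp hB v hP, integral_add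
    ((Lp.memLp _).integrable one_le_two) (integrable_const _)]
  simp [charInt]

lemma continuous_charInt (hP : IsPoissonProcess μ P) : Continuous (charInt hP) := by
  have := hP.isProbabilityMeasure
  have h (F : Lp ℂ 2 P) : ∫ ν, F ν ∂P = inner ℂ
      (indicatorConstLp 2 MeasurableSet.univ (measure_ne_top P univ) (1 : ℂ)) F := by
    rw [L2.inner_indicatorConstLp_one, setIntegral_univ]
  rw [show charInt hP = _ from funext fun f => congrArg (· + 1) (h (expLp (realInt hP f)))]
  exact (continuous_const.inner (continuous_expLp.comp (realInt hP).continuous)).add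
    continuous_const

lemma charInt_ne_zero (hP : IsPoissonProcess μ P) (f : Lp ℝ 2 μ) : charInt hP f ≠ 0 := by
  have h : Real.exp (-(‖f‖ ^ 2 / 2)) ≤ ‖charInt hP f‖ := by
    refine (denseRange_stepLp ℝ).induction_on (p := fun f =>
      Real.exp (-(‖f‖ ^ 2 / 2)) ≤ ‖charInt hP f‖) f
      (isClosed_le (by fun_prop) (continuous_charInt hP).norm) fun c => ?_
    obtain ⟨m, B, hB, v, S, h, -⟩ := exists_familyLp_eq_stepLp c
      (⟨∅, MeasurableSet.empty, by simp⟩ : FiniteMeasureSet μ)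
    rw [h, charInt_familyLp]
    exact exp_le_norm_familyChar hB v
  exact norm_pos_iff.1 ((Real.exp_pos _).trans_le h)

/-- Both sides are continuous in f, so f may be a step function; refining it together with A reduces
to A being one of its atoms. -/
lemma inner_ctrLp_expLp (hP : IsPoissonProcess μ P) (A : FiniteMeasureSet μ) (f : Lp ℝ 2 μ) :
    inner ℂ (ctrLp hP A) (expLp (realInt hP f)) =
      charInt hP f * inner ℂ (indLp ℂ A) (expLp f) := by
  refine (denseRange_stepLp ℝ).induction_on (p := fun f => inner ℂ (ctrLp hP A)
    (expLp (realInt hP f)) = charInt hP f * inner ℂ (indLp ℂ A) (expLp f)) f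
    (isClosed_eq (continuous_const.inner (continuous_expLp.comp (realInt hP).continuous))
      ((continuous_charInt hP).mul (continuous_const.inner continuous_expLp))) fun c => ?_
  obtain ⟨m, B, hB, v, S, h, hA⟩ := exists_familyLp_eq_stepLp c A
  rw [h, ctrLp_biUnion hP hB S hA, indLp_biUnion hB S hA, sum_inner, sum_inner, Finset.mul_sum]
  refine Finset.sum_congr rfl fun a _ => ?_
  rw [inner_ctrLp_eq_integral, integral_ctr_mul_expLp_realInt_familyLp, charInt_familyLp,
    inner_indLp_expLp_familyLp]

/-- The projection of `exp (i ∫ f) - 1` on the first chaos is, up to a nonzero factor, the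
stochastic integral of `exp (i f) - 1`. -/
theorem inner_stochInt_expLp (hP : IsPoissonProcess μ P) (g : Lp ℂ 2 μ) (f : Lp ℝ 2 μ) :
    inner ℂ (stochInt hP g) (expLp (realInt hP f)) =
      charInt hP f * inner ℂ g (expLp f) := by
  refine (denseRange_stepLp ℂ).induction_on (p := fun g => inner ℂ (stochInt hP g)
    (expLp (realInt hP f)) = charInt hP f * inner ℂ g (expLp f)) g
    (isClosed_eq ((stochInt hP).continuous.inner continuous_const)
      (continuous_const.mul (continuous_id.inner continuous_const))) fun c => ?_
  simp only [stepLp, Finsupp.linearCombination_apply, Finsupp.sum, map_sum, map_smul,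
    stochInt_indLp, sum_inner, inner_smul_left, inner_ctrLp_expLp, Finset.mul_sum]
  exact Finset.sum_congr rfl fun _ _ => mul_left_comm _ _ _

end Characteristic

/-! ### A trigonometric iteration converging to a step function -/

section Iteration

open Real Filter Topology

/-- A map of `[0, 1]`, with attracting fixed points `0` and `1` and repelling fixed point `1 / 2`. -/
noncomputable def sharpen (x : ℝ) : ℝ := x - (2 * π)⁻¹ * sin (2 * π * x)

lemma sharpen_one_sub (x : ℝ) : sharpen (1 - x) = 1 - sharpen x := by
  rw [sharpen, sharpen, show 2 * π * (1 - x) = 2 * π - 2 * π * x by ring, sin_two_pi_sub]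
  ring

lemma iterate_sharpen_one_sub (n : ℕ) (x : ℝ) : sharpen^[n] (1 - x) = 1 - sharpen^[n] x := by
  induction n generalizing x with
  | zero => rfl
  | succ n ih => rw [Function.iterate_succ_apply, Function.iterate_succ_apply, sharpen_one_sub, ih]

lemma sharpen_mem {x : ℝ} (h0 : 0 ≤ x) (h1 : x ≤ 1 / 2) : 0 ≤ sharpen x ∧ sharpen x ≤ x := by
  have hp := pi_pos
  have h2 : 0 ≤ 2 * π * x := by positivity
  have h3 : 0 ≤ sin (2 * π * x) := sin_nonneg_of_nonneg_of_le_pi h2 (by nlinarith)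
  have h4 : (2 * π)⁻¹ * sin (2 * π * x) ≤ x := by
    rw [inv_mul_le_iff₀ (by positivity)]
    exact sin_le h2
  exact ⟨sub_nonneg.2 h4, sub_le_self _ (by positivity)⟩

lemma iterate_sharpen_mem (n : ℕ) {x : ℝ} (h0 : 0 ≤ x) (h1 : x ≤ 1 / 2) :
    0 ≤ sharpen^[n] x ∧ sharpen^[n] x ≤ x := by
  induction n generalizing x with
  | zero => exact ⟨h0, le_rfl⟩
  | succ n ih =>
    obtain ⟨h2, h3⟩ := sharpen_mem h0 h1
    rw [Function.iterate_succ_apply]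
    exact ⟨(ih h2 (h3.trans h1)).1, (ih h2 (h3.trans h1)).2.trans h3⟩

/-- The iterates decrease to a fixed point l in [0, 1/2), where sin(2πl) = 0 forces l = 0. -/
lemma tendsto_iterate_sharpen_zero {x : ℝ} (h0 : 0 ≤ x) (h1 : x < 1 / 2) :
    Tendsto (fun n => sharpen^[n] x) atTop (𝓝 0) := by
  have hanti : Antitone fun n => sharpen^[n] x := antitone_nat_of_succ_le fun n => by
    obtain ⟨h2, h3⟩ := iterate_sharpen_mem n h0 h1.le
    rw [Function.iterate_succ_apply']
    exact (sharpen_mem h2 (h3.trans h1.le)).2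
  have hlim := tendsto_atTop_ciInf hanti ⟨0, by
    rintro _ ⟨n, rfl⟩
    exact (iterate_sharpen_mem n h0 h1.le).1⟩
  set l := ⨅ n, sharpen^[n] x
  have hl0 : 0 ≤ l := ge_of_tendsto' hlim fun n => (iterate_sharpen_mem n h0 h1.le).1
  have hl1 : l ≤ x := le_of_tendsto' hlim fun n => (iterate_sharpen_mem n h0 h1.le).2
  have hfix : Function.IsFixedPt sharpen l := isFixedPt_of_tendsto_iterate hlim (by
    unfold sharpen
    fun_prop)
  have hp := pi_pos
  have hs : (2 * π)⁻¹ * sin (2 * π * l) = 0 := sub_eq_self.1 hfix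
  have hs' : sin (2 * π * l) = 0 := (mul_eq_zero.1 hs).resolve_left (by positivity)
  have := (sin_eq_zero_iff_of_lt_of_lt (by nlinarith) (by nlinarith)).1 hs'
  have hl : l = 0 := (mul_eq_zero.1 this).resolve_left (by positivity)
  rwa [hl] at hlim

lemma sharpen_half : sharpen (1 / 2) = 1 / 2 := by
  rw [sharpen, show 2 * π * (1 / 2) = π by ring, sin_pi, mul_zero, sub_zero]

/-- The limit of the iterates of `sharpen` on `[0, 1]`. -/
noncomputable def sharpenLim (x : ℝ) : ℝ := if x < 1 / 2 then 0 else if x = 1 / 2 then 1 / 2 else 1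

lemma measurable_sharpenLim : Measurable sharpenLim :=
  Measurable.ite measurableSet_Iio measurable_const
    (Measurable.ite (measurableSet_singleton _) measurable_const measurable_const)

lemma tendsto_iterate_sharpen {x : ℝ} (h0 : 0 ≤ x) (h1 : x ≤ 1) :
    Tendsto (fun n => sharpen^[n] x) atTop (𝓝 (sharpenLim x)) := by
  unfold sharpenLim
  split_ifs with h2 h3
  · exact tendsto_iterate_sharpen_zero h0 h2
  · rw [h3]
    simp only [Function.iterate_fixed sharpen_half]
    exact tendsto_const_nhds
  · have h4 : 1 / 2 < x := lt_of_le_of_ne (not_lt.1 h2) (Ne.symm h3)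
    have h := (tendsto_iterate_sharpen_zero (x := 1 - x) (by linarith) (by linarith)).const_sub 1
    simpa [iterate_sharpen_one_sub] using h

/-- Below 1/2 the iterates are at most x; above, they are at most 1 ≤ 2x. A bound linear in x gives
domination in L² of an infinite measure. -/
lemma abs_iterate_sharpen_le (n : ℕ) {x : ℝ} (h0 : 0 ≤ x) (h1 : x ≤ 1) :
    |sharpen^[n] x| ≤ 2 * x := by
  rcases le_total x (1 / 2) with h2 | h2
  · obtain ⟨h3, h4⟩ := iterate_sharpen_mem n h0 h2
    rw [abs_of_nonneg h3]
    linarith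
  · obtain ⟨h3, h4⟩ := iterate_sharpen_mem n (x := 1 - x) (by linarith) (by linarith)
    rw [iterate_sharpen_one_sub] at h3 h4
    rw [abs_of_nonneg (by linarith)]
    linarith

lemma abs_sharpenLim_le {x : ℝ} (h0 : 0 ≤ x) (h1 : x ≤ 1) : |sharpenLim x| ≤ 2 * x :=
  le_of_tendsto' (tendsto_iterate_sharpen h0 h1).abs fun n => abs_iterate_sharpen_le n h0 h1

end Iteration

/-! ### Trigonometrically stable subspaces contain indicators -/

section TrigStable

variable {X : Type*} [MeasurableSpace X] {μ : Measure X}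

/-- Closed subspaces of `L²(μ)` which are stable under `f ↦ cos f - 1` and `f ↦ sin f`. -/
structure IsTrigStable (K : Submodule ℝ (Lp ℝ 2 μ)) : Prop where
  isClosed : IsClosed (K : Set (Lp ℝ 2 μ))
  cos_mem : ∀ f ∈ K, ∀ g : Lp ℝ 2 μ, (∀ᵐ x ∂μ, g x = Real.cos (f x) - 1) → g ∈ K
  sin_mem : ∀ f ∈ K, ∀ g : Lp ℝ 2 μ, (∀ᵐ x ∂μ, g x = Real.sin (f x)) → g ∈ K

lemma exists_coeFn_eq_cos (f : Lp ℝ 2 μ) : ∃ g : Lp ℝ 2 μ, ∀ᵐ x ∂μ, g x = Real.cos (f x) - 1 :=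
  have h : LipschitzWith 1 fun x => Real.cos x - 1 := LipschitzWith.of_dist_le_mul fun x y => by
    simpa [Real.dist_eq] using Real.lipschitzWith_cos.dist_le_mul x y
  ⟨h.compLp (by simp) f, h.coeFn_compLp (by simp) f⟩

lemma exists_coeFn_eq_sin (f : Lp ℝ 2 μ) : ∃ g : Lp ℝ 2 μ, ∀ᵐ x ∂μ, g x = Real.sin (f x) :=
  ⟨Real.lipschitzWith_sin.compLp Real.sin_zero f, Real.lipschitzWith_sin.coeFn_compLp _ f⟩

lemma tendsto_of_dominated {u : ℕ → Lp ℝ 2 μ} {v g : Lp ℝ 2 μ}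
    (hu : ∀ n, ∀ᵐ x ∂μ, |u n x| ≤ g x) (hv : ∀ᵐ x ∂μ, |v x| ≤ g x)
    (hlim : ∀ᵐ x ∂μ, Filter.Tendsto (fun n => u n x) Filter.atTop (nhds (v x))) :
    Filter.Tendsto u Filter.atTop (nhds v) := by
  rw [tendsto_iff_norm_sub_tendsto_zero]
  have h1 (n : ℕ) : ‖u n - v‖ ^ 2 = ∫ x, (u n x - v x) ^ 2 ∂μ := by
    rw [← real_inner_self_eq_norm_sq, L2.inner_def]
    refine integral_congr_ae ?_
    filter_upwards [Lp.coeFn_sub (u n) v] with x h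
    rw [h, Pi.sub_apply, real_inner_self_eq_norm_sq, Real.norm_eq_abs, sq_abs]
  have h2 : Filter.Tendsto (fun n => ‖u n - v‖ ^ 2) Filter.atTop (nhds (∫ _, (0 : ℝ) ∂μ)) := by
    simp only [h1]
    refine tendsto_integral_of_dominated_convergence (fun x => 4 * (g x) ^ 2)
      (fun n => (((Lp.memLp (u n)).sub (Lp.memLp v)).integrable_sq).aestronglyMeasurable)
      ((Lp.memLp g).integrable_sq.const_mul 4) (fun n => ?_) ?_
    · filter_upwards [hu n, hv] with x h3 h4
      rw [Real.norm_eq_abs, abs_of_nonneg (sq_nonneg _)]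
      have h5 := abs_le.1 h3
      have h6 := abs_le.1 h4
      nlinarith
    · filter_upwards [hlim] with x h
      simpa using (h.sub_const (v x)).pow 2
  rw [integral_zero] at h2
  simpa [Real.sqrt_sq_eq_abs] using h2.sqrt

variable {K : Submodule ℝ (Lp ℝ 2 μ)}

lemma IsTrigStable.sharpen_mem (hK : IsTrigStable K) {f : Lp ℝ 2 μ} (hf : f ∈ K) :
    ∃ g ∈ K, ∀ᵐ x ∂μ, g x = sharpen (f x) := by
  obtain ⟨s, hs⟩ := exists_coeFn_eq_sin ((2 * Real.pi) • f)
  refine ⟨f - (2 * Real.pi)⁻¹ • s, K.sub_mem hf (K.smul_mem _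
    (hK.sin_mem _ (K.smul_mem _ hf) s hs)), ?_⟩
  filter_upwards [hs, Lp.coeFn_smul (2 * Real.pi) f, Lp.coeFn_smul (2 * Real.pi)⁻¹ s,
    Lp.coeFn_sub f ((2 * Real.pi)⁻¹ • s)] with x h1 h2 h3 h4
  rw [h4, Pi.sub_apply, h3, Pi.smul_apply, h1, h2, sharpen]
  rfl

lemma IsTrigStable.iterate_sharpen_mem (hK : IsTrigStable K) {f : Lp ℝ 2 μ} (hf : f ∈ K) (n : ℕ) :
    ∃ g ∈ K, ∀ᵐ x ∂μ, g x = sharpen^[n] (f x) := by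
  induction n with
  | zero => exact ⟨f, hf, Filter.Eventually.of_forall fun _ => rfl⟩
  | succ n ih =>
    obtain ⟨g, hg, h1⟩ := ih
    obtain ⟨g', hg', h2⟩ := hK.sharpen_mem hg
    refine ⟨g', hg', ?_⟩
    filter_upwards [h1, h2] with x h1 h2
    rw [h2, h1, Function.iterate_succ_apply']

lemma IsTrigStable.sharpenLim_mem (hK : IsTrigStable K) {f : Lp ℝ 2 μ} (hf : f ∈ K)
    (h01 : ∀ᵐ x ∂μ, 0 ≤ f x ∧ f x ≤ 1) : ∃ v ∈ K, ∀ᵐ x ∂μ, v x = sharpenLim (f x) := by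
  choose u hu hux using fun n => hK.iterate_sharpen_mem hf n
  have hv : MemLp (fun x => sharpenLim (f x)) 2 μ := by
    refine MemLp.of_le ((Lp.memLp f).const_mul 2)
      (measurable_sharpenLim.comp_aemeasurable (Lp.aestronglyMeasurable f).aemeasurable
        ).aestronglyMeasurable ?_
    filter_upwards [h01] with x h
    exact (abs_sharpenLim_le h.1 h.2).trans (le_abs_self _)
  have h2 : ∀ᵐ x ∂μ, (2 * f x) = ((2 : ℝ) • f : Lp ℝ 2 μ) x :=
    (Lp.coeFn_smul (2 : ℝ) f).mono fun x h => h.symm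
  refine ⟨hv.toLp _, hK.isClosed.mem_of_tendsto (tendsto_of_dominated (g := (2 : ℝ) • f)
    (fun n => ?_) ?_ ?_) (Filter.Eventually.of_forall hu), hv.coeFn_toLp⟩
  · filter_upwards [hux n, h2, h01] with x h1 h2 h3
    rw [h1, ← h2]
    exact abs_iterate_sharpen_le n h3.1 h3.2
  · filter_upwards [hv.coeFn_toLp, h2, h01] with x h1 h2 h3
    rw [h1, ← h2]
    exact abs_sharpenLim_le h3.1 h3.2
  · filter_upwards [ae_all_iff.2 hux, hv.coeFn_toLp, h01] with x h1 h2 h3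
    simp only [h1, h2]
    exact tendsto_iterate_sharpen h3.1 h3.2

/-- Countably many dyadic annuli cover the non-zero values. -/
lemma exists_measure_annulus_ne_zero {f : X → ℝ} (hf : ¬ f =ᵐ[μ] 0) :
    ∃ c : ℝ, 0 < c ∧ μ {x | c ≤ |f x| ∧ |f x| ≤ 2 * c} ≠ 0 := by
  by_contra! h
  refine hf ?_
  have h1 : ∀ᵐ x ∂μ, ∀ n : ℤ, ¬ ((2 : ℝ) ^ n ≤ |f x| ∧ |f x| ≤ 2 * 2 ^ n) :=
    ae_all_iff.2 fun n => measure_eq_zero_iff_ae_notMem.1 (h (2 ^ n) (by positivity))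
  filter_upwards [h1] with x hx
  by_contra h0
  obtain ⟨n, h2, h3⟩ := exists_mem_Ico_zpow (abs_pos.2 h0) one_lt_two
  refine hx n ⟨h2, h3.le.trans ?_⟩
  rw [zpow_add_one₀ two_ne_zero, mul_comm]

/-- A nonzero trigonometrically stable subspace contains the indicator of a non-null set. -/
lemma IsTrigStable.exists_indLp_mem (hK : IsTrigStable K) {f : Lp ℝ 2 μ} (hf : f ∈ K)
    (hf0 : f ≠ 0) : ∃ A : FiniteMeasureSet μ, μ A.1 ≠ 0 ∧ indLp ℝ A ∈ K := by
  obtain ⟨c, hc, hfc⟩ := exists_measure_annulus_ne_zero (μ := μ) (f := f)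
    fun h => hf0 ((Lp.eq_zero_iff_ae_eq_zero).2 h)
  -- The factor π/(2c) sends the values with c ≤ |f| ≤ 2c to [π/2, π] in modulus, where the cosine
  -- is non-positive. Hence u = (1 - cos)/2 has values in [0, 1] and is at least 1/2 on the non-null
  -- annulus.
  obtain ⟨g, hg⟩ := exists_coeFn_eq_cos ((Real.pi / (2 * c)) • f)
  have hgK := hK.cos_mem _ (K.smul_mem _ hf) g hg
  set u : Lp ℝ 2 μ := (-1 / 2 : ℝ) • g with hu
  have huf : ∀ᵐ x ∂μ, u x = (1 - Real.cos (Real.pi / (2 * c) * f x)) / 2 := by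
    filter_upwards [Lp.coeFn_smul (-1 / 2 : ℝ) g, hg, Lp.coeFn_smul (Real.pi / (2 * c)) f]
      with x h1 h2 h3
    rw [hu, h1, Pi.smul_apply, h2, h3, Pi.smul_apply, smul_eq_mul, smul_eq_mul]
    ring
  have h01 : ∀ᵐ x ∂μ, 0 ≤ u x ∧ u x ≤ 1 := by
    filter_upwards [huf] with x h
    rw [h]
    constructor <;>
      linarith [Real.neg_one_le_cos (Real.pi / (2 * c) * f x),
        Real.cos_le_one (Real.pi / (2 * c) * f x)]
  obtain ⟨v, hvK, hv⟩ := hK.sharpenLim_mem (f := u) (K.smul_mem _ hgK) h01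
  have hA : MeasurableSet {x | 1 / 2 ≤ u x} :=
    measurableSet_le measurable_const (Lp.stronglyMeasurable u).measurable
  have hfin : μ {x | 1 / 2 ≤ u x} < ∞ := by
    refine (measure_mono fun x hx => ?_).trans_lt ((Lp.memLp u).meas_ge_lt_top (ε := 1 / 2)
      two_ne_zero ENNReal.ofNat_ne_top (by norm_num))
    have h : (1 / 2 : ℝ) ≤ u x := hx
    rw [mem_ofPred_eq, ← NNReal.coe_le_coe, coe_nnnorm]
    exact le_trans (by norm_num; linarith) (le_abs_self _)
  refine ⟨⟨_, hA, hfin⟩, fun h0 => hfc ?_, ?_⟩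
  · refine measure_mono_null_ae ?_ h0
    filter_upwards [huf] with x h1 h2
    change 1 / 2 ≤ u x
    have hp := Real.pi_pos
    have h3 : Real.cos (Real.pi / (2 * c) * f x) ≤ 0 := by
      rw [← Real.cos_abs, abs_mul, abs_of_pos (by positivity)]
      refine Real.cos_nonpos_of_pi_div_two_le_of_le ?_ ?_
      · calc Real.pi / 2 = Real.pi / (2 * c) * c := by field_simp
          _ ≤ _ := by gcongr; exact h2.1
      · calc Real.pi / (2 * c) * |f x| ≤ Real.pi / (2 * c) * (2 * c) := by gcongr; exact h2.2
          _ = Real.pi := by field_simp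
          _ ≤ _ := by linarith
    rw [h1]
    linarith
  -- On the three values 0, 1/2, 1 of v, the combination (1 - cos πv)/2 + (1 - cos 2πv)/4 equals 0,
  -- 1, 1: it is the indicator of {u ≥ 1/2}.
  · obtain ⟨g₁, hg₁⟩ := exists_coeFn_eq_cos (Real.pi • v)
    obtain ⟨g₂, hg₂⟩ := exists_coeFn_eq_cos ((2 * Real.pi) • v)
    have hm : (-1 / 2 : ℝ) • g₁ + (-1 / 4 : ℝ) • g₂ ∈ K :=
      K.add_mem (K.smul_mem _ (hK.cos_mem _ (K.smul_mem _ hvK) _ hg₁))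
        (K.smul_mem _ (hK.cos_mem _ (K.smul_mem _ hvK) _ hg₂))
    convert! hm
    refine Lp.ext ?_
    filter_upwards [coeFn_indLp ℝ (⟨_, hA, hfin⟩ : FiniteMeasureSet μ), hg₁, hg₂, hv,
      Lp.coeFn_smul Real.pi v, Lp.coeFn_smul (2 * Real.pi) v, Lp.coeFn_smul (-1 / 2 : ℝ) g₁,
      Lp.coeFn_smul (-1 / 4 : ℝ) g₂, Lp.coeFn_add ((-1 / 2 : ℝ) • g₁) ((-1 / 4 : ℝ) • g₂)]
      with x h1 h2 h3 h4 h5 h6 h7 h8 h9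
    rw [h1, h9, Pi.add_apply, h7, h8, Pi.smul_apply, Pi.smul_apply, h2, h3, h5, h6, Pi.smul_apply,
      Pi.smul_apply, h4]
    simp only [sharpenLim, indicator, mem_ofPred_eq, smul_eq_mul]
    by_cases c1 : u x < 1 / 2
    · rw [if_neg (not_le.2 c1), if_pos c1]
      simp
    · by_cases c2 : u x = 1 / 2
      · rw [if_pos (not_lt.1 c1), if_neg c1, if_pos c2, show 2 * Real.pi * (1 / 2) = Real.pi by ring,
          mul_one_div, Real.cos_pi_div_two, Real.cos_pi]
        norm_num
      · rw [if_pos (not_lt.1 c1), if_neg c1, if_neg c2, mul_one, mul_one, Real.cos_pi,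
          Real.cos_two_pi]
        norm_num

lemma IsTrigStable.indLp_inter_mem (hK : IsTrigStable K) {A B : FiniteMeasureSet μ}
    (hA : indLp ℝ A ∈ K) (hB : indLp ℝ B ∈ K) {D : FiniteMeasureSet μ} (hD : D.1 = A.1 ∩ B.1) :
    indLp ℝ D ∈ K := by
  obtain ⟨g, hg⟩ := exists_coeFn_eq_cos (Real.pi • (indLp ℝ A + indLp ℝ B))
  -- For t = 1_A + 1_B, the expression t/2 + (cos πt - 1)/4 is 0, 0, 1 at t = 0, 1, 2.
  have hm : (1 / 2 : ℝ) • (indLp ℝ A + indLp ℝ B) + (1 / 4 : ℝ) • g ∈ K :=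
    K.add_mem (K.smul_mem _ (K.add_mem hA hB)) (K.smul_mem _
      (hK.cos_mem _ (K.smul_mem _ (K.add_mem hA hB)) _ hg))
  convert! hm
  refine Lp.ext ?_
  filter_upwards [hg, coeFn_indLp ℝ A, coeFn_indLp ℝ B, coeFn_indLp ℝ D,
    Lp.coeFn_add (indLp ℝ A) (indLp ℝ B), Lp.coeFn_smul Real.pi (indLp ℝ A + indLp ℝ B),
    Lp.coeFn_smul (1 / 2 : ℝ) (indLp ℝ A + indLp ℝ B), Lp.coeFn_smul (1 / 4 : ℝ) g,
    Lp.coeFn_add ((1 / 2 : ℝ) • (indLp ℝ A + indLp ℝ B)) ((1 / 4 : ℝ) • g)]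
    with x h1 h2 h3 h4 h5 h6 h7 h8 h9
  rw [h4, h9, Pi.add_apply, h7, h8, Pi.smul_apply, Pi.smul_apply, h1, h6, Pi.smul_apply, h5,
    Pi.add_apply, h2, h3, hD]
  simp only [indicator, smul_eq_mul]
  by_cases c1 : x ∈ A.1 <;> by_cases c2 : x ∈ B.1
  · rw [if_pos (mem_inter c1 c2), if_pos c1, if_pos c2,
      show Real.pi * (1 + 1) = 2 * Real.pi by ring, Real.cos_two_pi]
    norm_num
  · simp [c1, c2]
    norm_num
  · simp [c1, c2]
    norm_num
  · simp [c1, c2]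

end TrigStable

/-! ### The invariant σ-finite σ-algebra attached to a stable subspace -/

section StableSigmaAlgebra

variable {X : Type*} [MeasurableSpace X] {μ : Measure X} {K : Submodule ℝ (Lp ℝ 2 μ)}

lemma indLp_eq_zero {A : FiniteMeasureSet μ} (hA : μ A.1 = 0) : indLp ℝ A = 0 := by
  refine Lp.ext ?_
  filter_upwards [coeFn_indLp ℝ A, Lp.coeFn_zero ℝ 2 μ, measure_eq_zero_iff_ae_notMem.1 hA]
    with x h1 h2 h3
  rw [h1, h2, indicator_of_notMem h3, Pi.zero_apply]

lemma indLp_diff {A B D : FiniteMeasureSet μ} (hBA : B.1 ⊆ A.1) (hD : D.1 = A.1 \ B.1) :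
    indLp ℝ D = indLp ℝ A - indLp ℝ B := by
  refine Lp.ext ?_
  filter_upwards [coeFn_indLp ℝ A, coeFn_indLp ℝ B, coeFn_indLp ℝ D,
    Lp.coeFn_sub (indLp ℝ A) (indLp ℝ B)] with x h1 h2 h3 h4
  rw [h3, h4, Pi.sub_apply, h1, h2, hD]
  have := @hBA x
  by_cases c1 : x ∈ A.1 <;> by_cases c2 : x ∈ B.1 <;> simp_all

/-- The intersection of a set of finite measure with a measurable set. -/
abbrev FiniteMeasureSet.inter (A : FiniteMeasureSet μ) {B : Set X} (hB : MeasurableSet B) :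
    FiniteMeasureSet μ :=
  ⟨A.1 ∩ B, A.2.1.inter hB, (measure_mono inter_subset_left).trans_lt A.2.2⟩

lemma IsTrigStable.iUnion_mem (hK : IsTrigStable K) {A : FiniteMeasureSet μ} {B : ℕ → Set X}
    (hB : ∀ n, MeasurableSet (B n)) (hmono : Monotone B)
    (h : ∀ n, indLp ℝ (A.inter (hB n)) ∈ K) : indLp ℝ (A.inter (MeasurableSet.iUnion hB)) ∈ K := by
  have hle {B : Set X} (hB : MeasurableSet B) : ∀ᵐ x ∂μ, |indLp ℝ (A.inter hB) x| ≤ indLp ℝ A x := by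
    filter_upwards [coeFn_indLp ℝ A, coeFn_indLp ℝ (A.inter hB)] with x h1 h2
    rw [h1, h2, abs_of_nonneg (indicator_nonneg (fun _ _ => zero_le_one) _)]
    exact indicator_le_indicator_of_subset inter_subset_left (fun _ => zero_le_one) x
  refine hK.isClosed.mem_of_tendsto (tendsto_of_dominated (g := indLp ℝ A) (fun n => hle (hB n))
    (hle (MeasurableSet.iUnion hB)) ?_) (Filter.Eventually.of_forall h)
  filter_upwards [ae_all_iff.2 fun n => coeFn_indLp ℝ (A.inter (hB n)),
    coeFn_indLp ℝ (A.inter (MeasurableSet.iUnion hB))] with x h1 h2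
  simp only [h1, h2, inter_iUnion]
  exact (Monotone.tendsto_indicator (fun n => A.1 ∩ B n)
    (fun _ _ hij => inter_subset_inter_right _ (hmono hij)) (fun _ => (1 : ℝ)) x).mono_right (pure_le_nhds _)

/-- The σ-algebra of the sets `B` such that, for `A` of finite measure, the indicator function of
`A ∩ B` belongs to `K` when that of `A` does. -/
abbrev stableSigmaAlgebra (hK : IsTrigStable K) : MeasurableSpace X where
  MeasurableSet' B := ∃ hB : MeasurableSet B,
    ∀ A : FiniteMeasureSet μ, indLp ℝ A ∈ K → indLp ℝ (A.inter hB) ∈ K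
  measurableSet_empty := ⟨MeasurableSet.empty, fun A _ => by
    rw [indLp_eq_zero (by simp)]
    exact K.zero_mem⟩
  measurableSet_compl := fun B ⟨hB, h⟩ => ⟨hB.compl, fun A hA => by
    rw [indLp_diff (A := A) (B := A.inter hB) inter_subset_left (by simp [sdiff_eq, compl_inter,
      inter_union_distrib_left])]
    exact K.sub_mem hA (h A hA)⟩
  measurableSet_iUnion := fun B h => by
    choose hB h using h
    have hunion {B B' : Set X} (hB : MeasurableSet B) (hB' : MeasurableSet B')
        (h : ∀ A : FiniteMeasureSet μ, indLp ℝ A ∈ K → indLp ℝ (A.inter hB) ∈ K)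
        (h' : ∀ A : FiniteMeasureSet μ, indLp ℝ A ∈ K → indLp ℝ (A.inter hB') ∈ K)
        (A : FiniteMeasureSet μ) (hA : indLp ℝ A ∈ K) : indLp ℝ (A.inter (hB.union hB')) ∈ K := by
      have e : indLp ℝ (A.inter (hB.union hB')) = indLp ℝ (A.inter hB) + (indLp ℝ (A.inter hB') -
          indLp ℝ ((A.inter hB).inter hB')) := by
        rw [← sub_eq_iff_eq_add', ← indLp_diff (A := A.inter (hB.union hB')) (B := A.inter hB)
          (D := (A.inter hB').inter hB.compl) (inter_subset_inter_right _ subset_union_left)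
          (by ext; simp; tauto)]
        exact indLp_diff (fun x hx => ⟨hx.1.1, hx.2⟩) (by ext; simp; tauto)
      rw [e]
      exact K.add_mem (h A hA) (K.sub_mem (h' A hA) (h' _ (h A hA)))
    -- Partial unions reduce countable unions to increasing ones, for which dominated convergence in
    -- the closed K applies.
    have hacc (n : ℕ) : MeasurableSet (accumulate B n) :=
      MeasurableSet.biUnion (to_countable _) fun i _ => hB i
    have hacc' (n : ℕ) : ∀ A : FiniteMeasureSet μ, indLp ℝ A ∈ K →
        indLp ℝ (A.inter (hacc n)) ∈ K := by
      induction n with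
      | zero =>
        have e : accumulate B 0 = B 0 := accumulate_zero_nat B
        intro A hA
        convert! h 0 A hA
      | succ n ih =>
        have e : accumulate B (n + 1) = accumulate B n ∪ B (n + 1) := accumulate_succ B n
        intro A hA
        convert! hunion (hacc n) (hB (n + 1)) ih (h (n + 1)) A hA
    refine ⟨MeasurableSet.iUnion hB, fun A hA => ?_⟩
    have e : A.inter (MeasurableSet.iUnion hB) = A.inter (MeasurableSet.iUnion hacc) :=
      Subtype.ext (congrArg (A.1 ∩ ·) (iUnion_accumulate (s := B)).symm)
    rw [e]
    exact hK.iUnion_mem hacc monotone_accumulate fun n => hacc' n A hA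

lemma measurableSet_stableSigmaAlgebra (hK : IsTrigStable K) {A : FiniteMeasureSet μ}
    (hA : indLp ℝ A ∈ K) : MeasurableSet[stableSigmaAlgebra hK] A.1 :=
  ⟨A.2.1, fun _ hB => hK.indLp_inter_mem hB hA rfl⟩

/-- The preimage of a set of finite measure. -/
abbrev FiniteMeasureSet.preimage {T : X ≃ᵐ X} (hT : MeasurePreserving T μ μ)
    (A : FiniteMeasureSet μ) : FiniteMeasureSet μ :=
  ⟨T ⁻¹' A.1, T.measurable A.2.1, by
    rw [hT.measure_preimage A.2.1.nullMeasurableSet]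
    exact A.2.2⟩

/-- Invariance of the set of indicator functions in `K`. -/
def IsPreimageStable (K : Submodule ℝ (Lp ℝ 2 μ)) (T : X ≃ᵐ X) : Prop :=
  ∀ A B : FiniteMeasureSet μ, B.1 = T ⁻¹' A.1 → indLp ℝ A ∈ K → indLp ℝ B ∈ K

lemma stableSigmaAlgebra_preimage (hK : IsTrigStable K) {T : X ≃ᵐ X}
    (hT : MeasurePreserving T μ μ) (h : IsPreimageStable K T) (h' : IsPreimageStable K T.symm)
    {B : Set X} (hB : MeasurableSet[stableSigmaAlgebra hK] B) :
    MeasurableSet[stableSigmaAlgebra hK] (T ⁻¹' B) := by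
  obtain ⟨hBm, hB⟩ := hB
  refine ⟨T.measurable hBm, fun A hA => ?_⟩
  have hT' : MeasurePreserving T.symm μ μ := hT.symm T
  -- A ∩ T⁻¹B = T⁻¹(TA ∩ B), which uses stability under both T and its inverse.
  refine h ((A.preimage hT').inter hBm) _ ?_ (hB _ (h' A _ rfl hA))
  ext x
  simp

lemma comap_stableSigmaAlgebra (hK : IsTrigStable K) {T : X ≃ᵐ X}
    (hT : MeasurePreserving T μ μ) (h : IsPreimageStable K T) (h' : IsPreimageStable K T.symm) :
    (stableSigmaAlgebra hK).comap T = stableSigmaAlgebra hK := by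
  refine le_antisymm ?_ fun B hB => ?_
  · rintro _ ⟨B, hB, rfl⟩
    exact stableSigmaAlgebra_preimage hK hT h h' hB
  · refine ⟨T.symm ⁻¹' B, stableSigmaAlgebra_preimage hK (hT.symm T) h' h hB, ?_⟩
    ext x
    simp

/-- By ergodicity, a non-null set in a stable subspace has translates which cover the space. -/
lemma exists_countable_cover {T : X ≃ᵐ X}
    (hT : Ergodic T μ) (h : IsPreimageStable K T) (h' : IsPreimageStable K T.symm)
    {A : FiniteMeasureSet μ} (hA : indLp ℝ A ∈ K) (hA0 : μ A.1 ≠ 0) :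
    ∃ s : ℕ → FiniteMeasureSet μ, (∀ n, indLp ℝ (s n) ∈ K) ∧ ⋃ n, (s n).1 = univ := by
  have hTm := hT.toMeasurePreserving
  have key : ∀ n : ℤ, ∃ B : FiniteMeasureSet μ, B.1 = ⇑(T.toEquiv ^ n : Equiv.Perm X) ⁻¹' A.1 ∧
      indLp ℝ B ∈ K := by
    intro n
    induction n using Int.induction_on with
    | zero => exact ⟨A, by simp, hA⟩
    | succ n ih =>
      obtain ⟨B, hB, hBK⟩ := ih
      refine ⟨B.preimage hTm, ?_, h B _ rfl hBK⟩
      rw [zpow_add_one]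
      ext x
      simp [hB]
    | pred n ih =>
      obtain ⟨B, hB, hBK⟩ := ih
      refine ⟨B.preimage (hTm.symm T), ?_, h' B _ rfl hBK⟩
      rw [zpow_sub_one]
      ext x
      simp [hB]
  choose B hB hBK using key
  set U : Set X := ⋃ n, (B n).1 with hU
  have hUm : MeasurableSet U := MeasurableSet.iUnion fun n => (B n).2.1
  have hUT : T ⁻¹' U = U := by
    rw [hU, preimage_iUnion]
    refine iUnion_congr_of_surjective (fun n => n + 1) (Equiv.addRight (1 : ℤ)).surjective
      fun n => ?_
    rw [hB, hB, zpow_add_one]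
    rfl
  have hU0 : μ Uᶜ = 0 := by
    rcases hT.measure_self_or_compl_eq_zero hUm hUT with h0 | h0
    · refine absurd (measure_mono_null ?_ h0) hA0
      have : (B 0).1 = A.1 := by rw [hB]; simp
      rw [← this]
      exact subset_iUnion (fun n => (B n).1) 0
    · exact h0
  -- The null set left over by the translates is added as one more member, so that the cover is
  -- exact; its indicator is zero in L².
  let s : Option ℤ → FiniteMeasureSet μ := fun k => k.elim ⟨Uᶜ, hUm.compl, by simp [hU0]⟩ B
  obtain ⟨e, he⟩ := exists_surjective_nat (Option ℤ)
  refine ⟨s ∘ e, fun n => ?_, ?_⟩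
  · rcases h : e n with _ | k
    · rw [Function.comp_apply, h, indLp_eq_zero hU0]
      exact K.zero_mem
    · rw [Function.comp_apply, h]
      exact hBK k
  · exact (he.iUnion_comp fun k => (s k).1).trans ((iUnion_option _).trans (compl_union_self U))

end StableSigmaAlgebra

/-! ### Measurability modulo null sets -/

section AEMeasurability

variable {Ω : Type*} {C mΩ : MeasurableSpace Ω} {P : Measure Ω}

lemma aestronglyMeasurable_reLp {F : Lp ℂ 2 P} (hF : AEStronglyMeasurable[C] F P) :
    AEStronglyMeasurable[C] (reLp P F) P :=
  (Complex.continuous_re.comp_aestronglyMeasurable hF).congr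
    ((coeFn_reLp F).mono fun _ h => h.symm)

lemma aestronglyMeasurable_imLp {F : Lp ℂ 2 P} (hF : AEStronglyMeasurable[C] F P) :
    AEStronglyMeasurable[C] (imLp P F) P :=
  (Complex.continuous_im.comp_aestronglyMeasurable hF).congr
    ((coeFn_imLp F).mono fun _ h => h.symm)

lemma aestronglyMeasurable_smul_expLp {F : Lp ℝ 2 P} (hF : AEStronglyMeasurable[C] F P) (c : ℂ) :
    AEStronglyMeasurable[C] (c • expLp F : Lp ℂ 2 P) P := by
  have h : AEStronglyMeasurable[C] (expLp F) P :=
    (lipschitzWith_expSubOne.continuous.comp_aestronglyMeasurable hF).congr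
      ((coeFn_expLp F).mono fun _ h => h.symm)
  exact (h.const_smul c).congr (Lp.coeFn_smul c _).symm

lemma eventuallyMeasurable_of_aestronglyMeasurable {f : Ω → ℝ} (hf : AEStronglyMeasurable[C] f P) :
    Measurable[eventuallyMeasurableSpace C (ae P)] f :=
  Measurable.eventuallyMeasurable_of_eventuallyEq hf.stronglyMeasurable_mk.measurable hf.ae_eq_mk

lemma leMod_iff_le_eventuallyMeasurableSpace {D : MeasurableSpace Ω} :
    LeMod P D C ↔ D ≤ eventuallyMeasurableSpace C (ae P) := Iff.rfl

lemma aestronglyMeasurable_comp {S : Ω → Ω} (hS : MeasurePreserving S P P) (hC : C.comap S = C)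
    {f : Ω → ℝ} (hf : AEStronglyMeasurable[C] f P) : AEStronglyMeasurable[C] (f ∘ S) P := by
  have h : Measurable[C, C] S := measurable_iff_comap_le.2 hC.le
  exact ⟨hf.mk f ∘ S, hf.stronglyMeasurable_mk.comp_measurable h,
    hS.quasiMeasurePreserving.ae_eq_comp hf.ae_eq_mk⟩

end AEMeasurability

/-! ### The functions whose stochastic integral is measurable for the factor -/

section MeasurableKernel

variable {X : Type*} [MeasurableSpace X] {μ : Measure X} {P : Measure (CountingMeasures X)}

/-- The functions, the stochastic integral of which is `C`-measurable. -/
noncomputable def measurableKernel (hP : IsPoissonProcess μ P)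
    (C : MeasurableSpace (CountingMeasures X)) : Submodule ℝ (Lp ℝ 2 μ) where
  carrier := {f | AEStronglyMeasurable[C] (realInt hP f) P}
  add_mem' {f g} hf hg := by
    rw [mem_ofPred_eq, map_add]
    exact (hf.add hg).congr (Lp.coeFn_add _ _).symm
  zero_mem' := by
    rw [mem_ofPred_eq, map_zero]
    exact aestronglyMeasurable_zero.congr (Lp.coeFn_zero ℝ 2 P).symm
  smul_mem' c f hf := by
    rw [mem_ofPred_eq, map_smul]
    exact (hf.const_smul c).congr (Lp.coeFn_smul _ _).symm

lemma mem_measurableKernel (hP : IsPoissonProcess μ P) {C : MeasurableSpace (CountingMeasures X)}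
    {f : Lp ℝ 2 μ} :
    f ∈ measurableKernel hP C ↔ AEStronglyMeasurable[C] (realInt hP f) P := Iff.rfl

lemma indLp_mem_measurableKernel (hP : IsPoissonProcess μ P)
    {C : MeasurableSpace (CountingMeasures X)} {A : FiniteMeasureSet μ} :
    indLp ℝ A ∈ measurableKernel hP C ↔ AEStronglyMeasurable[C] (ctr μ A.1) P :=
  aestronglyMeasurable_congr (coeFn_realInt_indLp hP A)

/-- Dividing by the non-vanishing characteristic function makes I(exp(if) - 1) exactly the
projection on the first chaos of a multiple of exp(i I(f)) - 1. -/
lemma inner_smul_expLp_sub_stochInt (hP : IsPoissonProcess μ P) (f : Lp ℝ 2 μ) {F : Lp ℂ 2 P}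
    (hF : F ∈ chaos μ P 1) :
    inner ℂ F ((charInt hP f)⁻¹ • expLp (realInt hP f) - stochInt hP (expLp f)) = 0 := by
  obtain ⟨g, rfl⟩ := exists_stochInt_eq hP hF
  rw [inner_sub_right, inner_smul_right, inner_stochInt_expLp, LinearIsometry.inner_map_map,
    inv_mul_cancel_left₀ (charInt_ne_zero hP f), sub_self]

/-- The variable exp(i I(f)) - 1 is C-measurable with I(f), and invariance of the first chaos under
conditional expectation passes this on to its projection. -/
lemma stochInt_expLp_measurable (hP : IsPoissonProcess μ P)
    {C : MeasurableSpace (CountingMeasures X)} (hm : C ≤ instMeasurableSpaceCountingMeasures)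
    (hCP : ∀ F ∈ chaos μ P 1, (condExpL2 ℂ ℂ hm F : Lp ℂ 2 P) ∈ chaos μ P 1)
    {f : Lp ℝ 2 μ} (hf : f ∈ measurableKernel hP C) :
    AEStronglyMeasurable[C] (stochInt hP (expLp f)) P :=
  aestronglyMeasurable_component hm hCP
    (aestronglyMeasurable_smul_expLp hf (charInt hP f)⁻¹) (stochInt_mem_chaos hP _)
    fun _ hx => inner_smul_expLp_sub_stochInt hP f hx

lemma isTrigStable_measurableKernel (hP : IsPoissonProcess μ P)
    {C : MeasurableSpace (CountingMeasures X)} (hm : C ≤ instMeasurableSpaceCountingMeasures)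
    (hCP : ∀ F ∈ chaos μ P 1, (condExpL2 ℂ ℂ hm F : Lp ℂ 2 P) ∈ chaos μ P 1) :
    IsTrigStable (measurableKernel hP C) where
  isClosed := (isClosed_aestronglyMeasurable hm).preimage (realInt hP).continuous
  cos_mem f hf g hg := by
    have e : g = reLp μ (expLp f) := Lp.ext <| by
      filter_upwards [hg, coeFn_reLp (expLp f), coeFn_expLp f] with x h1 h2 h3
      rw [h1, h2, h3, mul_comm, Complex.sub_re, Complex.exp_ofReal_mul_I_re, Complex.one_re]
    rw [mem_measurableKernel, e, ← (reLp_stochInt_and_imLp_stochInt hP (expLp f)).1]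
    exact aestronglyMeasurable_reLp (stochInt_expLp_measurable hP hm hCP hf)
  sin_mem f hf g hg := by
    have e : g = imLp μ (expLp f) := Lp.ext <| by
      filter_upwards [hg, coeFn_imLp (expLp f), coeFn_expLp f] with x h1 h2 h3
      rw [h1, h2, h3, mul_comm, Complex.sub_im, Complex.exp_ofReal_mul_I_im, Complex.one_im,
        sub_zero]
    rw [mem_measurableKernel, e, ← (reLp_stochInt_and_imLp_stochInt hP (expLp f)).2]
    exact aestronglyMeasurable_imLp (stochInt_expLp_measurable hP hm hCP hf)

lemma exists_ne_zero_mem_measurableKernel (hP : IsPoissonProcess μ P)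
    {C : MeasurableSpace (CountingMeasures X)} {F : Lp ℂ 2 P} (hF : F ∈ chaos μ P 1)
    (hFC : AEStronglyMeasurable[C] F P) (hF0 : F ≠ 0) :
    ∃ f ∈ measurableKernel hP C, f ≠ 0 := by
  obtain ⟨g, rfl⟩ := exists_stochInt_eq hP hF
  obtain ⟨h1, h2⟩ := reLp_stochInt_and_imLp_stochInt hP g
  by_cases hg : reLp μ g = 0
  · refine ⟨imLp μ g, ?_, fun hg' => hF0 ?_⟩
    · rw [mem_measurableKernel, ← h2]
      exact aestronglyMeasurable_imLp hFC
    · rw [← ofRealLp_reLp_add g, hg, hg', map_zero, smul_zero, add_zero, map_zero]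
  · refine ⟨reLp μ g, ?_, hg⟩
    rw [mem_measurableKernel, ← h1]
    exact aestronglyMeasurable_reLp hFC

lemma ctr_preimage {T : X ≃ᵐ X} (hT : MeasurePreserving T μ μ) {A : Set X} (hA : MeasurableSet A) :
    ctr μ (T ⁻¹' A) = ctr μ A ∘ suspension T := by
  funext ν
  rw [Function.comp_apply, ctr, ctr, N_suspension T hA, hT.measure_preimage hA.nullMeasurableSet]

/-- N(T⁻¹A) = N(A) ∘ T_*, and composition with T_* preserves measurability for an invariant C. -/
lemma isPreimageStable_measurableKernel [SigmaFinite μ] (hP : IsPoissonProcess μ P) {T : X ≃ᵐ X}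
    (hT : MeasurePreserving T μ μ) {C : MeasurableSpace (CountingMeasures X)}
    (hC : C.comap (suspension T) = C) : IsPreimageStable (measurableKernel hP C) T := by
  intro A B hB hA
  rw [indLp_mem_measurableKernel] at hA ⊢
  rw [hB, ctr_preimage hT A.2.1]
  exact aestronglyMeasurable_comp (measurePreserving_suspension hT hP) hC hA

lemma suspension_comp_symm (T : X ≃ᵐ X) : suspension T ∘ suspension T.symm = id := by
  funext ν
  refine Subtype.ext ?_
  change (ν.1.map T.symm).map T = ν.1
  rw [Measure.map_map T.measurable T.symm.measurable]
  simp

lemma comap_suspension_symm {T : X ≃ᵐ X} {C : MeasurableSpace (CountingMeasures X)}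
    (hC : C.comap (suspension T) = C) : C.comap (suspension T.symm) = C := by
  conv_lhs => rw [← hC]
  rw [MeasurableSpace.comap_comp, suspension_comp_symm, MeasurableSpace.comap_id]

lemma measurable_N_of_mem_measurableKernel (hP : IsPoissonProcess μ P)
    {C : MeasurableSpace (CountingMeasures X)} {A : FiniteMeasureSet μ}
    (hA : indLp ℝ A ∈ measurableKernel hP C) :
    Measurable[eventuallyMeasurableSpace C (ae P)] (N A.1) := by
  have h := eventuallyMeasurable_of_aestronglyMeasurable ((indLp_mem_measurableKernel hP).1 hA)
  refine EventuallyMeasurable.congr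
    (ENNReal.measurable_ofReal.comp_eventuallyMeasurable (h.add_const (μ A.1).toReal)) ?_
  filter_upwards [hP.ae_N_lt_top A.2.1 A.2.2] with ν hν
  simp only [Function.comp_apply, ctr, sub_add_cancel]
  exact (ENNReal.ofReal_toReal hν.ne).symm

end MeasurableKernel

/-! ### The Poissonian factor and primeness -/

section Factors

variable {X : Type*} [mX : MeasurableSpace X] {μ : Measure X} {P : Measure (CountingMeasures X)}

lemma measurable_N_of_iUnion {m : MeasurableSpace (CountingMeasures X)} {B : ℕ → Set X}
    (hB : ∀ n, MeasurableSet (B n)) (hd : Pairwise (Function.onFun Disjoint B))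
    (h : ∀ n, Measurable[m] (N (B n))) : Measurable[m] (N (⋃ n, B n)) := by
  have e : N (⋃ n, B n) = fun ν => ∑' n, N (B n) ν := funext fun ν => measure_iUnion hd hB
  rw [e]
  exact Measurable.tsum h

lemma measurable_N_of_measurableSet_stableSigmaAlgebra (hP : IsPoissonProcess μ P)
    {C : MeasurableSpace (CountingMeasures X)} (hK : IsTrigStable (measurableKernel hP C))
    {s : ℕ → FiniteMeasureSet μ} (hs : ∀ n, indLp ℝ (s n) ∈ measurableKernel hP C)
    (hU : ⋃ n, (s n).1 = univ) {B : Set X} (hB : MeasurableSet[stableSigmaAlgebra hK] B) :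
    Measurable[eventuallyMeasurableSpace C (ae P)] (N B) := by
  have hd (n : ℕ) : MeasurableSet[stableSigmaAlgebra hK] (B ∩ disjointed (fun n => (s n).1) n) :=
    hB.inter (MeasurableSet.disjointed
      (fun k => measurableSet_stableSigmaAlgebra hK (hs k)) n)
  -- The disjointed cover cuts B into pieces of finite measure with indicator in the kernel, and
  -- N(B) is the sum of their counts.
  have e : B = ⋃ n, B ∩ disjointed (fun n => (s n).1) n := by
    rw [← inter_iUnion, iUnion_disjointed, hU, inter_univ]
  rw [e]
  refine measurable_N_of_iUnion (fun n => (hd n).1) (fun i j hij => ?_) fun n => ?_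
  · exact (disjoint_disjointed (fun n => (s n).1) hij).mono inter_subset_right inter_subset_right
  · have e : B ∩ disjointed (fun n => (s n).1) n =
        ((s n).inter (hd n).1).1 :=
      (inter_eq_right.2 (inter_subset_right.trans (disjointed_subset _ n))).symm
    rw [e]
    exact measurable_N_of_mem_measurableKernel hP ((hd n).2 (s n) (hs n))

/-- A nontrivial factor of the suspension contains all the variables `N(B)`, for `B` in some
`σ`-finite factor of the base. -/
theorem exists_sigmaFiniteFactor [StandardBorelSpace X] [NullSingletonClass μ] [SigmaFinite μ]
    (hP : IsPoissonProcess μ P) {T : X ≃ᵐ X} (hT : Ergodic T μ) (hCP : PropertyCP T μ P)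
    {C : MeasurableSpace (CountingMeasures X)} (hC : IsFactor (suspension T) P C)
    (hC0 : ¬ IsTrivialMod P C) : ∃ G : Iic mX, IsSigmaFiniteFactor T μ G.1 ∧
      (∀ B, MeasurableSet[G.1] B → Measurable[eventuallyMeasurableSpace C (ae P)] (N B)) ∧
      ∃ B, MeasurableSet[G.1] B ∧ μ B ≠ 0 ∧ μ B < ∞ := by
  obtain ⟨F, hF, hFC, hF0⟩ := exists_ne_zero_mem_chaos_one hP hC.le hC0
    fun n F hF => hCP C hC n F hF
  obtain ⟨f, hf, hf0⟩ := exists_ne_zero_mem_measurableKernel hP hF hFC hF0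
  have hK := isTrigStable_measurableKernel hP hC.le fun F hF => hCP C hC 1 F hF
  obtain ⟨A, hA0, hA⟩ := hK.exists_indLp_mem hf hf0
  have hTm := hT.toMeasurePreserving
  have h := isPreimageStable_measurableKernel hP hTm hC.comap_eq
  have h' := isPreimageStable_measurableKernel hP (hTm.symm T) (comap_suspension_symm hC.comap_eq)
  obtain ⟨s, hs, hU⟩ := exists_countable_cover hT h h' hA hA0
  have hle : stableSigmaAlgebra hK ≤ mX := fun B hB => hB.1
  refine ⟨⟨stableSigmaAlgebra hK, hle⟩, ⟨⟨hle, comap_stableSigmaAlgebra hK hTm h h'⟩, ⟨⟨⟨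
    fun n => (s n).1, fun _ => trivial, fun n => ?_, hU⟩⟩⟩⟩, fun B hB =>
      measurable_N_of_measurableSet_stableSigmaAlgebra hP hK hs hU hB, A.1,
      measurableSet_stableSigmaAlgebra hK hA, hA0, A.2.2⟩
  rw [trim_measurableSet_eq hle (measurableSet_stableSigmaAlgebra hK (hs n))]
  exact (s n).2.2

/-- A `σ`-finite factor of the base, seen on the subset `univ`. -/
lemma IsSigmaFiniteFactor.comap_univ {T : X ≃ᵐ X} {G : Iic mX}
    (hG : IsSigmaFiniteFactor T μ G.1) (hT : univ ⊆ T ⁻¹' univ) :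
    IsSigmaFiniteFactor (MapsTo.restrict T univ univ hT) (restrictMeasure μ univ)
      (G.1.comap Subtype.val) := by
  have hle : G.1.comap Subtype.val ≤ (inferInstance : MeasurableSpace (univ : Set X)) :=
    MeasurableSpace.comap_mono hG.isFactor.le
  have hsf := hG.sigmaFinite
  refine ⟨⟨hle, ?_⟩, ⟨⟨⟨fun n => Subtype.val ⁻¹' spanningSets (μ.trim hG.isFactor.le) n,
    fun _ => trivial, fun n => ?_, ?_⟩⟩⟩⟩
  · conv_rhs => rw [← hG.isFactor.comap_eq]
    rw [MeasurableSpace.comap_comp, MeasurableSpace.comap_comp]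
    rfl
  · have hm := measurableSet_spanningSets (μ.trim hG.isFactor.le) n
    have hm' := comap_measurable (m := G.1) (fun x : (univ : Set X) => (x : X)) hm
    rw [trim_measurableSet_eq _ hm', restrictMeasure,
      (MeasurableEmbedding.subtype_coe MeasurableSet.univ).comap_apply,
      Subtype.image_preimage_coe, univ_inter, ← trim_measurableSet_eq hG.isFactor.le hm]
    exact measure_spanningSets_lt_top _ n
  · rw [← preimage_iUnion]
    exact (congrArg _ (iUnion_spanningSets (μ.trim hG.isFactor.le))).trans preimage_univ

/-- The event N(B) = 0 has probability exp(-μ(B)), strictly between 0 and 1. It is computed as the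
mean of 0 ^ N(B), with 0 ^ 0 = 1. -/
lemma not_isTrivialMod_of_measurable_N (hP : IsPoissonProcess μ P) {B : Set X}
    (hB : MeasurableSet B) (h0 : μ B ≠ 0) (hfin : μ B < ∞)
    {D : MeasurableSpace (CountingMeasures X)} (hD : Measurable[D] (N B)) :
    ¬ IsTrivialMod P D := by
  intro h
  have hprob := hP.isProbabilityMeasure
  have hr : (μ B).toNNReal ≠ 0 := ENNReal.toNNReal_ne_zero.2 ⟨h0, hfin.ne⟩
  have hint : ∫ ν, (0 : ℂ) ^ num B ν ∂P = Complex.exp (-((μ B).toNNReal : ℂ)) := by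
    rw [hP.integral_comp_num hB hfin fun k => (0 : ℂ) ^ k, integral_poissonMeasure_pow]
    simp
  obtain ⟨t, ht, hst⟩ := h (N B ⁻¹' {0}) (hD (measurableSet_singleton 0))
  rcases MeasurableSpace.measurableSet_bot_iff.1 ht with rfl | rfl
  · have e : ∀ᵐ ν ∂P, (0 : ℂ) ^ num B ν = 0 := by
      filter_upwards [ae_eq_empty.1 hst |> measure_eq_zero_iff_ae_notMem.1,
        hP.ae_N_eq B hB hfin] with ν h1 h2
      refine zero_pow fun h3 => h1 ?_
      rw [mem_preimage, h2, h3]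
      simp
    rw [integral_congr_ae e, integral_zero] at hint
    exact Complex.exp_ne_zero _ hint.symm
  · have e : ∀ᵐ ν ∂P, (0 : ℂ) ^ num B ν = 1 := by
      filter_upwards [measure_eq_zero_iff_ae_notMem.1 (ae_eq_univ.1 hst)] with ν h1
      have h2 : N B ν = 0 := not_not.1 h1
      rw [num, h2]
      simp
    rw [integral_congr_ae e, integral_const, probReal_univ, one_smul] at hint
    have h1 : Real.exp (-((μ B).toNNReal : ℝ)) = 1 := by
      exact_mod_cast hint.symm
    rw [Real.exp_eq_one_iff, neg_eq_zero] at h1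
    exact hr (by exact_mod_cast h1)

lemma IsPoissonMeasure.ae_N_congr [SigmaFinite μ] (hμ : μ univ = ∞) (hP : IsPoissonMeasure μ P)
    {A B : Set X} (hA : MeasurableSet A) (hB : MeasurableSet B) (h : A =ᵐ[μ] B) :
    N A =ᵐ[P] N B := by
  obtain ⟨h1, h2⟩ := ae_eq_set.1 h
  filter_upwards [hP.ae_N_eq_zero hμ (hA.diff hB) h1, hP.ae_N_eq_zero hμ (hB.diff hA) h2]
    with ν h3 h4
  exact measure_congr (ae_eq_set.2 ⟨h3, h4⟩)

/-- Primeness of the base replaces any A by a set t of G up to a null set; then N(A) = N(t) almost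
surely, and N(t) is measurable for the completion of C. These variables generate the whole
σ-algebra. -/
lemma isPrimeProbSystem_of_isPrimeInfiniteSystem [StandardBorelSpace X] [NullSingletonClass μ]
    [SigmaFinite μ] (hμ : μ univ = ∞) (hP : IsPoissonMeasure μ P) {T : X ≃ᵐ X} (hT : Ergodic T μ)
    (hCP : PropertyCP T μ P) (hprime : IsPrimeInfiniteSystem T μ) :
    IsPrimeProbSystem (suspension T) P := by
  intro C hC
  refine or_iff_not_imp_right.2 fun hC0 => ?_
  obtain ⟨G, hG, hN, -⟩ := exists_sigmaFiniteFactor (hP.isPoissonProcess hμ) hT hCP hC hC0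
  rw [leMod_iff_le_eventuallyMeasurableSpace]
  refine iSup₂_le fun A hA => Measurable.comap_le ?_
  obtain ⟨t, ht, hAt⟩ := hprime G.1 hG A hA
  exact EventuallyMeasurable.congr (hN t ht) (hP.ae_N_congr hμ hA (hG.isFactor.le t ht) hAt)

/-- The T-invariant set in the definition of a Poissonian factor is taken to be the whole of X;
non-triviality comes from a set of G of positive finite measure. -/
lemma exists_poissonianFactor [StandardBorelSpace X] [NullSingletonClass μ]
    [SigmaFinite μ] (hP : IsPoissonProcess μ P) {T : X ≃ᵐ X} (hT : Ergodic T μ)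
    (hCP : PropertyCP T μ P) {C : MeasurableSpace (CountingMeasures X)}
    (hC : IsFactor (suspension T) P C) (hC0 : ¬ IsTrivialMod P C) :
    ∃ D : MeasurableSpace (CountingMeasures X), IsPoissonianFactor T μ D ∧
      ¬ IsTrivialMod P D ∧ LeMod P D C := by
  obtain ⟨G, hG, hN, B, hB, hB0, hfin⟩ := exists_sigmaFiniteFactor hP hT hCP hC hC0
  refine ⟨_, Or.inr ⟨univ, MeasurableSet.univ, preimage_univ, G.1.comap Subtype.val,
    hG.comap_univ _, rfl⟩, ?_, ?_⟩
  · refine not_isTrivialMod_of_measurable_N hP (hG.isFactor.le B hB) hB0 hfin ?_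
    refine measurable_iff_comap_le.2 (le_iSup₂_of_le B ?_ le_rfl)
    exact ⟨Subtype.val ⁻¹' B, ⟨B, hB, rfl⟩, by simp⟩
  · rw [leMod_iff_le_eventuallyMeasurableSpace]
    refine iSup₂_le fun A hA => Measurable.comap_le ?_
    obtain ⟨_, ⟨B, hB, rfl⟩, rfl⟩ := hA
    simpa using hN B hB

end Factors

end PoissonSuspension

theorem theorem4p2 {X : Type*} [MeasurableSpace X] [StandardBorelSpace X]
    (μ : Measure X) [SigmaFinite μ] [NullSingletonClass μ] (hμ : μ Set.univ = ∞)
    (T : X ≃ᵐ X) (hT : Ergodic T μ)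
    (P : Measure (PoissonSuspension.CountingMeasures X))
    (hP : PoissonSuspension.IsPoissonMeasure μ P)
    (hCP : PoissonSuspension.PropertyCP T μ P) :
    (∀ C : MeasurableSpace (PoissonSuspension.CountingMeasures X),
      PoissonSuspension.IsFactor (PoissonSuspension.suspension T) P C →
      ¬ PoissonSuspension.IsTrivialMod P C →
      ∃ D : MeasurableSpace (PoissonSuspension.CountingMeasures X),
        PoissonSuspension.IsPoissonianFactor T μ D ∧
        ¬ PoissonSuspension.IsTrivialMod P D ∧
        PoissonSuspension.LeMod P D C) ∧
    (PoissonSuspension.IsPrimeInfiniteSystem T μ →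
      PoissonSuspension.IsPrimeProbSystem (PoissonSuspension.suspension T) P) := by
  have hP' := hP.isPoissonProcess hμ
  exact ⟨fun C hC hC0 => PoissonSuspension.exists_poissonianFactor hP' hT hCP hC hC0,
    fun hprime =>
      PoissonSuspension.isPrimeProbSystem_of_isPrimeInfiniteSystem hμ hP hT hCP hprime⟩
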